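/- Consider Unary Subset-Sum: the input is a list of integers $m_1,\dots,m_n$ and an integer $B$ (of arbitrary signs), written in unary; let $L$ be the length of the input word, $\lambda=\lfloor\log_2 L\rfloor+1$ the number of binary digits of $L$, and let $A$ be the number of sets $S\subseteq\{1,\dots,n\}$ with $\sum_{i\in S}m_i=B$. Then, in logarithmic space, logarithmically many significant bits of $A$ can be computed. More precisely, for every integer constant $K\ge 1$, with $b=K\lambda$: 1. There is a deterministic Turing machine (with read-only input tape, write-only output tape and $O(\log L)$ cells of work space) that, on every input $(m_1,\dots,m_n;B)$, outputs in binary a floating-point approximation of $A$ to $b$ significant bits, that is, integers $M,e\ge 0$ with $M<2^b$, with $M\ge 2^{b-1}$ unless $e=0$, and with $|A-M\cdot 2^e|<2^e$ (so that $M=A$ if $e=0$). 2. There is such a logarithmic-space machine that, on every input with $A\ge 2$, outputs in binary distinct primes $p_1,\dots,p_k$ whose product $N=p_1\cdots p_k$ satisfies $A<N<2A$, together with $A/N$ (which equals $A/N \bmod 1$) to $b$ bits of precision, that is, an integer $q\ge 0$ with $\left|A/N-q/2^b\right|<2^{-b}$. -/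

import Mathlib

/-! ### Deterministic logarithmic space

Deterministic Turing machines with a two-way read-only input tape, finitely many two-way
read/write work tapes, and a one-way write-only output tape. -/

/-- A head movement. -/
inductive HeadMove where
  | left
  | stay
  | right

/-- The effect of a movement on a head position of a tape with a left end at `0`:
at the left end, a movement to the left leaves the head where it is. -/
def HeadMove.apply : HeadMove → ℕ → ℕ
  | .left, i => i - 1
  | .stay, i => i
  | .right, i => i + 1

/-- What the input head can see: one of the two end markers, or a letter of the input word. -/
inductive InputCell (σ : Type) where
  | leftEnd
  | letter (a : σ)
  | rightEnd

/-- The input tape holds `⊢ w ⊣`: the left end marker in cell `0`, the letters of `w` in the cells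
`1, …, |w|` and the right end marker from cell `|w| + 1` on. -/
def inputCell {σ : Type} (w : List σ) : ℕ → InputCell σ
  | 0 => .leftEnd
  | i + 1 => match w[i]? with
    | some a => .letter a
    | none => .rightEnd

/-- What a machine does in one step: the next state, the movement of the input head, for each of
the `k` work tapes the symbol written and the head movement, and the output symbol (if any) that
is appended to the output tape. -/
structure TMAction (Q Γ δ : Type) (k : ℕ) where
  next : Q
  inputMove : HeadMove
  write : Fin k → Γ
  workMove : Fin k → HeadMove
  emit : Option δ

/-- A deterministic Turing machine with input alphabet `σ` and output alphabet `δ`. The states and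
the work alphabet are finite; `trans` is the transition table, with `none` for halting. -/
structure OfflineTM (σ δ : Type) where
  /-- the states -/
  Q : Type
  /-- the work alphabet -/
  Γ : Type
  finiteQ : Finite Q
  finiteΓ : Finite Γ
  /-- the number of work tapes -/
  k : ℕ
  start : Q
  blank : Γ
  trans : Q → InputCell σ → (Fin k → Γ) → Option (TMAction Q Γ δ k)

namespace OfflineTM

variable {σ δ : Type}

/-- A configuration: state, input head position, contents and head positions of the work tapes
(whose cells are numbered by `ℕ`), and the output written so far. -/
structure Cfg (M : OfflineTM σ δ) where
  state : M.Q
  inputHead : ℕ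
  tape : Fin M.k → ℕ → M.Γ
  head : Fin M.k → ℕ
  output : List δ

/-- The initial configuration: all work tapes blank, all heads at cell `0`, empty output. -/
def init (M : OfflineTM σ δ) : M.Cfg where
  state := M.start
  inputHead := 0
  tape := fun _ _ => M.blank
  head := fun _ => 0
  output := []

/-- One step on the input word `w`; `none` if the machine halts. The input head cannot move beyond
the cell `|w| + 1` of the right end marker. -/
def step (M : OfflineTM σ δ) (w : List σ) (c : M.Cfg) : Option M.Cfg :=
  (M.trans c.state (inputCell w c.inputHead) (fun j => c.tape j (c.head j))).map fun a =>
    { state := a.next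
      inputHead := min (a.inputMove.apply c.inputHead) (w.length + 1)
      tape := fun j => Function.update (c.tape j) (c.head j) (a.write j)
      head := fun j => (a.workMove j).apply (c.head j)
      output := c.output ++ a.emit.toList }

/-- The configuration `c` occurs in the computation on the input word `w`. -/
def Visits (M : OfflineTM σ δ) (w : List σ) (c : M.Cfg) : Prop :=
  StateTransition.Reaches (M.step w) M.init c

/-- The machine halts on the input word `w` with the word `y` on its output tape. -/
def HaltsWith (M : OfflineTM σ δ) (w : List σ) (y : List δ) : Prop :=
  ∃ c : M.Cfg, M.Visits w c ∧ M.step w c = none ∧ c.output = y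

/-- The machine halts on every input word, and on every input word `w` it only ever visits the
first `O(log |w|)` cells of each of its work tapes. -/
def IsLogspace (M : OfflineTM σ δ) : Prop :=
  (∀ w : List σ, ∃ y : List δ, M.HaltsWith w y) ∧
    ∃ a : ℕ, ∀ (w : List σ) (c : M.Cfg), M.Visits w c →
      ∀ j : Fin M.k, c.head j < a * (Nat.log 2 w.length + 1)

end OfflineTM

/-- The symbols used to write lists of natural numbers on the output tape. -/
inductive OutSymbol where
  | bit (b : Bool)
  | sep

/-- A natural number in binary (least significant digit first, no superfluous zeros),
followed by a separator. -/
def encodeNat (n : ℕ) : List OutSymbol :=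
  (Nat.bits n).map OutSymbol.bit ++ [OutSymbol.sep]

/-- A list of natural numbers in binary. -/
def encodeNats (l : List ℕ) : List OutSymbol :=
  l.flatMap encodeNat

/-- Instances of type `ι` are given to machines through the encoding `enc`. In logarithmic space
one can compute, for each instance `x`, a list `l` of natural numbers (written in binary) that is
a correct answer for `x` in the sense of `R x l`. -/
def LogspaceSolvable {ι σ : Type} (enc : ι → List σ) (R : ι → List ℕ → Prop) : Prop :=
  ∃ M : OfflineTM σ OutSymbol, M.IsLogspace ∧
    ∀ x : ι, ∃ l : List ℕ, M.HaltsWith (enc x) (encodeNats l) ∧ R x l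

/-! ### Unary Subset-Sum -/

/-- An instance of Subset-Sum: integers `m 0, …, m (n - 1)` and a target `B`. -/
structure SubsetSum where
  n : ℕ
  m : Fin n → ℤ
  B : ℤ

/-- The symbols in which instances are written. -/
inductive UnarySymbol where
  | plus
  | minus
  | sep

/-- An integer in signed unary: `|z|` copies of its sign, followed by a separator. -/
def unaryInt (z : ℤ) : List UnarySymbol :=
  List.replicate z.natAbs (if 0 ≤ z then UnarySymbol.plus else UnarySymbol.minus) ++
    [UnarySymbol.sep]

namespace SubsetSum

/-- The input word of an instance: `B, m 0, …, m (n - 1)` in unary. -/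
def encode (I : SubsetSum) : List UnarySymbol :=
  unaryInt I.B ++ (List.ofFn I.m).flatMap unaryInt

/-- The number `A` of solutions: the number of sets `S` of indices with `∑ i ∈ S, m i = B`. -/
def numSolutions (I : SubsetSum) : ℕ :=
  (Finset.univ.filter fun S : Finset (Fin I.n) => ∑ i ∈ S, I.m i = I.B).card

/-- The number of binary digits of the length of the input word. -/
def logSize (I : SubsetSum) : ℕ :=
  Nat.log 2 I.encode.length + 1

end SubsetSum

/-- The floating point number `M * 2 ^ e` is `A` to `b` significant bits: the integer mantissa `M`
has exactly `b` binary digits (at most `b` if the exponent `e` is `0`), and the error is less than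
one unit in the last place of the mantissa. In particular, `M = A` if `e = 0`. -/
def SignificantBits (b A M e : ℕ) : Prop :=
  M < 2 ^ b ∧ (e = 0 ∨ 2 ^ (b - 1) ≤ M) ∧ |(A : ℤ) - M * 2 ^ e| < 2 ^ e

/-!
Why logarithmically many significant bits of the number `A` of solutions can be computed in
logarithmic space.

*Residues.* For a prime `p` larger than the input word, `A` is the constant coefficient of the Laurent
polynomial `x ^ (-B) * ∏ i, (1 + x ^ m i)`, and the sum of its values over the nonzero residues `x`
modulo `p` is `-A`, since the degrees are smaller than `p - 1` (`solutionsMod_encode`). So `A` modulo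
`p` can be computed by repeated scans of the input.

*Fractions.* If `N` is a product of such primes, then `A / N` modulo `1` is a sum of fractions with the
denominators `p`, by the Chinese remainder theorem. Computed with fixed point numbers of
logarithmically many digits, it is accurate, unless `A / N` is so close to `1` that the result wraps
around (`crt_fraction`).

*A suitable product.* There remains the search for such an `N` with `A < N < 2 * A`, although `A` is
not known. It uses a chain of products of primes that can be described by two small numbers `j` and
`r`: the product of the primes in `(|w| + 1, j]` times a prime `r` from an interval `(X, 2 * X ^ 2]`.
The last elements of the chain (with `j = X`) are much larger than `A`, by Chebyshev's bound
(`two_pow_le_prod_basePrimes`). Every other element `N` is followed by some `N' < 2 * N`, by Bertrand's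
postulate: either by a larger `r`, or by one more prime `j + 1` and an `r` that is smaller in about the
same proportion. Hence, going backwards from the end of the chain, as long as the computed fractions
are not above `1 / 2`, they are reliable for the next element, too (`fraction_lt_of_forall_later`). The
last `N` whose fraction is computed to be above `1 / 2` therefore satisfies `A < N < 2 * A`
(`chosenProd_lt`). If there is none, then `A` is smaller than a prime of polynomial size and equal to
its residue (`smallCount_eq`).

*Significant bits.* The fraction `A / N` is the second result. For the first one it is multiplied by a
floating point approximation of `N`, which is obtained by multiplication of the prime factors with
upward rounding after each step (`mantissa_bounds`, `significantBits_of_approx`).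

*Machines.* All numbers that are held in memory have polynomial size. The computations are therefore
expressed by counter programs with polynomially bounded registers, and these are compiled to Turing
machines with a binary counter on each work tape (`CounterProg.exists_isLogspace`). The functions that
are computed by such programs (`LogspaceFun`) are closed under composition and under primitive
recursion with polynomially bounded values, whence they contain the arithmetic that is needed; and the
list of their values can be written on the output tape (`LogspaceSolvable.of_logspaceFun`).
-/

/-! ### Counter programs -/

/-- A test of a counter program: whether a register is positive, or whether the letter under the
input head satisfies a predicate. -/
inductive CounterTest (σ : Type) where
  | pos (r : ℕ)
  | inp (P : InputCell σ → Bool)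

/-- Structured counter programs. The registers are numbered by `ℕ` and hold natural numbers; the
input word is read with a two-way head. -/
inductive CounterProg (σ δ : Type) where
  | inc (r : ℕ)
  | dec (r : ℕ)
  | move (v : HeadMove)
  | emit (a : δ)
  | seq (c₁ c₂ : CounterProg σ δ)
  | loop (t : CounterTest σ) (c : CounterProg σ δ)

/-- A state of a counter program: registers, position of the input head, output so far. -/
structure Store (δ : Type) where
  regs : ℕ → ℕ
  pos : ℕ
  out : List δ

section Machines

variable {σ δ : Type}

/-- The truth value of a test. -/
def CounterTest.holds (w : List σ) (s : Store δ) : CounterTest σ → Bool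
  | .pos r => decide (s.regs r ≠ 0)
  | .inp P => P (inputCell w s.pos)

namespace CounterProg

/-- Big-step semantics: on the input word `w` the program leads from one store to another, and no
register is ever increased beyond `B`. Only positive registers may be decreased. -/
inductive Exec (w : List σ) (B : ℕ) : CounterProg σ δ → Store δ → Store δ → Prop
  | inc {r ρ p o} : ρ r + 1 ≤ B →
      Exec w B (inc r) ⟨ρ, p, o⟩ ⟨Function.update ρ r (ρ r + 1), p, o⟩
  | dec {r ρ p o} : ρ r ≠ 0 →
      Exec w B (dec r) ⟨ρ, p, o⟩ ⟨Function.update ρ r (ρ r - 1), p, o⟩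
  | move {v ρ p o} : Exec w B (move v) ⟨ρ, p, o⟩ ⟨ρ, min (v.apply p) (w.length + 1), o⟩
  | emit {a ρ p o} : Exec w B (emit a) ⟨ρ, p, o⟩ ⟨ρ, p, o ++ [a]⟩
  | seq {c₁ c₂ s₁ s₂ s₃} : Exec w B c₁ s₁ s₂ → Exec w B c₂ s₂ s₃ → Exec w B (seq c₁ c₂) s₁ s₃
  | loop_done {t c s} : t.holds w s = false → Exec w B (loop t c) s s
  | loop_step {t c s₁ s₂ s₃} : t.holds w s₁ = true → Exec w B c s₁ s₂ →
      Exec w B (loop t c) s₂ s₃ → Exec w B (loop t c) s₁ s₃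

theorem Exec.mono {w : List σ} {B B' : ℕ} (hB : B ≤ B') {c : CounterProg σ δ} {s s' : Store δ}
    (h : Exec w B c s s') : Exec w B' c s s' := by
  induction h with
  | inc h => exact .inc (h.trans hB)
  | dec h => exact .dec h
  | move => exact .move
  | emit => exact .emit
  | seq _ _ h₁ h₂ => exact .seq h₁ h₂
  | loop_done h => exact .loop_done h
  | loop_step h _ _ h₁ h₂ => exact .loop_step h h₁ h₂

/-- All registers of a program are smaller than its width. -/
def width : CounterProg σ δ → ℕ
  | inc r => r + 1
  | dec r => r + 1
  | move _ => 0
  | emit _ => 0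
  | seq c₁ c₂ => max c₁.width c₂.width
  | loop (.pos r) c => max (r + 1) c.width
  | loop (.inp _) c => c.width

end CounterProg

/-! ### From counter programs to Turing machines -/

/-- The memory of a machine with `k` work tapes over the alphabet `Option Bool`: a configuration
without its state. -/
@[ext]
structure Mem (δ : Type) (k : ℕ) where
  pos : ℕ
  tape : Fin k → ℕ → Option Bool
  head : Fin k → ℕ
  out : List δ

namespace Mem

variable {k : ℕ} {N : Type}

/-- The effect of an action on the memory. -/
def act (w : List σ) (m : Mem δ k) (a : TMAction N (Option Bool) δ k) : Mem δ k where
  pos := min (a.inputMove.apply m.pos) (w.length + 1)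
  tape := fun j => Function.update (m.tape j) (m.head j) (a.write j)
  head := fun j => (a.workMove j).apply (m.head j)
  out := m.out ++ a.emit.toList

/-- The symbols under the heads. -/
def syms (m : Mem δ k) : Fin k → Option Bool := fun j => m.tape j (m.head j)

/-- The memory `m` with contents `T` and head position `h` on tape `j`. -/
def setTape (m : Mem δ k) (j : Fin k) (T : ℕ → Option Bool) (h : ℕ) : Mem δ k where
  pos := m.pos
  tape := Function.update m.tape j T
  head := Function.update m.head j h
  out := m.out

end Mem

/-- A piece of a Turing machine that is left with a Boolean result: its transitions lead to a state
of the piece or to an exit. -/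
structure Fragment (σ δ : Type) (k : ℕ) where
  Q : Type
  finiteQ : Finite Q
  start : Q
  trans : Q → InputCell σ → (Fin k → Option Bool) → TMAction (Q ⊕ Bool) (Option Bool) δ k

namespace Fragment

variable {k : ℕ}

/-- The action that is taken in state `q` with memory `m`. -/
def actionAt (F : Fragment σ δ k) (w : List σ) (q : F.Q) (m : Mem δ k) :=
  F.trans q (inputCell w m.pos) m.syms

/-- Started in state `q` with the memory `m`, the fragment is eventually left with the result `b`
and the memory `m'`; until then all heads stay to the left of cell `S`. -/
inductive Run (F : Fragment σ δ k) (w : List σ) (S : ℕ) :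
    F.Q → Mem δ k → Bool → Mem δ k → Prop
  | exit {q m b} : (∀ j, m.head j < S) → (F.actionAt w q m).next = .inr b →
      Run F w S q m b (m.act w (F.actionAt w q m))
  | step {q m q' b m'} : (∀ j, m.head j < S) → (F.actionAt w q m).next = .inl q' →
      Run F w S q' (m.act w (F.actionAt w q m)) b m' → Run F w S q m b m'

/-- As `Fragment.Run`, but started at a state or at an exit. -/
def RunFrom (F : Fragment σ δ k) (w : List σ) (S : ℕ) :
    F.Q ⊕ Bool → Mem δ k → Bool → Mem δ k → Prop
  | .inl q, m, b, m' => F.Run w S q m b m'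
  | .inr e, m, b, m' => e = b ∧ m = m'

theorem Run.of_next {F : Fragment σ δ k} {w : List σ} {S : ℕ} {q : F.Q} {m m' : Mem δ k} {b : Bool}
    (hS : ∀ j, m.head j < S)
    (h : F.RunFrom w S (F.actionAt w q m).next (m.act w (F.actionAt w q m)) b m') :
    F.Run w S q m b m' := by
  rcases hn : (F.actionAt w q m).next with q' | e
  · rw [hn] at h
    exact .step hS hn h
  · rw [hn] at h
    obtain ⟨rfl, rfl⟩ := h
    exact .exit hS hn

/-- Change of the target of an action. -/
def mapNext {N N' Γ : Type} (f : N → N') (a : TMAction N Γ δ k) : TMAction N' Γ δ k where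
  next := f a.next
  inputMove := a.inputMove
  write := a.write
  workMove := a.workMove
  emit := a.emit

/-- Two fragments side by side; `k₁` and `k₂` say where to continue at their exits. -/
def glue (F₁ F₂ : Fragment σ δ k) (k₁ k₂ : Bool → (F₁.Q ⊕ F₂.Q) ⊕ Bool) : Fragment σ δ k where
  Q := F₁.Q ⊕ F₂.Q
  finiteQ := haveI := F₁.finiteQ; haveI := F₂.finiteQ; inferInstance
  start := .inl F₁.start
  trans
    | .inl q, x, y => mapNext (Sum.elim (fun q' => .inl (.inl q')) k₁) (F₁.trans q x y)
    | .inr q, x, y => mapNext (Sum.elim (fun q' => .inl (.inr q')) k₂) (F₂.trans q x y)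

section glue

variable {F₁ F₂ : Fragment σ δ k} {k₁ k₂ : Bool → (F₁.Q ⊕ F₂.Q) ⊕ Bool} {w : List σ} {S : ℕ}
  {m m' m'' : Mem δ k} {b e : Bool}

theorem Run.glue_left {q : F₁.Q} (h : F₁.Run w S q m b m')
    (h' : (glue F₁ F₂ k₁ k₂).RunFrom w S (k₁ b) m' e m'') :
    (glue F₁ F₂ k₁ k₂).Run w S (.inl q) m e m'' := by
  induction h with
  | @exit q m b hS hn =>
    have hnext : ((glue F₁ F₂ k₁ k₂).actionAt w (.inl q) m).next = k₁ b := by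
      change Sum.elim _ _ (F₁.actionAt w q m).next = _
      rw [hn]; rfl
    exact .of_next hS (hnext ▸ h')
  | @step q m q' b m' hS hn _ ih =>
    refine .step (F := glue F₁ F₂ k₁ k₂) hS (q' := Sum.inl q') ?_ (ih h')
    change Sum.elim _ _ (F₁.actionAt w q m).next = _
    rw [hn]; rfl

theorem Run.glue_right {q : F₂.Q} (h : F₂.Run w S q m b m')
    (h' : (glue F₁ F₂ k₁ k₂).RunFrom w S (k₂ b) m' e m'') :
    (glue F₁ F₂ k₁ k₂).Run w S (.inr q) m e m'' := by
  induction h with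
  | @exit q m b hS hn =>
    have hnext : ((glue F₁ F₂ k₁ k₂).actionAt w (.inr q) m).next = k₂ b := by
      change Sum.elim _ _ (F₂.actionAt w q m).next = _
      rw [hn]; rfl
    exact .of_next hS (hnext ▸ h')
  | @step q m q' b m' hS hn _ ih =>
    refine .step (F := glue F₁ F₂ k₁ k₂) hS (q' := Sum.inr q') ?_ (ih h')
    change Sum.elim _ _ (F₂.actionAt w q m).next = _
    rw [hn]; rfl

end glue

/-- A single step that leaves the work tapes alone. -/
def once (P : InputCell σ → Bool) (v : HeadMove) (a : Option δ) : Fragment σ δ k where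
  Q := Unit
  finiteQ := inferInstance
  start := ()
  trans := fun _ x y => ⟨.inr (P x), v, y, fun _ => .stay, a⟩

/-- The phases of a sweep: entering the digits, moving right over them, and moving back to cell `0`
with a result. -/
inductive Phase where
  | enter
  | scan
  | back (b : Bool)

instance : Finite Phase :=
  Finite.of_injective (β := Option (Option Bool))
    (fun | .enter => none | .scan => some none | .back b => some (some b))
    (by rintro (_ | _ | _) (_ | _ | _) h <;> simp_all)

/-- An action on tape `r` alone. -/
def localAction {N : Type} (r : ℕ) (y : Fin k → Option Bool) (n : N) (x : Option Bool)
    (v : HeadMove) : TMAction N (Option Bool) δ k where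
  next := n
  inputMove := .stay
  write := fun j => if j.1 = r then x else y j
  workMove := fun j => if j.1 = r then v else .stay
  emit := none

/-- A sweep over the digits on tape `r`: from the first digit on, digits `b` are replaced by `b'`;
the first cell with other contents is overwritten with `o` (or left alone if `o = none`), and the
head returns to cell `0`. The result says whether the sweep was stopped by a digit. -/
def sweep (r : Fin k) (b b' : Bool) (o : Option Bool) : Fragment σ δ k where
  Q := Phase
  finiteQ := inferInstance
  start := .enter
  trans
    | .enter, _, y => localAction r y (.inl .scan) (y r) .right
    | .scan, _, y =>
      if y r = some b then localAction r y (.inl .scan) (some b') .right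
      else localAction r y (.inl (.back (y r).isSome)) (o.or (y r)) .left
    | .back e, _, y =>
      if y r = none then localAction r y (.inr e) none .stay
      else localAction r y (.inl (.back e)) (y r) .left

end Fragment

/-- A tape with the digits `l` in the cells `1, …, |l|`. -/
def tapeOf (l : List Bool) : ℕ → Option Bool
  | 0 => none
  | i + 1 => l[i]?

/-- The number with the binary digits `l`, least significant digit first; superfluous zeros are
allowed. -/
def bitsVal : List Bool → ℕ
  | [] => 0
  | x :: l => x.toNat + 2 * bitsVal l

/-- The effect of `Fragment.sweep` on the digits. -/
def sweepList (b b' : Bool) (o : Option Bool) : List Bool → List Bool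
  | [] => o.toList
  | x :: l => if x = b then b' :: sweepList b b' o l else o.getD x :: l

/-- The result of `Fragment.sweep`. -/
def sweepStops (b : Bool) : List Bool → Bool
  | [] => false
  | x :: l => if x = b then sweepStops b l else true

namespace Fragment

variable {k : ℕ}

theorem act_localAction {N : Type} {w : List σ} {m : Mem δ k} (hp : m.pos ≤ w.length + 1)
    (j : Fin k) (T : ℕ → Option Bool) (h : ℕ) (n : N) (x : Option Bool) (v : HeadMove) :
    (m.setTape j T h).act w (localAction j (m.setTape j T h).syms n x v) =
      m.setTape j (Function.update T h x) (v.apply h) := by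
  ext1
  · simpa [Mem.act, localAction, Mem.setTape, HeadMove.apply] using hp
  · funext i
    by_cases hi : i = j
    · subst hi; simp [Mem.act, localAction, Mem.setTape]
    · have : i.1 ≠ j.1 := fun h => hi (Fin.ext h)
      simp [Mem.act, localAction, Mem.setTape, Mem.syms, hi, this]
  · funext i
    by_cases hi : i = j
    · subst hi; simp [Mem.act, localAction, Mem.setTape]
    · have : i.1 ≠ j.1 := fun h => hi (Fin.ext h)
      simp [Mem.act, localAction, Mem.setTape, HeadMove.apply, hi, this]
  · simp [Mem.act, localAction, Mem.setTape]

theorem syms_setTape (m : Mem δ k) (j : Fin k) (T : ℕ → Option Bool) (h : ℕ) :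
    (m.setTape j T h).syms j = T h := by
  simp [Mem.syms, Mem.setTape]

theorem head_setTape_lt {m : Mem δ k} {S : ℕ} (hS : ∀ j, m.head j < S) (j : Fin k)
    (T : ℕ → Option Bool) {h : ℕ} (hh : h < S) : ∀ i, (m.setTape j T h).head i < S := by
  intro i
  by_cases hi : i = j
  · subst hi; simpa [Mem.setTape] using hh
  · simpa [Mem.setTape, hi] using hS i

theorem update_tapeOf (a l l' : List Bool) (ht : l.tail = l'.tail) :
    Function.update (tapeOf (a ++ l)) (a.length + 1) l'[0]? = tapeOf (a ++ l') := by
  funext i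
  rcases i with _ | i
  · rfl
  · rcases lt_trichotomy i a.length with h | rfl | h
    · rw [Function.update_of_ne (by omega)]
      simp [tapeOf, List.getElem?_append_left h]
    · simp [tapeOf, List.getElem?_append_right]
    · rw [Function.update_of_ne (by omega)]
      obtain ⟨n, rfl⟩ := Nat.exists_eq_add_of_lt h
      have := congrArg (fun t : List Bool => t[n]?) ht
      simpa [tapeOf, List.getElem?_append_right, List.getElem?_tail, Nat.add_assoc] using this

section sweep

variable {w : List σ} {S : ℕ} {m : Mem δ k} (hp : m.pos ≤ w.length + 1) (hS : ∀ j, m.head j < S)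
  (j : Fin k) (b b' : Bool) (o : Option Bool)
include hp hS

theorem run_sweep_back (e : Bool) (l : List Bool) (i : ℕ) (hi : i ≤ l.length) (hlS : i < S) :
    (sweep j b b' o : Fragment σ δ k).Run w S (.back e) (m.setTape j (tapeOf l) i) e
      (m.setTape j (tapeOf l) 0) := by
  induction i with
  | zero =>
    have ha : (sweep j b b' o : Fragment σ δ k).actionAt w (.back e) (m.setTape j (tapeOf l) 0) =
        localAction j (m.setTape j (tapeOf l) 0).syms (.inr e) none .stay := by
      simp only [actionAt, sweep, syms_setTape]
      exact if_pos rfl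
    refine .of_next (head_setTape_lt hS j _ hlS) ?_
    rw [ha, act_localAction hp]
    have hu : Function.update (tapeOf l) 0 none = tapeOf l := Function.update_eq_self 0 (tapeOf l)
    exact ⟨rfl, by rw [hu]; rfl⟩
  | succ i ih =>
    have hsome : tapeOf l (i + 1) = some l[i] := List.getElem?_eq_getElem hi
    have ha : (sweep j b b' o : Fragment σ δ k).actionAt w (.back e)
        (m.setTape j (tapeOf l) (i + 1)) = localAction j (m.setTape j (tapeOf l) (i + 1)).syms
          (.inl (.back e)) (tapeOf l (i + 1)) .left := by
      simp only [actionAt, sweep, syms_setTape]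
      exact if_neg (by simp [hsome])
    refine .of_next (head_setTape_lt hS j _ hlS) ?_
    rw [ha, act_localAction hp, Function.update_eq_self]
    exact ih (by omega) (by omega)

theorem run_sweep_scan (l a : List Bool) (hlS : a.length + l.length + 1 < S) :
    (sweep j b b' o : Fragment σ δ k).Run w S .scan
      (m.setTape j (tapeOf (a ++ l)) (a.length + 1)) (sweepStops b l)
      (m.setTape j (tapeOf (a ++ sweepList b b' o l)) 0) := by
  have hread : ∀ a l : List Bool, tapeOf (a ++ l) (a.length + 1) = l[0]? := fun a l => by
    simp [tapeOf, List.getElem?_append_right]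
  have hhalt : ∀ a l l' : List Bool, a.length + l.length + 1 < S → l[0]? ≠ some b →
      l.tail = l'.tail → o.or l[0]? = l'[0]? →
      (sweep j b b' o : Fragment σ δ k).Run w S .scan
        (m.setTape j (tapeOf (a ++ l)) (a.length + 1)) (l[0]?).isSome
        (m.setTape j (tapeOf (a ++ l')) 0) := by
    intro a l l' hl hb ht ho
    have ha : (sweep j b b' o : Fragment σ δ k).actionAt w .scan
        (m.setTape j (tapeOf (a ++ l)) (a.length + 1)) =
          localAction j (m.setTape j (tapeOf (a ++ l)) (a.length + 1)).syms
          (.inl (.back (l[0]?).isSome)) (o.or l[0]?) .left := by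
      simp only [actionAt, sweep, syms_setTape, hread]
      exact if_neg hb
    refine .of_next (head_setTape_lt hS j _ (by omega)) ?_
    rw [ha, act_localAction hp, ho, update_tapeOf a l l' ht]
    exact run_sweep_back hp hS j b b' o _ _ a.length (by simp) (by omega)
  induction l generalizing a with
  | nil => exact hhalt a [] _ hlS (by simp) (by cases o <;> rfl) (by cases o <;> rfl)
  | cons x l ih =>
    by_cases hx : x = b
    · subst hx
      have ha : (sweep j x b' o : Fragment σ δ k).actionAt w .scan
          (m.setTape j (tapeOf (a ++ x :: l)) (a.length + 1)) =
            localAction j (m.setTape j (tapeOf (a ++ x :: l)) (a.length + 1)).syms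
            (.inl .scan) (some b') .right := by
        simp only [actionAt, sweep, syms_setTape, hread]
        exact if_pos rfl
      refine .of_next (head_setTape_lt hS j _ (by simp at hlS; omega)) ?_
      rw [ha, act_localAction hp]
      have hu := update_tapeOf a (x :: l) (b' :: l) rfl
      simp only [List.getElem?_cons_zero] at hu
      rw [hu]
      have := ih (a ++ [b']) (by simp at hlS ⊢; omega)
      simpa [sweepStops, sweepList, RunFrom, HeadMove.apply, localAction] using this
    · have := hhalt a (x :: l) (o.getD x :: l) hlS (by simpa using hx) rfl (by cases o <;> rfl)
      simpa [sweepList, sweepStops, hx] using this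

end sweep

theorem run_sweep {w : List σ} {S : ℕ} {m : Mem δ k} (hp : m.pos ≤ w.length + 1) (j : Fin k)
    (b b' : Bool) (o : Option Bool) (hh : ∀ j, m.head j = 0) (l : List Bool)
    (hl : m.tape j = tapeOf l) (hlS : l.length + 1 < S) :
    (sweep j b b' o : Fragment σ δ k).Run w S .enter m (sweepStops b l)
      { m with tape := Function.update m.tape j (tapeOf (sweepList b b' o l)) } := by
  have hS : ∀ j, m.head j < S := fun j => by rw [hh]; omega
  have hset : ∀ T, m.setTape j T 0 = { m with tape := Function.update m.tape j T } := fun T => by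
    have : Function.update m.head j 0 = m.head := by
      rw [← hh j]; exact Function.update_eq_self _ _
    simp only [Mem.setTape, this]
  have hm : m.setTape j (tapeOf l) 0 = m := by
    rw [hset, ← hl, Function.update_eq_self]
  rw [← hset]
  have ha : (sweep j b b' o : Fragment σ δ k).actionAt w .enter (m.setTape j (tapeOf l) 0) =
      localAction j (m.setTape j (tapeOf l) 0).syms (.inl .scan) (tapeOf l 0) .right := by
    simp only [actionAt, sweep, syms_setTape]
  nth_rw 1 [← hm]
  refine .of_next (head_setTape_lt hS j _ (by omega)) ?_
  rw [ha, act_localAction hp, Function.update_eq_self]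
  have := run_sweep_scan hp hS j b b' o l [] (by simpa using hlS)
  simpa [RunFrom, localAction, HeadMove.apply] using this

end Fragment

/-! ### Binary counters on the work tapes -/

theorem sweepList_test (l : List Bool) : sweepList false false none l = l := by
  induction l with
  | nil => rfl
  | cons x l ih => cases x <;> simp [sweepList, ih]

theorem sweepStops_test (l : List Bool) : sweepStops false l = decide (bitsVal l ≠ 0) := by
  induction l with
  | nil => rfl
  | cons x l ih => cases x <;> simp [sweepStops, bitsVal, ih]

theorem bitsVal_inc (l : List Bool) :
    bitsVal (sweepList true false (some true) l) = bitsVal l + 1 := by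
  induction l with
  | nil => rfl
  | cons x l ih =>
    cases x
    · simp [sweepList, bitsVal, Nat.add_comm]
    · simp only [sweepList, bitsVal, if_true, ih, Bool.toNat_false, Bool.toNat_true]; ring

theorem bitsVal_dec (l : List Bool) (hl : bitsVal l ≠ 0) :
    bitsVal (sweepList false true (some false) l) = bitsVal l - 1 := by
  induction l with
  | nil => exact absurd rfl hl
  | cons x l ih =>
    cases x
    · have : bitsVal l ≠ 0 := by simpa [bitsVal] using hl
      simp only [sweepList, bitsVal, if_true, ih this, Bool.toNat_false, Bool.toNat_true]; omega
    · simp [sweepList, bitsVal]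

theorem length_inc (l : List Bool) :
    (sweepList true false (some true) l).length = l.length ∨
      (sweepList true false (some true) l).length = l.length + 1 ∧
        bitsVal l + 1 = 2 ^ l.length := by
  induction l with
  | nil => exact .inr ⟨rfl, rfl⟩
  | cons x l ih =>
    cases x
    · exact .inl (by simp [sweepList])
    · rcases ih with h | ⟨h, h'⟩
      · exact .inl (by simp [sweepList, h])
      · refine .inr ⟨by simp [sweepList, h], ?_⟩
        rw [List.length_cons, pow_succ, ← h', bitsVal, Bool.toNat_true]; ring

theorem length_dec (l : List Bool) (hl : bitsVal l ≠ 0) :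
    (sweepList false true (some false) l).length = l.length := by
  induction l with
  | nil => exact absurd rfl hl
  | cons x l ih =>
    cases x
    · have : bitsVal l ≠ 0 := by simpa [bitsVal] using hl
      simp [sweepList, ih this]
    · simp [sweepList]

namespace Fragment

variable {k : ℕ}

/-- The fragment for a sweep over the tape with number `r`, if there is such a tape. -/
def sweepReg (k r : ℕ) (b b' : Bool) (o : Option Bool) : Fragment σ δ k :=
  if h : r < k then sweep ⟨r, h⟩ b b' o else once (fun _ => false) .stay none

/-- The fragment for a test: its result is the truth value of the test. -/
def ofTest (k : ℕ) : CounterTest σ → Fragment σ δ k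
  | .pos r => sweepReg k r false false none
  | .inp P => once P .stay none

/-- Compilation of counter programs: register `r` is held in binary on tape `r`. -/
def ofProg (k : ℕ) : CounterProg σ δ → Fragment σ δ k
  | .inc r => sweepReg k r true false (some true)
  | .dec r => sweepReg k r false true (some false)
  | .move v => once (fun _ => false) v none
  | .emit a => once (fun _ => false) .stay (some a)
  | .seq c₁ c₂ => glue (ofProg k c₁) (ofProg k c₂) (fun _ => .inl (.inr (ofProg k c₂).start)) .inr
  | .loop t c => glue (ofTest k t) (ofProg k c)
      (fun b => if b then .inl (.inr (ofProg k c).start) else .inr false)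
      (fun _ => .inl (.inl (ofTest k t).start))

/-- The memory `m` represents the store `s`; the registers hold at most as many digits as `B`. -/
def Represents (w : List σ) (B : ℕ) (s : Store δ) (m : Mem δ k) : Prop :=
  m.pos = s.pos ∧ s.pos ≤ w.length + 1 ∧ m.out = s.out ∧ ∀ j, m.head j = 0 ∧
    ∃ l, l.length ≤ B.size ∧ bitsVal l = s.regs j ∧ m.tape j = tapeOf l

section

variable {w : List σ} {B : ℕ} {s : Store δ} {m : Mem δ k} (hm : Represents w B s m)
include hm

theorem run_once (P : InputCell σ → Bool) (v : HeadMove) (a : Option δ) :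
    ∃ m', (once P v a : Fragment σ δ k).Run w (B.size + 2) () m (P (inputCell w s.pos)) m' ∧
      Represents w B ⟨s.regs, min (v.apply s.pos) (w.length + 1), s.out ++ a.toList⟩ m' := by
  obtain ⟨h₁, h₂, h₃, h₄⟩ := hm
  refine ⟨_, .exit (fun j => by rw [(h₄ j).1]; omega) (by rw [← h₁]; rfl), ?_, ?_, ?_, fun j => ?_⟩
  · simp [Mem.act, actionAt, once, h₁]
  · simp
  · simp [Mem.act, actionAt, once, h₃]
  · simpa [Mem.act, actionAt, once, HeadMove.apply, Mem.syms] using h₄ j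

theorem run_sweepReg {r : ℕ} (hr : r < k) (b b' : Bool) (o : Option Bool) (v : ℕ)
    (hv : ∀ l, l.length ≤ B.size → bitsVal l = s.regs r →
      bitsVal (sweepList b b' o l) = v ∧ (sweepList b b' o l).length ≤ B.size) :
    ∃ l m', bitsVal l = s.regs r ∧ (sweepReg k r b b' o : Fragment σ δ k).Run w (B.size + 2)
        (sweepReg k r b b' o : Fragment σ δ k).start m (sweepStops b l) m' ∧
      Represents w B ⟨Function.update s.regs r v, s.pos, s.out⟩ m' := by
  obtain ⟨h₁, h₂, h₃, h₄⟩ := hm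
  obtain ⟨-, l, hl, hlv, hT⟩ := h₄ ⟨r, hr⟩
  obtain ⟨hv, hlen⟩ := hv l hl hlv
  have hrun := run_sweep (w := w) (S := B.size + 2) (h₁ ▸ h₂) ⟨r, hr⟩ b b' o (fun j => (h₄ j).1) l
    hT (by omega)
  have hF : (sweepReg k r b b' o : Fragment σ δ k) = sweep ⟨r, hr⟩ b b' o := dif_pos hr
  rw [hF]
  refine ⟨l, _, hlv, hrun, h₁, h₂, h₃, fun j => ⟨(h₄ j).1, ?_⟩⟩
  by_cases hj : j = ⟨r, hr⟩
  · subst hj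
    exact ⟨_, hlen, by simpa using hv, by simp⟩
  · have hj' : j.1 ≠ r := fun h => hj (Fin.ext h)
    have h := (h₄ j).2
    simp only [Function.update_of_ne hj, Function.update_of_ne hj']
    exact h

theorem run_ofTest (t : CounterTest σ) (ht : ∀ r, t = .pos r → r < k) :
    ∃ m', (ofTest k t : Fragment σ δ k).Run w (B.size + 2) (ofTest k t : Fragment σ δ k).start m
      (t.holds w s) m' ∧ Represents w B s m' := by
  cases t with
  | pos r =>
    obtain ⟨l, m', hl, h, h'⟩ := run_sweepReg hm (ht r rfl) false false none (s.regs r)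
      fun l h₁ h₂ => by rw [sweepList_test]; exact ⟨h₂, h₁⟩
    rw [sweepStops_test, hl] at h
    rw [Function.update_eq_self] at h'
    exact ⟨m', h, h'⟩
  | inp P =>
    obtain ⟨m', h, h'⟩ := run_once hm P .stay none
    have hpos : min s.pos (w.length + 1) = s.pos := min_eq_left hm.2.1
    simp only [HeadMove.apply, hpos, Option.toList_none, List.append_nil] at h'
    exact ⟨m', h, h'⟩

end

theorem run_ofProg {w : List σ} {B : ℕ} {c : CounterProg σ δ} {s s' : Store δ}
    (h : CounterProg.Exec w B c s s') (hk : c.width ≤ k) {m : Mem δ k}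
    (hm : Represents w B s m) :
    ∃ b m', (ofProg k c).Run w (B.size + 2) (ofProg k c).start m b m' ∧
      Represents w B s' m' := by
  induction h generalizing m with
  | @inc r ρ p o hB =>
    obtain ⟨l, m', -, h, h'⟩ := run_sweepReg hm hk true false (some true) (ρ r + 1)
      fun l h₁ h₂ => by
        refine ⟨by rw [bitsVal_inc, h₂], ?_⟩
        rcases length_inc l with h | ⟨h, h'⟩
        · omega
        · rw [h, Nat.succ_le_iff, Nat.lt_size, ← h', h₂]; exact hB
    exact ⟨_, m', h, h'⟩
  | @dec r ρ p o h0 =>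
    obtain ⟨l, m', -, h, h'⟩ := run_sweepReg hm hk false true (some false) (ρ r - 1)
      fun l h₁ h₂ => by
        have hl : bitsVal l ≠ 0 := by rw [h₂]; exact h0
        exact ⟨by rw [bitsVal_dec l hl, h₂], (length_dec l hl).trans_le h₁⟩
    exact ⟨_, m', h, h'⟩
  | @move v ρ p o =>
    obtain ⟨m', h, h'⟩ := run_once hm (fun _ => false) v none
    exact ⟨_, m', h, by simpa using h'⟩
  | @emit a ρ p o =>
    obtain ⟨m', h, h'⟩ := run_once hm (fun _ => false) .stay (some a)
    have hpos : min p (w.length + 1) = p := min_eq_left hm.2.1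
    exact ⟨_, m', h, by simpa [HeadMove.apply, hpos] using h'⟩
  | seq _ _ ih₁ ih₂ =>
    obtain ⟨b₁, m₁, h₁, hm₁⟩ := ih₁ ((le_max_left _ _).trans hk) hm
    obtain ⟨b₂, m₂, h₂, hm₂⟩ := ih₂ ((le_max_right _ _).trans hk) hm₁
    exact ⟨b₂, m₂, h₁.glue_left (h₂.glue_right ⟨rfl, rfl⟩), hm₂⟩
  | @loop_done t c s ht =>
    obtain ⟨m₁, h₁, hm₁⟩ := run_ofTest hm t (by
      rintro r rfl; exact (le_max_left _ _).trans hk)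
    rw [ht] at h₁
    exact ⟨false, m₁, h₁.glue_left ⟨rfl, rfl⟩, hm₁⟩
  | @loop_step t c s₁ s₂ s₃ ht _ _ ih₁ ih₂ =>
    obtain ⟨m₁, h₁, hm₁⟩ := run_ofTest hm t (by
      rintro r rfl; exact (le_max_left _ _).trans hk)
    rw [ht] at h₁
    have hc : c.width ≤ k := by
      cases t
      · exact (le_max_right _ _).trans hk
      · exact hk
    obtain ⟨b₂, m₂, h₂, hm₂⟩ := ih₁ hc hm₁
    obtain ⟨b₃, m₃, h₃, hm₃⟩ := ih₂ hk hm₂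
    exact ⟨b₃, m₃, h₁.glue_left (h₂.glue_right h₃), hm₃⟩

/-- The Turing machine that runs a fragment and halts at its exit. -/
def toTM (F : Fragment σ δ k) : OfflineTM σ δ where
  Q := F.Q ⊕ Bool
  Γ := Option Bool
  finiteQ := haveI := F.finiteQ; inferInstance
  finiteΓ := inferInstance
  k := k
  start := .inl F.start
  blank := none
  trans
    | .inl q, x, y => some (F.trans q x y)
    | .inr _, _, _ => none

/-- The configuration of `F.toTM` with a given state and memory. -/
def cfg (F : Fragment σ δ k) (q : F.Q ⊕ Bool) (m : Mem δ k) : F.toTM.Cfg where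
  state := q
  inputHead := m.pos
  tape := m.tape
  head := m.head
  output := m.out

theorem step_cfg (F : Fragment σ δ k) (w : List σ) (q : F.Q) (m : Mem δ k) :
    F.toTM.step w (F.cfg (.inl q) m) =
      some (F.cfg (F.actionAt w q m).next (m.act w (F.actionAt w q m))) := rfl

theorem step_cfg_exit (F : Fragment σ δ k) (w : List σ) (b : Bool) (m : Mem δ k) :
    F.toTM.step w (F.cfg (.inr b) m) = none := rfl

theorem Run.reaches {F : Fragment σ δ k} {w : List σ} {S : ℕ} {q : F.Q} {m m' : Mem δ k} {b : Bool}
    (h : F.Run w S q m b m') :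
    StateTransition.Reaches (F.toTM.step w) (F.cfg (.inl q) m) (F.cfg (.inr b) m') := by
  induction h with
  | @exit q m b hS hn =>
    refine .single ?_
    rw [step_cfg, hn]; rfl
  | @step q m q' b m' hS hn _ ih =>
    refine .head ?_ ih
    rw [step_cfg, hn]; rfl

theorem Run.head_lt {F : Fragment σ δ k} {w : List σ} {S : ℕ} {q : F.Q} {m m' : Mem δ k} {b : Bool}
    (h : F.Run w S q m b m') (hm' : ∀ j, m'.head j < S) {c : F.toTM.Cfg}
    (hc : StateTransition.Reaches (F.toTM.step w) (F.cfg (.inl q) m) c) : ∀ j, c.head j < S := by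
  induction h with
  | @exit q m b hS hn =>
    rcases hc.cases_head with rfl | ⟨d, hd, hdc⟩
    · exact hS
    · rw [step_cfg, hn, Option.mem_some] at hd
      subst hd
      rcases hdc.cases_head with rfl | ⟨d, hd, -⟩
      · exact hm'
      · simp [step_cfg_exit] at hd
  | @step q m q' b m' hS hn _ ih =>
    rcases hc.cases_head with rfl | ⟨d, hd, hdc⟩
    · exact hS
    · rw [step_cfg, hn, Option.mem_some] at hd
      subst hd
      exact ih hm' hdc

end Fragment

/-- The number of tape cells for a counter that is bounded by a polynomial is logarithmic. -/
theorem size_pow_le (d n : ℕ) : ((n + 2) ^ d).size + 2 ≤ (3 * d + 3) * (Nat.log 2 n + 1) := by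
  have h : n + 2 ≤ 2 ^ (Nat.log 2 n + 2) := by
    have := Nat.lt_pow_succ_log_self (b := 2) (by norm_num) n
    have h1 : 1 ≤ 2 ^ Nat.log 2 n := Nat.one_le_two_pow
    rw [pow_succ] at this ⊢
    rw [pow_succ]
    omega
  have : ((n + 2) ^ d).size ≤ (Nat.log 2 n + 2) * d + 1 := by
    rw [Nat.size_le]
    calc (n + 2) ^ d ≤ (2 ^ (Nat.log 2 n + 2)) ^ d := Nat.pow_le_pow_left h d
      _ = 2 ^ ((Nat.log 2 n + 2) * d) := (pow_mul _ _ _).symm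
      _ < _ := Nat.pow_lt_pow_right (by norm_num) (by omega)
  nlinarith [Nat.zero_le (Nat.log 2 n * d), Nat.zero_le (Nat.log 2 n)]

/-- A counter program whose registers stay polynomially bounded in the length of the input word
can be carried out in logarithmic space. -/
theorem CounterProg.exists_isLogspace (c : CounterProg σ δ) (d : ℕ) (g : List σ → List δ)
    (h : ∀ w, ∃ ρ p, Exec w ((w.length + 2) ^ d) c ⟨fun _ => 0, 0, []⟩ ⟨ρ, p, g w⟩) :
    ∃ M : OfflineTM σ δ, M.IsLogspace ∧ ∀ w, M.HaltsWith w (g w) := by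
  set F := Fragment.ofProg c.width c with hF
  have hrun : ∀ w, ∃ b m', F.Run w (((w.length + 2) ^ d).size + 2) F.start
      ⟨0, fun _ _ => none, fun _ => 0, []⟩ b m' ∧ m'.out = g w ∧ ∀ j, m'.head j = 0 := by
    intro w
    obtain ⟨ρ, p, he⟩ := h w
    obtain ⟨b, m', hr, hm'⟩ := Fragment.run_ofProg (k := c.width) he le_rfl
      (m := ⟨0, fun _ _ => none, fun _ => 0, []⟩)
      ⟨rfl, by simp, rfl, fun j => ⟨rfl, [], by simp, rfl, by
        funext i; cases i <;> simp [tapeOf]⟩⟩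
    exact ⟨b, m', hr, hm'.2.2.1, fun j => (hm'.2.2.2 j).1⟩
  have hhalt : ∀ w, F.toTM.HaltsWith w (g w) := by
    intro w
    obtain ⟨b, m', hr, ho, -⟩ := hrun w
    exact ⟨_, hr.reaches, F.step_cfg_exit w b m', ho⟩
  refine ⟨F.toTM, ⟨fun w => ⟨_, hhalt w⟩, 3 * d + 3, fun w x hx j => ?_⟩, hhalt⟩
  obtain ⟨b, m', hr, -, hh⟩ := hrun w
  exact (hr.head_lt (fun j => by rw [hh]; omega) hx j).trans_le (size_pow_le d _)

/-! ### Functions computed by counter programs -/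

namespace CounterProg

/-- Execution of a loop whose successive stores are known. -/
theorem Exec.loop_iterate {w : List σ} {B n : ℕ} {t : CounterTest σ} {c : CounterProg σ δ}
    (st : ℕ → Store δ) (hpos : ∀ i < n, t.holds w (st i) = true) (hend : t.holds w (st n) = false)
    (hbody : ∀ i < n, Exec w B c (st i) (st (i + 1))) : Exec w B (loop t c) (st 0) (st n) := by
  induction n generalizing st with
  | zero => exact .loop_done hend
  | succ n ih =>
    exact .loop_step (hpos 0 (by omega)) (hbody 0 (by omega))
      (ih (fun i => st (i + 1)) (fun i hi => hpos _ (by omega)) hend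
        fun i hi => hbody _ (by omega))

/-- Setting a register to `0`. -/
def clear (r : ℕ) : CounterProg σ δ := loop (.pos r) (dec r)

/-- Adding register `a` to register `b` and setting `a` to `0`. -/
def transfer (a b : ℕ) : CounterProg σ δ := loop (.pos a) (seq (dec a) (inc b))

/-- Adding register `a` to register `b`, with the help of a register `c` that holds `0`. -/
def addTo (a b c : ℕ) : CounterProg σ δ :=
  seq (loop (.pos a) (seq (dec a) (seq (inc b) (inc c)))) (transfer c a)

section

variable {w : List σ} {B : ℕ} {ρ : ℕ → ℕ} {p : ℕ} {o : List δ}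

theorem Exec.regs_eq {c : CounterProg σ δ} {s : Store δ} {ρ' : ℕ → ℕ}
    (h : Exec w B c s ⟨ρ, p, o⟩) (hρ : ∀ x, ρ' x = ρ x) : Exec w B c s ⟨ρ', p, o⟩ := by
  have : ρ' = ρ := funext hρ
  exact this ▸ h

theorem exec_clear (r : ℕ) : Exec w B (clear r) ⟨ρ, p, o⟩ ⟨Function.update ρ r 0, p, o⟩ := by
  have := Exec.loop_iterate (w := w) (B := B) (n := ρ r) (t := .pos r) (c := dec r)
    (fun i => (⟨Function.update ρ r (ρ r - i), p, o⟩ : Store δ))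
    (fun i hi => by simp [CounterTest.holds]; omega) (by simp [CounterTest.holds])
    (fun i hi => (Exec.dec (r := r) (by simp; omega)).regs_eq fun x => by
      simp only [Function.update_apply]; grind)
  simp only [Nat.sub_zero, Function.update_eq_self, Nat.sub_self] at this
  exact this

theorem exec_transfer {a b : ℕ} (hab : a ≠ b) (hB : ρ b + ρ a ≤ B) :
    Exec w B (transfer a b) ⟨ρ, p, o⟩
      ⟨Function.update (Function.update ρ a 0) b (ρ b + ρ a), p, o⟩ := by
  have := Exec.loop_iterate (w := w) (B := B) (n := ρ a) (t := .pos a)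
    (c := seq (dec a) (inc b)) (fun i =>
      (⟨Function.update (Function.update ρ a (ρ a - i)) b (ρ b + i), p, o⟩ : Store δ))
    (fun i hi => by simp [CounterTest.holds, hab]; omega) (by simp [CounterTest.holds, hab])
    (fun i hi => .seq (.dec (by simp [hab]; omega)) <|
      (Exec.inc (r := b) (by simp [hab.symm]; omega)).regs_eq fun x => by
        simp only [Function.update_apply]; grind)
  simp only [Nat.sub_zero, Function.update_eq_self, Nat.sub_self, Nat.add_zero] at this
  exact this

theorem exec_addTo {a b c : ℕ} (hab : a ≠ b) (hac : a ≠ c) (hbc : b ≠ c) (hc : ρ c = 0)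
    (hB : ρ b + ρ a ≤ B) :
    Exec w B (addTo a b c) ⟨ρ, p, o⟩ ⟨Function.update ρ b (ρ b + ρ a), p, o⟩ := by
  have := Exec.loop_iterate (w := w) (B := B) (n := ρ a) (t := .pos a)
    (c := seq (dec a) (seq (inc b) (inc c))) (fun i =>
      (⟨Function.update (Function.update (Function.update ρ a (ρ a - i)) b (ρ b + i)) c i, p, o⟩ :
        Store δ))
    (fun i hi => by simp [CounterTest.holds, hab, hac]; omega)
    (by simp [CounterTest.holds, hab, hac])
    (fun i hi => .seq (.dec (by simp [hab, hac]; omega)) <| .seq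
      (.inc (by simp [hab.symm, hbc]; omega)) <|
      (Exec.inc (r := c) (by simp [hbc.symm, hac.symm]; omega)).regs_eq fun x => by
        simp only [Function.update_apply]; grind)
  have h0 : Function.update (Function.update (Function.update ρ a (ρ a - 0)) b (ρ b + 0)) c 0 =
      ρ := by
    funext x
    simp only [Function.update_apply]
    grind
  rw [h0] at this
  refine .seq this ((exec_transfer hac.symm (by simp [hab, hac]; omega)).regs_eq fun x => ?_)
  simp only [Function.update_apply]
  grind

end

end CounterProg

open CounterProg

/-- The environment `v` extended by a new variable `0` with value `a`; the other variables are
renumbered. -/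
def consEnv (a : ℕ) (v : ℕ → ℕ) : ℕ → ℕ
  | 0 => a
  | i + 1 => v i

/-- A function of the input word and of (finitely many) numerical variables is computable in
logarithmic space: given the variables in any registers `ins i < s`, a counter program computes the
value in register `s`, with scratch registers from `s` on, and no register exceeds a fixed
polynomial in an upper bound `X` for the length of the word and the variables. In particular,
the function is polynomially bounded. -/
def LogspaceFun (f : List σ → (ℕ → ℕ) → ℕ) : Prop :=
  ∃ n d : ℕ, ∀ (ins : ℕ → ℕ) (s : ℕ), (∀ i < n, ins i < s) → ∃ c : CounterProg σ OutSymbol,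
    ∀ (w : List σ) (X : ℕ) (ρ v : ℕ → ℕ), 2 ≤ X → w.length ≤ X → (∀ i < n, v i ≤ X) →
      (∀ i < n, ρ (ins i) = v i) → (∀ r ≥ s, ρ r = 0) →
      f w v ≤ X ^ d ∧ ∀ o, Exec w (X ^ d) c ⟨ρ, 0, o⟩ ⟨Function.update ρ s (f w v), 0, o⟩

/-- A word that depends on the input word and on (finitely many) numerical variables can be written
on the output tape in logarithmic space. -/
def LogspaceEmits (g : List σ → (ℕ → ℕ) → List OutSymbol) : Prop :=
  ∃ n d : ℕ, ∀ (ins : ℕ → ℕ) (s : ℕ), (∀ i < n, ins i < s) → ∃ c : CounterProg σ OutSymbol,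
    ∀ (w : List σ) (X : ℕ) (ρ v : ℕ → ℕ), 2 ≤ X → w.length ≤ X → (∀ i < n, v i ≤ X) →
      (∀ i < n, ρ (ins i) = v i) → (∀ r ≥ s, ρ r = 0) →
      ∀ o, Exec w (X ^ d) c ⟨ρ, 0, o⟩ ⟨ρ, 0, o ++ g w v⟩

/-- Polynomial boundedness in the length of the input word and the first few variables. -/
def PolyBounded (f : List σ → (ℕ → ℕ) → ℕ) : Prop :=
  ∃ n d : ℕ, ∀ (w : List σ) (X : ℕ) (v : ℕ → ℕ), 2 ≤ X → w.length ≤ X → (∀ i < n, v i ≤ X) →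
    f w v ≤ X ^ d

namespace LogspaceFun

variable {f g a : List σ → (ℕ → ℕ) → ℕ}

theorem polyBounded (hf : LogspaceFun f) : PolyBounded f := by
  obtain ⟨n, d, h⟩ := hf
  obtain ⟨c, hc⟩ := h id n (fun i hi => hi)
  exact ⟨n, d, fun w X v hX hw hv => (hc w X (fun r => if r < n then v r else 0) v hX hw hv
    (fun i hi => if_pos hi) (fun r hr => if_neg (by omega))).1⟩

theorem of_eq (hf : LogspaceFun f) (h : ∀ w v, f w v = g w v) : LogspaceFun g := by
  have : f = g := by funext w v; exact h w v
  exact this ▸ hf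

theorem zero : LogspaceFun fun (_ : List σ) _ => 0 :=
  ⟨0, 0, fun ins s _ => ⟨clear s, fun w X ρ v _ _ _ _ h0 => ⟨by simp, fun o => exec_clear s⟩⟩⟩

theorem succ (hf : LogspaceFun f) : LogspaceFun fun w v => f w v + 1 := by
  obtain ⟨n, d, h⟩ := hf
  refine ⟨n, d + 1, fun ins s hs => ?_⟩
  obtain ⟨c, hc⟩ := h ins s hs
  refine ⟨seq c (inc s), fun w X ρ v hX hw hv hi h0 => ?_⟩
  obtain ⟨h₁, h₂⟩ := hc w X ρ v hX hw hv hi h0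
  have hd : f w v + 1 ≤ X ^ (d + 1) := by
    have : 1 ≤ X ^ d := Nat.one_le_pow _ _ (by omega)
    rw [pow_succ]; nlinarith
  refine ⟨hd, fun o => .seq ((h₂ o).mono (Nat.pow_le_pow_right (by omega) (by omega))) ?_⟩
  exact (Exec.inc (by simpa using hd)).regs_eq fun x => by simp

theorem const (c : ℕ) : LogspaceFun fun (_ : List σ) _ => c := by
  induction c with
  | zero => exact zero
  | succ c ih => exact ih.succ

theorem var (i : ℕ) : LogspaceFun fun (_ : List σ) v => v i := by
  refine ⟨i + 1, 1, fun ins s hs => ⟨addTo (ins i) s (s + 1), fun w X ρ v _ hw hv hi h0 => ?_⟩⟩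
  have hlt := hs i (by omega)
  have hvi : v i ≤ X ^ 1 := by simpa using hv i (by omega)
  refine ⟨hvi, fun o => ?_⟩
  have := exec_addTo (w := w) (B := X ^ 1) (ρ := ρ) (p := 0) (o := o) (a := ins i) (b := s)
    (c := s + 1) (by omega) (by omega) (by omega) (h0 _ (by omega))
    (by rw [h0 s le_rfl, hi i (by omega)]; omega)
  rwa [h0 s le_rfl, hi i (by omega), Nat.zero_add] at this

theorem rename (hf : LogspaceFun f) (τ : ℕ → ℕ) : LogspaceFun fun w v => f w fun i => v (τ i) := by
  obtain ⟨n, d, h⟩ := hf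
  obtain ⟨N, hN⟩ : ∃ N, ∀ i < n, τ i < N :=
    ⟨(Finset.range n).sup τ + 1, fun i hi =>
      Nat.lt_succ_of_le (Finset.le_sup (f := τ) (Finset.mem_range.2 hi))⟩
  refine ⟨N, d, fun ins s hs => ?_⟩
  obtain ⟨c, hc⟩ := h (fun i => ins (τ i)) s fun i hi => hs _ (hN i hi)
  exact ⟨c, fun w X ρ v hX hw hv hi h0 => hc w X ρ _ hX hw (fun i h => hv _ (hN i h))
    (fun i h => hi _ (hN i h)) h0⟩

end LogspaceFun

section

variable {f a : List σ → (ℕ → ℕ) → ℕ}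

/-- A local definition in front of a computation. -/
theorem LogspaceFun.letIn (ha : LogspaceFun a) (hf : LogspaceFun f) :
    LogspaceFun fun w v => f w (consEnv (a w v) v) := by
  obtain ⟨na, da, ha⟩ := ha
  obtain ⟨nf, df, hf⟩ := hf
  refine ⟨max na nf, (da + 1) * (df + 1), fun ins s hs => ?_⟩
  obtain ⟨ca, hca⟩ := ha ins s fun i hi => hs i (by omega)
  obtain ⟨cf, hcf⟩ := hf (consEnv s ins) (s + 1) (by
    rintro (_ | i) hi
    · exact Nat.lt_succ_self s
    · exact (hs i (by omega)).trans (Nat.lt_succ_self s))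
  refine ⟨seq ca (seq cf (seq (clear s) (transfer (s + 1) s))),
    fun w X ρ v hX hw hv hi h0 => ?_⟩
  obtain ⟨ha₁, ha₂⟩ := hca w X ρ v hX hw (fun i h => hv i (by omega)) (fun i h => hi i (by omega)) h0
  have hX' : X ≤ X ^ (da + 1) := Nat.le_self_pow (by omega) _
  have haX : X ^ da ≤ X ^ (da + 1) := Nat.pow_le_pow_right (by omega) (by omega)
  obtain ⟨hf₁, hf₂⟩ := hcf w (X ^ (da + 1)) (Function.update ρ s (a w v)) (consEnv (a w v) v)
    (hX.trans hX') (hw.trans hX')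
    (by
      rintro (_ | i) h
      · exact ha₁.trans haX
      · exact (hv i (by omega)).trans hX')
    (by
      rintro (_ | i) h
      · simp [consEnv]
      · have := hs i (by omega)
        simp only [consEnv]
        rw [Function.update_of_ne (by omega), hi i (by omega)])
    (fun r hr => by rw [Function.update_of_ne (by omega), h0 r (by omega)])
  have hbf : (X ^ (da + 1)) ^ df ≤ X ^ ((da + 1) * (df + 1)) := by
    rw [← pow_mul]; exact Nat.pow_le_pow_right (by omega) (by nlinarith)
  have hba : X ^ da ≤ X ^ ((da + 1) * (df + 1)) :=
    Nat.pow_le_pow_right (by omega) (by nlinarith)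
  refine ⟨hf₁.trans hbf, fun o => .seq ((ha₂ o).mono hba) (.seq ((hf₂ o).mono hbf)
    (.seq (exec_clear s) ?_))⟩
  refine (exec_transfer (by omega) (by simpa using hf₁.trans hbf)).regs_eq fun x => ?_
  have := h0 (s + 1) (by omega)
  simp only [Function.update_apply]
  grind

end

/-! ### Recursion and access to the input -/

section

variable {f a N : List σ → (ℕ → ℕ) → ℕ} {h : List σ → (ℕ → ℕ) → ℕ}
  {g : List σ → (ℕ → ℕ) → List OutSymbol}

/-- Primitive recursion, provided that the values stay polynomially bounded. -/
theorem LogspaceFun.prec (hN : LogspaceFun N) (ha : LogspaceFun a) (hh : LogspaceFun h)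
    (hb : ∃ n d : ℕ, ∀ (w : List σ) (X : ℕ) (v : ℕ → ℕ), 2 ≤ X → w.length ≤ X →
      (∀ i < n, v i ≤ X) → ∀ i ≤ N w v,
      Nat.rec (motive := fun _ => ℕ) (a w v) (fun i x => h w (consEnv i (consEnv x v))) i ≤ X ^ d) :
    LogspaceFun fun w v =>
      Nat.rec (motive := fun _ => ℕ) (a w v) (fun i x => h w (consEnv i (consEnv x v))) (N w v) := by
  obtain ⟨nN, dN, hN⟩ := hN
  obtain ⟨na, da, ha⟩ := ha
  obtain ⟨nh, dh, hh⟩ := hh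
  obtain ⟨nb, db, hb⟩ := hb
  set E := dN + da + db + 1 with hE
  refine ⟨nN + na + nh + nb, E * (dh + 1), fun ins s hs => ?_⟩
  obtain ⟨cN, hcN⟩ := hN ins s fun i hi => hs i (by omega)
  obtain ⟨ca, hca⟩ := ha ins (s + 2) fun i hi => (hs i (by omega)).trans (by omega)
  obtain ⟨ch, hch⟩ := hh (consEnv (s + 1) (consEnv (s + 2) ins)) (s + 3) (by
    rintro (_ | _ | i) hi
    · simp [consEnv]
    · simp [consEnv]
    · exact (hs i (by omega)).trans (by omega))
  refine ⟨seq cN (seq ca (seq (loop (.pos s) (seq (dec s) (seq ch (seq (clear (s + 2))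
    (seq (transfer (s + 3) (s + 2)) (inc (s + 1))))))) (seq (clear (s + 1)) (transfer (s + 2) s)))),
    fun w X ρ v hX hw hv hi h0 => ?_⟩
  set R : ℕ → ℕ := fun i => Nat.rec (motive := fun _ => ℕ) (a w v)
    (fun i x => h w (consEnv i (consEnv x v))) i with hR
  have hpow : ∀ e ≤ E, X ^ e ≤ X ^ E := fun e he => Nat.pow_le_pow_right (by omega) he
  have hpowE : X ^ E ≤ X ^ (E * (dh + 1)) := Nat.pow_le_pow_right (by omega) (by nlinarith)
  have hpowh : (X ^ E) ^ dh ≤ X ^ (E * (dh + 1)) := by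
    rw [← pow_mul]; exact Nat.pow_le_pow_right (by omega) (by nlinarith)
  have hXE : X ≤ X ^ E := Nat.le_self_pow (by omega) _
  obtain ⟨hN₁, hN₂⟩ := hcN w X ρ v hX hw (fun i h => hv i (by omega)) (fun i h => hi i (by omega)) h0
  obtain ⟨ha₁, ha₂⟩ := hca w X (Function.update ρ s (N w v)) v hX hw (fun i h => hv i (by omega))
    (fun i h => by
      rw [Function.update_of_ne (hs i (by omega)).ne, hi i (by omega)])
    (fun r hr => by rw [Function.update_of_ne (by omega), h0 r (by omega)])
  have hRb : ∀ i ≤ N w v, R i ≤ X ^ E := fun i hiN =>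
    (hb w X v hX hw (fun i h => hv i (by omega)) i hiN).trans (hpow _ (by omega))
  refine ⟨(hRb _ le_rfl).trans hpowE, fun o => ?_⟩
  let st : ℕ → Store OutSymbol := fun i => ⟨Function.update (Function.update
    (Function.update ρ s (N w v - i)) (s + 1) i) (s + 2) (R i), 0, o⟩
  have hbody : ∀ i < N w v, Exec w (X ^ (E * (dh + 1))) (seq (dec s) (seq ch (seq (clear (s + 2))
      (seq (transfer (s + 3) (s + 2)) (inc (s + 1)))))) (st i) (st (i + 1)) := by
    intro i hiN
    refine .seq (.dec (by simp; omega)) ?_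
    obtain ⟨hh₁, hh₂⟩ := hch w (X ^ E) (Function.update (Function.update (Function.update
      (Function.update ρ s (N w v - i)) (s + 1) i) (s + 2) (R i)) s (N w v - i - 1))
      (consEnv i (consEnv (R i) v)) (hX.trans hXE) (hw.trans hXE)
      (by
        rintro (_ | _ | j) hj
        · exact (hiN.le.trans hN₁).trans (hpow _ (by omega))
        · exact hRb i hiN.le
        · exact (hv j (by omega)).trans hXE)
      (by
        rintro (_ | _ | j) hj
        · simp [consEnv]
        · simp [consEnv]
        · have := hs j (by omega)
          simp only [consEnv]
          rw [Function.update_of_ne (by omega), Function.update_of_ne (by omega),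
            Function.update_of_ne (by omega), Function.update_of_ne (by omega), hi j (by omega)])
      (fun r hr => by
        rw [Function.update_of_ne (by omega), Function.update_of_ne (by omega),
            Function.update_of_ne (by omega), Function.update_of_ne (by omega), h0 r (by omega)])
    have hRs : h w (consEnv i (consEnv (R i) v)) = R (i + 1) := rfl
    rw [hRs] at hh₁ hh₂
    have hi' : i + 1 ≤ X ^ (E * (dh + 1)) :=
      (Nat.succ_le_of_lt hiN).trans (hN₁.trans ((hpow _ (by omega)).trans hpowE))
    have h3 := h0 (s + 3) (by omega)
    simp only [st, Function.update_self, Function.update_of_ne (show s ≠ s + 1 by omega),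
      Function.update_of_ne (show s ≠ s + 2 by omega)]
    refine .seq ((hh₂ o).mono hpowh) (.seq (exec_clear _) (.seq (exec_transfer (by omega) ?_)
      ((Exec.inc ?_).regs_eq fun x => ?_)))
    · simpa using (hRb _ hiN).trans hpowE
    · simpa using hi'
    · simp only [Function.update_apply]
      grind
  have hloop := Exec.loop_iterate (t := .pos s) st (n := N w v)
    (fun i hi => by simp [CounterTest.holds, st]; omega) (by simp [CounterTest.holds, st]) hbody
  have hst0 : st 0 = ⟨Function.update (Function.update ρ s (N w v)) (s + 2) (a w v), 0, o⟩ := by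
    have h1 := h0 (s + 1) (by omega)
    simp only [st, Store.mk.injEq, and_true]
    funext x
    simp only [Function.update_apply, show R 0 = a w v from rfl]
    clear * - h1
    grind
  rw [hst0] at hloop
  refine .seq ((hN₂ o).mono ((hpow _ (by omega)).trans hpowE)) (.seq
    ((ha₂ o).mono ((hpow _ (by omega)).trans hpowE)) (.seq hloop (.seq (exec_clear _)
    ((exec_transfer (by omega) ?_).regs_eq fun x => ?_))))
  · simpa using (hRb _ le_rfl).trans hpowE
  · have h1 := h0 (s + 1) (by omega)
    have h2 := h0 (s + 2) (by omega)
    simp only [Function.update_apply]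
    grind

/-- Concatenation of the words for the indices `0, …, N - 1`. -/
theorem LogspaceEmits.flatMap_range (hN : LogspaceFun N) (hg : LogspaceEmits g) :
    LogspaceEmits fun w v => (List.range (N w v)).flatMap fun i => g w (consEnv i v) := by
  obtain ⟨nN, dN, hN⟩ := hN
  obtain ⟨ng, dg, hg⟩ := hg
  set E := dN + 1 with hE
  refine ⟨nN + ng, E * (dg + 1), fun ins s hs => ?_⟩
  obtain ⟨cN, hcN⟩ := hN ins s fun i hi => hs i (by omega)
  obtain ⟨cg, hcg⟩ := hg (consEnv (s + 1) ins) (s + 2) (by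
    rintro (_ | i) hi
    · simp [consEnv]
    · exact (hs i (by omega)).trans (by omega))
  refine ⟨seq cN (seq (loop (.pos s) (seq (dec s) (seq cg (inc (s + 1))))) (clear (s + 1))),
    fun w X ρ v hX hw hv hi h0 o => ?_⟩
  have hpowE : X ^ E ≤ X ^ (E * (dg + 1)) := Nat.pow_le_pow_right (by omega) (by nlinarith)
  have hpowg : (X ^ E) ^ dg ≤ X ^ (E * (dg + 1)) := by
    rw [← pow_mul]; exact Nat.pow_le_pow_right (by omega) (by nlinarith)
  have hXE : X ≤ X ^ E := Nat.le_self_pow (by omega) _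
  have hNE : X ^ dN ≤ X ^ E := Nat.pow_le_pow_right (by omega) (by omega)
  obtain ⟨hN₁, hN₂⟩ := hcN w X ρ v hX hw (fun i h => hv i (by omega)) (fun i h => hi i (by omega)) h0
  let st : ℕ → Store OutSymbol := fun i => ⟨Function.update
    (Function.update ρ s (N w v - i)) (s + 1) i, 0,
      o ++ (List.range i).flatMap fun i => g w (consEnv i v)⟩
  have hbody : ∀ i < N w v, Exec w (X ^ (E * (dg + 1))) (seq (dec s) (seq cg (inc (s + 1))))
      (st i) (st (i + 1)) := by
    intro i hiN
    refine .seq (.dec (by simp; omega)) ?_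
    have hg₁ := hcg w (X ^ E) (Function.update (Function.update
      (Function.update ρ s (N w v - i)) (s + 1) i) s (N w v - i - 1))
      (consEnv i v) (hX.trans hXE) (hw.trans hXE)
      (by
        rintro (_ | j) hj
        · exact (hiN.le.trans hN₁).trans hNE
        · exact (hv j (by omega)).trans hXE)
      (by
        rintro (_ | j) hj
        · simp [consEnv]
        · have := hs j (by omega)
          simp only [consEnv]
          rw [Function.update_of_ne (by omega), Function.update_of_ne (by omega),
            Function.update_of_ne (by omega), hi j (by omega)])
      (fun r hr => by
        rw [Function.update_of_ne (by omega), Function.update_of_ne (by omega),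
            Function.update_of_ne (by omega), h0 r (by omega)])
      (o ++ (List.range i).flatMap fun i => g w (consEnv i v))
    simp only [st, Function.update_self, Function.update_of_ne (show s ≠ s + 1 by omega)]
    have happ : (o ++ (List.range (i + 1)).flatMap fun i => g w (consEnv i v)) =
        (o ++ (List.range i).flatMap fun i => g w (consEnv i v)) ++ g w (consEnv i v) := by
      simp [List.range_succ, List.flatMap_append]
    rw [happ]
    refine .seq (hg₁.mono hpowg) ((Exec.inc ?_).regs_eq fun x => ?_)
    · have : i + 1 ≤ X ^ (E * (dg + 1)) :=
        (Nat.succ_le_of_lt hiN).trans (hN₁.trans (hNE.trans hpowE))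
      simpa using this
    · simp only [Function.update_apply]
      grind
  have hloop := Exec.loop_iterate (t := .pos s) st (n := N w v)
    (fun i hi => by simp [CounterTest.holds, st]; omega) (by simp [CounterTest.holds, st]) hbody
  have hst0 : st 0 = ⟨Function.update ρ s (N w v), 0, o⟩ := by
    have h1 := h0 (s + 1) (by omega)
    simp only [st, Store.mk.injEq, List.range_zero, List.flatMap_nil, List.append_nil,
      and_true]
    funext x
    simp only [Function.update_apply]
    grind
  rw [hst0] at hloop
  refine .seq ((hN₂ o).mono (hNE.trans hpowE)) (.seq hloop ((exec_clear _).regs_eq fun x => ?_))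
  have h1 := h0 s le_rfl
  have h2 := h0 (s + 1) (by omega)
  simp only [Function.update_apply]
  grind

theorem LogspaceEmits.append {g' : List σ → (ℕ → ℕ) → List OutSymbol} (hg : LogspaceEmits g)
    (hg' : LogspaceEmits g') : LogspaceEmits fun w v => g w v ++ g' w v := by
  obtain ⟨n, d, hg⟩ := hg
  obtain ⟨n', d', hg'⟩ := hg'
  refine ⟨n + n', d + d', fun ins s hs => ?_⟩
  obtain ⟨c, hc⟩ := hg ins s fun i hi => hs i (by omega)
  obtain ⟨c', hc'⟩ := hg' ins s fun i hi => hs i (by omega)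
  refine ⟨seq c c', fun w X ρ v hX hw hv hi h0 o => .seq
    ((hc w X ρ v hX hw (fun i h => hv i (by omega)) (fun i h => hi i (by omega)) h0 o).mono
      (Nat.pow_le_pow_right (by omega) (by omega))) ?_⟩
  rw [← List.append_assoc]
  exact ((hc' w X ρ v hX hw (fun i h => hv i (by omega)) (fun i h => hi i (by omega)) h0 _).mono
      (Nat.pow_le_pow_right (by omega) (by omega)))

theorem LogspaceEmits.symbol (b : OutSymbol) : LogspaceEmits fun (_ : List σ) _ => [b] :=
  ⟨0, 0, fun _ _ _ => ⟨emit b, fun _ _ _ _ _ _ _ _ _ _ => .emit⟩⟩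

theorem LogspaceEmits.of_eq {g' : List σ → (ℕ → ℕ) → List OutSymbol} (hg : LogspaceEmits g)
    (h : ∀ w v, g w v = g' w v) : LogspaceEmits g' := by
  have : g = g' := by funext w v; exact h w v
  exact this ▸ hg

theorem inputCell_min (w : List σ) (i : ℕ) : inputCell w (min i (w.length + 1)) = inputCell w i := by
  rcases le_total i (w.length + 1) with h | h
  · rw [min_eq_left h]
  · rw [min_eq_right h]
    obtain ⟨n, rfl⟩ : ∃ n, i = n + 1 := ⟨i - 1, by omega⟩
    have h₁ : w[w.length]? = none := by simp
    have h₂ : w[n]? = none := by simp; omega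
    simp only [inputCell, h₁, h₂]

/-- The input word can be inspected at any position. -/
theorem LogspaceFun.cell (P : InputCell σ → Bool) (hP : P .leftEnd = false) (ha : LogspaceFun a) :
    LogspaceFun fun w v => (P (inputCell w (a w v))).toNat := by
  obtain ⟨n, d, ha⟩ := ha
  refine ⟨n, d, fun ins s hs => ?_⟩
  obtain ⟨c, hc⟩ := ha ins s hs
  let back : CounterProg σ OutSymbol := loop (.pos (s + 1)) (seq (dec (s + 1)) (move .left))
  refine ⟨seq c (seq (loop (.pos s) (seq (dec s) (seq (inc (s + 1)) (move .right))))
    (seq (loop (.inp P) (seq (inc s) back)) back)), fun w X ρ v hX hw hv hi h0 => ?_⟩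
  obtain ⟨h₁, h₂⟩ := hc w X ρ v hX hw hv hi h0
  have hX1 : 1 ≤ X ^ d := Nat.one_le_pow _ _ (by omega)
  refine ⟨(Bool.toNat_le _).trans hX1, fun o => .seq (h₂ o) ?_⟩
  have hs0 := h0 s le_rfl
  have hs1 := h0 (s + 1) (by omega)
  -- the way to the position, while the counter is moved to register `s + 1`
  have hgo := Exec.loop_iterate (w := w) (B := X ^ d) (n := a w v) (t := .pos s)
    (c := seq (dec s) (seq (inc (s + 1)) (move .right)))
    (fun i => (⟨Function.update (Function.update ρ s (a w v - i)) (s + 1) i,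
      min i (w.length + 1), o⟩ : Store OutSymbol))
    (fun i hi => by simp [CounterTest.holds]; omega) (by simp [CounterTest.holds])
    (fun i hi => by
      have hp : min (i + 1) (w.length + 1) =
          min (HeadMove.right.apply (min i (w.length + 1))) (w.length + 1) := by
        simp only [HeadMove.apply]; omega
      simp only [hp]
      refine .seq (.dec (by simp; omega)) (.seq (.inc (by simp; omega))
        (Exec.move.regs_eq fun x => ?_))
      simp only [Function.update_apply]
      grind)
  have hst : (⟨Function.update (Function.update ρ s (a w v - 0)) (s + 1) 0,
      min 0 (w.length + 1), o⟩ : Store OutSymbol) = ⟨Function.update ρ s (a w v), 0, o⟩ := by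
    simp only [Store.mk.injEq, and_true]
    refine ⟨?_, by omega⟩
    funext x
    simp only [Function.update_apply]
    grind
  rw [hst] at hgo
  have hback : ∀ (ρ' : ℕ → ℕ) (p : ℕ), p ≤ ρ' (s + 1) → p ≤ w.length + 1 →
      Exec w (X ^ d) back ⟨ρ', p, o⟩ ⟨Function.update ρ' (s + 1) 0, 0, o⟩ := by
    intro ρ' p hp hpw
    have := Exec.loop_iterate (w := w) (B := X ^ d) (n := ρ' (s + 1)) (t := .pos (s + 1))
      (c := seq (dec (s + 1)) (move .left))
      (fun i => (⟨Function.update ρ' (s + 1) (ρ' (s + 1) - i), p - i, o⟩ : Store OutSymbol))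
      (fun i hi => by simp [CounterTest.holds]; omega) (by simp [CounterTest.holds])
      (fun i hi => by
        have hq : p - (i + 1) = min (HeadMove.left.apply (p - i)) (w.length + 1) := by
          simp only [HeadMove.apply]; omega
        simp only [hq]
        refine .seq (.dec (by simp; omega)) (Exec.move.regs_eq fun x => ?_)
        simp only [Function.update_apply]
        grind)
    simp only [Nat.sub_zero, Function.update_eq_self, Nat.sub_self, Nat.sub_eq_zero_of_le hp]
      at this
    exact this
  refine .seq hgo ?_
  have htest : CounterTest.holds w (⟨Function.update (Function.update ρ s (a w v - a w v)) (s + 1)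
      (a w v), min (a w v) (w.length + 1), o⟩ : Store OutSymbol) (.inp P) =
      P (inputCell w (a w v)) := by
    simp only [CounterTest.holds, inputCell_min]
  cases hPc : P (inputCell w (a w v))
  · refine .seq (.loop_done (htest.trans hPc)) ((hback _ _ (by simp) (by omega)).regs_eq fun x => ?_)
    simp only [Function.update_apply]
    grind
  · refine .seq (.loop_step (htest.trans hPc) (.seq (.inc (by simpa using hX1))
      (hback _ _ (by simp) (by omega))) (.loop_done ?_)) ((hback _ _ (by simp) (by omega)).regs_eq
        fun x => ?_)
    · simpa [CounterTest.holds, inputCell] using hP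
    · simp only [Function.update_apply]
      grind

/-- The length of the input word. -/
theorem LogspaceFun.length : LogspaceFun fun (w : List σ) _ => w.length := by
  refine ⟨0, 2, fun ins s _ => ?_⟩
  refine ⟨seq (loop (.inp fun x => match x with | .rightEnd => false | _ => true)
    (seq (inc s) (move .right))) (seq (dec s)
    (loop (.inp fun x => match x with | .leftEnd => false | _ => true) (move .left))),
    fun w X ρ v hX hw hv hi h0 => ⟨hw.trans (Nat.le_self_pow (by omega) _), fun o => ?_⟩⟩
  have hs0 := h0 s le_rfl
  have hB : w.length + 1 ≤ X ^ 2 := by nlinarith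
  have hr : inputCell w (w.length + 1) = .rightEnd := by simp [inputCell]
  have hgo := Exec.loop_iterate (w := w) (B := X ^ 2) (n := w.length + 1)
    (t := .inp fun x => match x with | .rightEnd => false | _ => true)
    (c := seq (inc s) (move .right))
    (fun i => (⟨Function.update ρ s i, i, o⟩ : Store OutSymbol))
    (fun i hi => by
      rcases i with _ | i
      · rfl
      · have : w[i]? = some w[i] := List.getElem?_eq_getElem (by omega)
        simp [CounterTest.holds, inputCell, this])
    (by simp [CounterTest.holds, hr])
    (fun i hi => by
      have hp : i + 1 = min (HeadMove.right.apply i) (w.length + 1) := by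
        simp only [HeadMove.apply]; omega
      refine .seq (.inc (by simpa using by omega)) ?_
      have := (Exec.move (w := w) (B := X ^ 2) (v := .right) (ρ := Function.update
        (Function.update ρ s i) s (Function.update ρ s i s + 1)) (p := i) (o := o)).regs_eq
        (ρ' := Function.update ρ s (i + 1)) fun x => by simp
      rwa [← hp] at this)
  have hback := Exec.loop_iterate (w := w) (B := X ^ 2) (n := w.length + 1)
    (t := .inp fun x => match x with | .leftEnd => false | _ => true)
    (c := move .left)
    (fun i => (⟨Function.update ρ s w.length, w.length + 1 - i, o⟩ : Store OutSymbol))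
    (fun i hi => by
      obtain ⟨j, hj⟩ : ∃ j, w.length + 1 - i = j + 1 := ⟨w.length - i, by omega⟩
      simp only [CounterTest.holds, hj, inputCell]
      cases w[j]? <;> rfl)
    (by simp [CounterTest.holds, inputCell])
    (fun i hi => by
      have hp : w.length + 1 - (i + 1) =
          min (HeadMove.left.apply (w.length + 1 - i)) (w.length + 1) := by
        simp only [HeadMove.apply]; omega
      simp only [hp]
      exact .move)
  simp only [Nat.sub_zero, Nat.sub_self] at hback
  have h00 : Function.update ρ s 0 = ρ := by rw [← hs0, Function.update_eq_self]
  simp only [h00] at hgo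
  exact .seq hgo (.seq ((Exec.dec (by simp)).regs_eq fun x => by simp) hback)

end

/-! ### Arithmetic and predicates in logarithmic space -/

namespace PolyBounded

variable {f g N : List σ → (ℕ → ℕ) → ℕ}

theorem mul (hf : PolyBounded f) (hg : PolyBounded g) :
    PolyBounded fun w v => f w v * g w v := by
  obtain ⟨n, d, hf⟩ := hf
  obtain ⟨n', d', hg⟩ := hg
  refine ⟨n + n', d + d', fun w X v hX hw hv => ?_⟩
  rw [pow_add]
  exact Nat.mul_le_mul (hf w X v hX hw fun i hi => hv i (by omega))
    (hg w X v hX hw fun i hi => hv i (by omega))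

theorem add (hf : PolyBounded f) (hg : PolyBounded g) :
    PolyBounded fun w v => f w v + g w v := by
  obtain ⟨n, d, hf⟩ := hf
  obtain ⟨n', d', hg⟩ := hg
  refine ⟨n + n', d + d' + 1, fun w X v hX hw hv => ?_⟩
  have h₁ := (hf w X v hX hw fun i hi => hv i (by omega)).trans
    (Nat.pow_le_pow_right (by omega) (show d ≤ d + d' by omega))
  have h₂ := (hg w X v hX hw fun i hi => hv i (by omega)).trans
    (Nat.pow_le_pow_right (by omega) (show d' ≤ d + d' by omega))
  rw [pow_succ]
  nlinarith [Nat.zero_le (X ^ (d + d'))]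

theorem sum (hN : PolyBounded N) (hf : PolyBounded f) :
    PolyBounded fun w v => ∑ i ∈ Finset.range (N w v), f w (consEnv i v) := by
  obtain ⟨n, d, hN⟩ := hN
  obtain ⟨n', d', hf⟩ := hf
  refine ⟨n + n', (d + 1) * (d' + 1), fun w X v hX hw hv => ?_⟩
  have hN' := hN w X v hX hw fun i hi => hv i (by omega)
  have hXd : X ≤ X ^ (d + 1) := Nat.le_self_pow (by omega) _
  have hdd : X ^ d ≤ X ^ (d + 1) := Nat.pow_le_pow_right (by omega) (by omega)
  calc ∑ i ∈ Finset.range (N w v), f w (consEnv i v)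
      ≤ ∑ i ∈ Finset.range (N w v), (X ^ (d + 1)) ^ d' := by
        refine Finset.sum_le_sum fun i hi => hf w _ _ (hX.trans hXd) (hw.trans hXd) ?_
        rintro (_ | j) hj
        · exact ((Finset.mem_range.1 hi).le.trans hN').trans hdd
        · exact (hv j (by omega)).trans hXd
    _ = N w v * (X ^ (d + 1)) ^ d' := by simp
    _ ≤ X ^ (d + 1) * (X ^ (d + 1)) ^ d' := Nat.mul_le_mul_right _ (hN'.trans hdd)
    _ = X ^ ((d + 1) * (d' + 1)) := by rw [mul_comm, ← pow_succ, ← pow_mul]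

end PolyBounded

open Classical in
/-- Decidability in logarithmic space of a property of the input word and the variables. -/
def LogspacePred (P : List σ → (ℕ → ℕ) → Prop) : Prop :=
  LogspaceFun fun w v => if P w v then 1 else 0

namespace LogspaceFun

variable {f g a b c N h : List σ → (ℕ → ℕ) → ℕ} {P R : List σ → (ℕ → ℕ) → Prop}

theorem comp₁ {F : List σ → ℕ → ℕ} (hF : LogspaceFun fun w v => F w (v 0)) (ha : LogspaceFun a) :
    LogspaceFun fun w v => F w (a w v) :=
  ha.letIn hF

theorem comp₂ {F : List σ → ℕ → ℕ → ℕ} (hF : LogspaceFun fun w v => F w (v 0) (v 1))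
    (ha : LogspaceFun a) (hb : LogspaceFun b) : LogspaceFun fun w v => F w (a w v) (b w v) :=
  hb.letIn ((ha.rename (· + 1)).letIn hF)

theorem comp₃ {F : List σ → ℕ → ℕ → ℕ → ℕ} (hF : LogspaceFun fun w v => F w (v 0) (v 1) (v 2))
    (ha : LogspaceFun a) (hb : LogspaceFun b) (hc : LogspaceFun c) :
    LogspaceFun fun w v => F w (a w v) (b w v) (c w v) :=
  hc.letIn ((hb.rename (· + 1)).letIn ((ha.rename (· + 2)).letIn hF))

/-- Primitive recursion for a function `G` that satisfies the recursion equations and is bounded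
by a polynomially bounded function. -/
theorem prec_of (G : List σ → (ℕ → ℕ) → ℕ → ℕ) (hN : LogspaceFun N) (ha : LogspaceFun a)
    (hh : LogspaceFun h) (hb : PolyBounded b) (h0 : ∀ w v, G w v 0 = a w v)
    (hs : ∀ w v i, G w v (i + 1) = h w (consEnv i (consEnv (G w v i) v)))
    (hle : ∀ w v, ∀ i ≤ N w v, G w v i ≤ b w v) : LogspaceFun fun w v => G w v (N w v) := by
  have hG : ∀ w v i, Nat.rec (motive := fun _ => ℕ) (a w v)
      (fun i x => h w (consEnv i (consEnv x v))) i = G w v i := by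
    intro w v i
    induction i with
    | zero => exact (h0 w v).symm
    | succ i ih => rw [hs, ← ih]
  refine (prec hN ha hh ?_).of_eq fun w v => hG w v _
  obtain ⟨n, d, hb⟩ := hb
  exact ⟨n, d, fun w X v hX hw hv i hi => by
    rw [hG]; exact (hle w v i hi).trans (hb w X v hX hw hv)⟩

theorem add (hf : LogspaceFun f) (hg : LogspaceFun g) : LogspaceFun fun w v => f w v + g w v :=
  comp₂ (F := fun _ x y => x + y) (prec_of (fun _ v i => v 0 + i) (var 1) (var 0) (var 1).succ
    ((var 0).polyBounded.add (var 1).polyBounded) (fun _ _ => rfl) (fun _ _ _ => rfl)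
    fun _ _ _ hi => Nat.add_le_add_left hi _) hf hg

theorem mul (hf : LogspaceFun f) (hg : LogspaceFun g) : LogspaceFun fun w v => f w v * g w v :=
  comp₂ (F := fun _ x y => x * y) (prec_of (fun _ v i => v 0 * i) (var 1) zero
    ((var 1).add (var 2)) ((var 0).polyBounded.mul (var 1).polyBounded) (fun _ _ => rfl)
    (fun _ _ _ => rfl) fun _ _ _ hi => Nat.mul_le_mul_left _ hi) hf hg

theorem pred (hf : LogspaceFun f) : LogspaceFun fun w v => f w v - 1 :=
  comp₁ (F := fun _ x => x - 1) (prec_of (fun _ _ i => i - 1) (var 0) zero (var 0)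
    (var 0).polyBounded (fun _ _ => rfl) (fun _ _ _ => rfl)
    fun _ _ i hi => (Nat.sub_le i 1).trans hi) hf

theorem sub (hf : LogspaceFun f) (hg : LogspaceFun g) : LogspaceFun fun w v => f w v - g w v :=
  comp₂ (F := fun _ x y => x - y) (prec_of (fun _ v i => v 0 - i) (var 1) (var 0) (var 1).pred
    (var 0).polyBounded (fun _ _ => rfl) (fun _ _ _ => rfl) fun _ _ _ _ => Nat.sub_le _ _) hf hg

theorem ite [∀ w v, Decidable (P w v)] (hP : LogspacePred P) (hf : LogspaceFun f)
    (hg : LogspaceFun g) : LogspaceFun fun w v => if P w v then f w v else g w v := by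
  classical
  -- a recursion whose number of steps is the truth value
  refine (prec_of (fun w v i => if i = 0 then g w v else f w v) hP hg (hf.rename (· + 2))
    (hf.polyBounded.add hg.polyBounded) (fun _ _ => rfl) (fun _ _ _ => rfl) fun w v i _ => ?_).of_eq
    fun w v => ?_
  · split_ifs <;> omega
  · by_cases h : P w v <;> simp [h]

theorem pow_const (hf : LogspaceFun f) (k : ℕ) : LogspaceFun fun w v => f w v ^ k := by
  induction k with
  | zero => exact const 1
  | succ k ih => exact ih.mul hf

end LogspaceFun

namespace LogspacePred

variable {f g : List σ → (ℕ → ℕ) → ℕ} {P R : List σ → (ℕ → ℕ) → Prop}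

theorem of_iff (hP : LogspacePred P) (h : ∀ w v, P w v ↔ R w v) : LogspacePred R := by
  have : P = R := by funext w v; exact propext (h w v)
  exact this ▸ hP

theorem comp₁ {P : List σ → ℕ → Prop} (hP : LogspacePred fun w v => P w (v 0))
    (hf : LogspaceFun f) : LogspacePred fun w v => P w (f w v) :=
  hf.letIn hP

theorem le (hf : LogspaceFun f) (hg : LogspaceFun g) : LogspacePred fun w v => f w v ≤ g w v :=
  ((LogspaceFun.const 1).sub (hf.sub hg)).of_eq fun w v => by split_ifs <;> omega

theorem not (hP : LogspacePred P) : LogspacePred fun w v => ¬ P w v :=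
  ((LogspaceFun.const 1).sub hP).of_eq fun w v => by by_cases h : P w v <;> simp [h]

theorem and (hP : LogspacePred P) (hR : LogspacePred R) : LogspacePred fun w v => P w v ∧ R w v :=
  (hP.mul hR).of_eq fun w v => by by_cases h : P w v <;> by_cases h' : R w v <;> simp [h, h']

theorem or (hP : LogspacePred P) (hR : LogspacePred R) : LogspacePred fun w v => P w v ∨ R w v :=
  (hP.not.and hR.not).not.of_iff fun w v => by tauto

theorem lt (hf : LogspaceFun f) (hg : LogspaceFun g) : LogspacePred fun w v => f w v < g w v :=
  (le hg hf).not.of_iff fun _ _ => not_le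

theorem eq (hf : LogspaceFun f) (hg : LogspaceFun g) : LogspacePred fun w v => f w v = g w v :=
  ((le hf hg).and (le hg hf)).of_iff fun _ _ => le_antisymm_iff.symm

end LogspacePred

/-- A renaming that makes a function of a recursion index ignore the value of the recursion. -/
theorem consEnv_consEnv_rename (i x : ℕ) (v : ℕ → ℕ) :
    (fun j => consEnv i (consEnv x v) (consEnv 0 (· + 2) j)) = consEnv i v := by
  funext j; rcases j with _ | j <;> rfl

namespace LogspaceFun

variable {f g a b c N h : List σ → (ℕ → ℕ) → ℕ} {P R : List σ → (ℕ → ℕ) → Prop}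

theorem sum (hN : LogspaceFun N) (hf : LogspaceFun f) :
    LogspaceFun fun w v => ∑ i ∈ Finset.range (N w v), f w (consEnv i v) :=
  prec_of (fun w v n => ∑ i ∈ Finset.range n, f w (consEnv i v)) hN zero
    ((var 1).add (hf.rename (consEnv 0 (· + 2)))) (hN.polyBounded.sum hf.polyBounded)
    (fun _ _ => rfl) (fun w v i => by
      rw [Finset.sum_range_succ, consEnv_consEnv_rename]; rfl)
    fun w v i hi => Finset.sum_le_sum_of_subset (Finset.range_subset_range.2 hi)

theorem div (hf : LogspaceFun f) (hg : LogspaceFun g) : LogspaceFun fun w v => f w v / g w v := by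
  classical
  -- the quotient is the number of those `i < x` with `(i + 1) * y ≤ x`
  refine comp₂ (F := fun _ x y => x / y) ((ite (LogspacePred.eq (var 1) zero) zero
    (sum (var 0) (ite (P := fun _ v => (v 0 + 1) * v 2 ≤ v 1)
      (LogspacePred.le ((var 0).succ.mul (var 2)) (var 1)) (const 1) zero))).of_eq
      fun w v => ?_) hf hg
  split_ifs with h
  · simp [h]
  · have hpos : 0 < v 1 := Nat.pos_of_ne_zero h
    have : (Finset.range (v 0)).filter (fun i => (i + 1) * v 1 ≤ v 0) = Finset.range (v 0 / v 1) := by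
      ext i
      simp only [Finset.mem_filter, Finset.mem_range]
      rw [← Nat.le_div_iff_mul_le hpos]
      have := Nat.div_le_self (v 0) (v 1)
      omega
    rw [← Finset.card_range (v 0 / v 1), ← this, Finset.card_filter]
    rfl

theorem mod (hf : LogspaceFun f) (hg : LogspaceFun g) : LogspaceFun fun w v => f w v % g w v :=
  (hf.sub (hg.mul (hf.div hg))).of_eq fun w v => by
    have := Nat.mod_add_div (f w v) (g w v); omega

end LogspaceFun

namespace LogspacePred

variable {N f : List σ → (ℕ → ℕ) → ℕ} {P : List σ → (ℕ → ℕ) → Prop}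

theorem exists_lt (hN : LogspaceFun N) (hP : LogspacePred P) :
    LogspacePred fun w v => ∃ i < N w v, P w (consEnv i v) := by
  classical
  refine (lt LogspaceFun.zero (LogspaceFun.sum hN hP)).of_iff fun w v => ?_
  rw [Nat.pos_iff_ne_zero, Ne, Finset.sum_eq_zero_iff]
  simp

theorem prime (hf : LogspaceFun f) : LogspacePred fun w v => (f w v).Prime := by
  classical
  have h : LogspacePred (σ := σ) fun _ v => 2 ≤ v 0 ∧ ¬ ∃ i < v 0, 2 ≤ i ∧ v 0 % i = 0 :=
    (le (.const 2) (.var 0)).and (exists_lt (.var 0)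
      ((le (.const 2) (.var 0)).and (eq ((LogspaceFun.var 1).mod (.var 0)) .zero)) :
        LogspacePred fun _ v => ∃ i < v 0, 2 ≤ i ∧ v 0 % i = 0).not
  refine comp₁ (P := fun _ x => x.Prime) (h.of_iff fun w v => ?_) hf
  rw [Nat.prime_def_lt']
  refine and_congr_right fun h2 => ?_
  simp only [not_exists, not_and, Nat.dvd_iff_mod_eq_zero]
  exact ⟨fun h m h1 h2 h3 => h m h2 h1 h3, fun h m h1 h2 h3 => h m h2 h1 h3⟩

end LogspacePred

namespace LogspaceFun

variable {f g a b c N p : List σ → (ℕ → ℕ) → ℕ} {P R : List σ → (ℕ → ℕ) → Prop}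

theorem findGreatest [∀ w v, DecidablePred fun i => P w (consEnv i v)] (hN : LogspaceFun N)
    (hP : LogspacePred P) :
    LogspaceFun fun w v => Nat.findGreatest (fun i => P w (consEnv i v)) (N w v) := by
  classical
  refine prec_of (fun w v n => Nat.findGreatest (fun i => P w (consEnv i v)) n)
    (h := fun w v => if P w (consEnv (v 0 + 1) fun i => v (i + 2)) then v 0 + 1 else v 1)
    hN zero (ite ?_ (var 0).succ (var 1)) hN.polyBounded (fun _ _ => rfl)
    (fun w v i => ?_) fun w v i hi => (Nat.findGreatest_le i).trans hi
  · have := (var (σ := σ) 0).succ.letIn (hP.rename (consEnv 0 (· + 3)))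
    refine this.of_eq fun w v => ?_
    have he : (fun i => consEnv (v 0 + 1) v (consEnv 0 (· + 3) i)) =
        consEnv (v 0 + 1) fun i => v (i + 2) := by
      funext j; rcases j with _ | j <;> rfl
    simp only [he]
    congr
  · rw [Nat.findGreatest_succ]; rfl

/-- Products modulo a number; the case distinction makes the value bounded also for modulus `0`. -/
theorem prod_mod (hN : LogspaceFun N) (hf : LogspaceFun f) (hp : LogspaceFun p) :
    LogspaceFun fun w v => if p w v = 0 then 0 else
      (∏ i ∈ Finset.range (N w v), f w (consEnv i v)) % p w v := by
  refine prec_of (fun w v n => if p w v = 0 then 0 else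
    (∏ i ∈ Finset.range n, f w (consEnv i v)) % p w v) hN
    (a := fun w v => if p w v = 0 then 0 else 1 % p w v)
    (h := fun w v => if p w (fun i => v (i + 2)) = 0 then 0 else
      v 1 * f w (fun i => v (consEnv 0 (· + 2) i)) % p w (fun i => v (i + 2)))
    (ite (LogspacePred.eq hp zero) zero ((const 1).mod hp))
    (ite (LogspacePred.eq (hp.rename (· + 2)) zero) zero
      (((var 1).mul (hf.rename _)).mod (hp.rename (· + 2)))) hp.polyBounded
    (fun w v => by simp) (fun w v i => ?_) fun w v i hi => ?_
  · have h : (fun j => consEnv i (consEnv (if p w v = 0 then 0 else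
        (∏ i ∈ Finset.range i, f w (consEnv i v)) % p w v) v) (j + 2)) = v := rfl
    rw [consEnv_consEnv_rename, h]
    by_cases h0 : p w v = 0
    · simp [h0]
    · simp [h0, consEnv, Finset.prod_range_succ]
  · split_ifs with h0
    · exact Nat.zero_le _
    · exact (Nat.mod_lt _ (Nat.pos_of_ne_zero h0)).le

theorem pow_mod (hf : LogspaceFun f) (hN : LogspaceFun N) (hp : LogspaceFun p) :
    LogspaceFun fun w v => if p w v = 0 then 0 else f w v ^ N w v % p w v :=
  (prod_mod hN (hf.rename (· + 1)) hp).of_eq fun w v => by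
    have : ∀ i, f w (fun j => consEnv i v (j + 1)) = f w v := fun _ => rfl
    simp [this]

end LogspaceFun

theorem two_pow_size_succ (n : ℕ) :
    2 ^ (n + 1).size = if 2 ^ n.size = n + 1 then 2 * 2 ^ n.size else 2 ^ n.size := by
  have h₁ : n < 2 ^ n.size := Nat.lt_size_self n
  split_ifs with h
  · rw [← h, Nat.size_pow, pow_succ, mul_comm]
  · congr 1
    refine le_antisymm (Nat.size_le.2 (by omega)) (Nat.size_le_size (Nat.le_succ n))

theorem size_succ_eq (n : ℕ) :
    (n + 1).size = if 2 ^ n.size = n + 1 then n.size + 1 else n.size := by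
  refine Nat.pow_right_injective le_rfl ?_
  dsimp only
  rw [two_pow_size_succ]
  split_ifs
  · rw [pow_succ, mul_comm]
  · rfl

theorem two_pow_size_le (n : ℕ) : 2 ^ n.size ≤ 2 * n + 1 := by
  rcases Nat.eq_zero_or_pos n with rfl | hn
  · simp
  · obtain ⟨k, hk⟩ : ∃ k, n.size = k + 1 := ⟨n.size - 1, by have := Nat.size_pos.2 hn; omega⟩
    have : 2 ^ k ≤ n := Nat.lt_size.1 (by omega)
    rw [hk, pow_succ]; omega

namespace LogspaceFun

variable {f g a b c N p : List σ → (ℕ → ℕ) → ℕ}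

theorem two_pow_size (hf : LogspaceFun f) : LogspaceFun fun w v => 2 ^ (f w v).size :=
  comp₁ (F := fun _ x => 2 ^ x.size) (prec_of (fun _ _ n => 2 ^ n.size) (var 0) (const 1)
    (ite (P := fun _ v => v 1 = v 0 + 1) (LogspacePred.eq (var 1) (var 0).succ)
      ((const 2).mul (var 1)) (var 1)) ((const 2).mul (var 0)).succ.polyBounded
    (fun _ _ => by simp) (fun _ _ i => two_pow_size_succ i)
    fun _ v i hi => (two_pow_size_le i).trans (by omega)) hf

theorem size (hf : LogspaceFun f) : LogspaceFun fun w v => (f w v).size :=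
  comp₁ (F := fun _ x => x.size) (prec_of (fun _ _ n => n.size) (var 0) zero
    (ite (P := fun _ v => 2 ^ (v 0).size = v 0 + 1)
      (LogspacePred.eq (var 0).two_pow_size (var 0).succ) (var 1).succ (var 1))
    (var 0).polyBounded
    (fun _ _ => by simp) (fun _ _ i => size_succ_eq i)
    fun _ v i hi => (Nat.size_le.2 (Nat.lt_two_pow_self)).trans hi) hf

end LogspaceFun

/-! ### Binary output -/

namespace LogspaceFun

variable {f N : List σ → (ℕ → ℕ) → ℕ}

theorem shiftRight (hf : LogspaceFun f) (hN : LogspaceFun N) :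
    LogspaceFun fun w v => f w v / 2 ^ N w v :=
  prec_of (fun w v n => f w v / 2 ^ n) hN hf ((var 1).div (const 2)) hf.polyBounded
    (fun w v => by simp) (fun w v i => by rw [pow_succ, ← Nat.div_div_eq_div_mul]; rfl)
    fun w v i _ => Nat.div_le_self _ _

end LogspaceFun

namespace LogspaceEmits

variable {f N : List σ → (ℕ → ℕ) → ℕ}

theorem replicate (hN : LogspaceFun N) (b : OutSymbol) :
    LogspaceEmits fun w v => List.replicate (N w v) b :=
  (flatMap_range hN (symbol b)).of_eq fun w v => by
    rw [← List.map_eq_flatMap, List.map_const', List.length_range]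

end LogspaceEmits

theorem encodeNat_eq (n : ℕ) : encodeNat n = ((List.range n.size).flatMap fun i =>
    List.replicate (n / 2 ^ i % 2) (OutSymbol.bit true) ++
      List.replicate (1 - n / 2 ^ i % 2) (OutSymbol.bit false)) ++ [OutSymbol.sep] := by
  have h : ∀ i, List.replicate (n / 2 ^ i % 2) (OutSymbol.bit true) ++
      List.replicate (1 - n / 2 ^ i % 2) (OutSymbol.bit false) = [OutSymbol.bit (n.testBit i)] := by
    intro i
    rw [Nat.testBit_eq_decide_div_mod_eq]
    rcases Nat.mod_two_eq_zero_or_one (n / 2 ^ i) with h | h <;> simp [h]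
  have hb : n.bits = (List.range n.size).map n.testBit := by
    refine List.ext_getElem (by simp [Nat.size_eq_bits_len]) fun i h₁ h₂ => ?_
    rw [List.getElem_map, List.getElem_range, Nat.testBit_eq_inth, List.getI_eq_getElem _ h₁]
  simp only [h, encodeNat, hb, List.map_map, ← List.map_eq_flatMap]
  rfl

theorem LogspaceEmits.encodeNat {f : List σ → (ℕ → ℕ) → ℕ} (hf : LogspaceFun f) :
    LogspaceEmits fun w v => encodeNat (f w v) := by
  have hbit : LogspaceFun fun w v => f w (fun i => v (i + 1)) / 2 ^ v 0 % 2 :=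
    ((hf.rename (· + 1)).shiftRight (.var 0)).mod (.const 2)
  exact ((flatMap_range hf.size ((replicate hbit (.bit true)).append
    (replicate ((LogspaceFun.const 1).sub hbit) (.bit false)))).append (symbol .sep)).of_eq
      fun w v => (encodeNat_eq (f w v)).symm

/-- To solve a problem in logarithmic space it suffices to give the answer as the list of the values
`val w i` for those indices `i < N w` that have a certain property, with all three ingredients
computable in logarithmic space. -/
theorem LogspaceSolvable.of_logspaceFun {ι : Type} {enc : ι → List σ} {R : ι → List ℕ → Prop}
    {N : List σ → ℕ} {val : List σ → ℕ → ℕ} {P : List σ → ℕ → Prop}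
    [∀ w, DecidablePred (P w)]
    (hN : LogspaceFun fun w _ => N w) (hval : LogspaceFun fun w v => val w (v 0))
    (hP : LogspacePred fun w v => P w (v 0))
    (hR : ∀ x, R x (((List.range (N (enc x))).filter fun i => P (enc x) i).map (val (enc x)))) :
    LogspaceSolvable enc R := by
  classical
  have hE : LogspaceEmits fun (w : List σ) _ =>
      encodeNats (((List.range (N w)).filter fun i => P w i).map (val w)) := by
    -- the entry with index `i` is written as often as the truth value of its property says
    refine (LogspaceEmits.flatMap_range hN (LogspaceEmits.flatMap_range hP
      (LogspaceEmits.encodeNat (hval.rename (· + 1))))).of_eq fun w v => ?_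
    simp only [encodeNats]
    induction List.range (N w) with
    | nil => rfl
    | cons i l ih =>
      rw [List.flatMap_cons, ih, List.filter_cons]
      by_cases h : P w i
      · simp [h, consEnv]
      · simp [h, consEnv]
  obtain ⟨n, d, h⟩ := hE
  obtain ⟨c, hc⟩ := h id n fun _ h => h
  obtain ⟨M, hM, hM'⟩ := c.exists_isLogspace d (fun w =>
    encodeNats (((List.range (N w)).filter fun i => P w i).map (val w))) fun w =>
      ⟨_, _, hc w (w.length + 2) (fun _ => 0) (fun _ => 0) (by omega) (by omega)
        (by simp) (by simp) (by simp) []⟩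
  exact ⟨M, hM, fun x => ⟨_, hM' _, hR x⟩⟩

end Machines

/-! ### Chinese remaindering with low precision -/

/-- The Chinese remainder theorem: the representation by cofactors agrees with `A` up to a multiple
of the modulus. -/
theorem exists_sum_mul_prod_erase_eq (S : Finset ℕ) (hS : ∀ p ∈ S, p.Prime) (A : ℕ) (c : ℕ → ℕ)
    (hc : ∀ p ∈ S, c p * ∏ q ∈ S.erase p, q ≡ A [MOD p]) :
    ∃ k : ℤ, ((∑ p ∈ S, c p * ∏ q ∈ S.erase p, q : ℕ) : ℤ) = A + k * (∏ p ∈ S, p : ℕ) := by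
  have hdvd : ∀ p ∈ S, (p : ℤ) ∣ ((∑ p ∈ S, c p * ∏ q ∈ S.erase p, q : ℕ) : ℤ) - A := by
    intro p hp
    refine (Nat.modEq_iff_dvd.1 ?_)
    rw [← Finset.add_sum_erase _ _ hp]
    have : p ∣ ∑ x ∈ S.erase p, c x * ∏ q ∈ S.erase x, q :=
      Finset.dvd_sum fun x hx => Dvd.dvd.mul_left (Finset.dvd_prod_of_mem _
        (Finset.mem_erase.2 ⟨(Finset.ne_of_mem_erase hx).symm, hp⟩)) _
    simpa using ((hc p hp).symm.add (Nat.modEq_zero_iff_dvd.2 this).symm)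
  have := Finset.prod_dvd_of_coprime (t := S) (s := fun p : ℕ => (p : ℤ)) (fun p hp q hq hpq =>
    Nat.isCoprime_iff_coprime.2 ((Nat.coprime_primes (hS p hp) (hS q hq)).2 hpq)) hdvd
  obtain ⟨k, hk⟩ := this
  refine ⟨k, ?_⟩
  rw [Nat.cast_prod]
  linarith [mul_comm k (∏ p ∈ S, (p : ℤ))]

/-- The fraction `A / N` for a product `N` of distinct primes `p`, computed from the residues of `A`:
it is the sum of the fractions `c p / p` modulo `1`. Rounding every summand down to a multiple of
`1 / D` costs at most `η / D` in total; this bound is added before the reduction modulo `1`, so that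
no wrap-around occurs unless `A / N` is close to `1`. -/
theorem crt_fraction (S : Finset ℕ) (hS : ∀ p ∈ S, p.Prime) (A D η : ℕ) (c : ℕ → ℕ)
    (hc : ∀ p ∈ S, c p * ∏ q ∈ S.erase p, q ≡ A [MOD p]) (hη : S.card ≤ η)
    (hA : D * A + η * (∏ p ∈ S, p) < D * ∏ p ∈ S, p) :
    D * A ≤ (∏ p ∈ S, p) * ((∑ p ∈ S, c p * D / p + η) % D) ∧
      (∏ p ∈ S, p) * ((∑ p ∈ S, c p * D / p + η) % D) ≤ D * A + η * ∏ p ∈ S, p := by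
  obtain ⟨k, hk⟩ := exists_sum_mul_prod_erase_eq S hS A c hc
  set N := ∏ p ∈ S, p with hN
  set s := ∑ p ∈ S, c p * D / p with hs
  have hterm : ∀ p ∈ S, N * (c p * D / p) ≤ D * (c p * ∏ q ∈ S.erase p, q) ∧
      D * (c p * ∏ q ∈ S.erase p, q) ≤ N * (c p * D / p) + N := by
    intro p hp
    have hNp : N = p * ∏ q ∈ S.erase p, q := (Finset.mul_prod_erase S id hp).symm
    have h₁ := Nat.div_mul_le_self (c p * D) p
    have h₂ := Nat.lt_div_mul_add (a := c p * D) (hS p hp).pos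
    rw [hNp]
    constructor
    · calc _ = (c p * D / p * p) * ∏ q ∈ S.erase p, q := by ring
        _ ≤ (c p * D) * ∏ q ∈ S.erase p, q := Nat.mul_le_mul_right _ h₁
        _ = _ := by ring
    · calc _ = (c p * D) * ∏ q ∈ S.erase p, q := by ring
        _ ≤ (c p * D / p * p + p) * ∏ q ∈ S.erase p, q := Nat.mul_le_mul_right _ h₂.le
        _ = _ := by ring
  have hlow : N * s ≤ D * ∑ p ∈ S, c p * ∏ q ∈ S.erase p, q := by
    rw [hs, Finset.mul_sum, Finset.mul_sum]
    exact Finset.sum_le_sum fun p hp => (hterm p hp).1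
  have hupp : D * ∑ p ∈ S, c p * ∏ q ∈ S.erase p, q ≤ N * (s + η) := by
    calc _ ≤ ∑ p ∈ S, (N * (c p * D / p) + N) := by
          rw [Finset.mul_sum]; exact Finset.sum_le_sum fun p hp => (hterm p hp).2
      _ = N * s + S.card * N := by
          rw [Finset.sum_add_distrib, ← Finset.mul_sum, Finset.sum_const, smul_eq_mul]
      _ ≤ N * (s + η) := by nlinarith
  have hN0 : (0 : ℤ) < N := by
    exact_mod_cast Finset.prod_pos fun p hp => (hS p hp).pos
  zify at hlow hupp hA ⊢
  push_cast at hk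
  rw [hk] at hlow hupp
  have h₁ : (D : ℤ) * A ≤ N * (s + η - k * D) := by nlinarith
  have h₂ : (N : ℤ) * (s + η - k * D) ≤ D * A + η * N := by nlinarith
  have h₃ : (0 : ℤ) ≤ s + η - k * D := by
    by_contra h
    have : (D : ℤ) * A ≥ 0 := by positivity
    nlinarith
  have h₄ : (s + η - k * D : ℤ) < D := by
    by_contra h
    nlinarith
  have hmod : ((s : ℤ) + η) % D = s + η - k * D := by
    rw [← Int.emod_eq_of_lt h₃ h₄, Int.sub_mul_emod_self_right]
  rw [hmod]
  exact ⟨h₁, h₂⟩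

/-! ### A chain of products of primes -/

/-- The primes in `(ℓ, j]`. -/
def basePrimes (ℓ j : ℕ) : Finset ℕ := (Finset.Ioc ℓ j).filter Nat.Prime

theorem prod_basePrimes_succ (ℓ j : ℕ) : ∏ p ∈ basePrimes ℓ (j + 1), p =
    if ℓ < j + 1 ∧ (j + 1).Prime then (∏ p ∈ basePrimes ℓ j, p) * (j + 1)
    else ∏ p ∈ basePrimes ℓ j, p := by
  split_ifs with h
  · have : basePrimes ℓ (j + 1) = insert (j + 1) (basePrimes ℓ j) := by
      ext p; simp only [basePrimes, Finset.mem_filter, Finset.mem_Ioc, Finset.mem_insert]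
      constructor
      · rintro ⟨⟨h₁, h₂⟩, h₃⟩
        rcases Nat.lt_or_ge j p with h' | h'
        · exact .inl (by omega)
        · exact .inr ⟨⟨h₁, h'⟩, h₃⟩
      · rintro (rfl | ⟨⟨h₁, h₂⟩, h₃⟩)
        · exact ⟨⟨h.1, le_rfl⟩, h.2⟩
        · exact ⟨⟨h₁, by omega⟩, h₃⟩
    rw [this, Finset.prod_insert (by simp [basePrimes]), mul_comm]
  · congr 1
    ext p; simp only [basePrimes, Finset.mem_filter, Finset.mem_Ioc]
    constructor
    · rintro ⟨⟨h₁, h₂⟩, h₃⟩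
      refine ⟨⟨h₁, ?_⟩, h₃⟩
      rcases Nat.lt_or_ge j p with h' | h'
      · obtain rfl : p = j + 1 := by omega
        exact absurd ⟨h₁, h₃⟩ h
      · exact h'
    · rintro ⟨⟨h₁, h₂⟩, h₃⟩
      exact ⟨⟨h₁, by omega⟩, h₃⟩

/-- If `A / N'` is at most about `1 / 2` and `N' / N = u / v` is less than `2` by a margin, then `A / N`
is less than `1` by a margin. -/
theorem fraction_step {A D η Y N N' u v : ℕ} (hN : 0 < N) (hvY : v ≤ Y)
    (huv : u + 1 ≤ 2 * v) (hNN : N' * v = N * u) (hD : 6 * Y * η < D)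
    (h : 2 * D * A ≤ N' * (D + 2 * η)) : D * A + η * N < D * N := by
  have h₁ : 2 * v * (D * A) ≤ N * (u * (D + 2 * η)) := by
    calc 2 * v * (D * A) = (2 * D * A) * v := by ring
      _ ≤ N' * (D + 2 * η) * v := Nat.mul_le_mul_right _ h
      _ = N' * v * (D + 2 * η) := by ring
      _ = N * (u * (D + 2 * η)) := by rw [hNN]; ring
  have h₂ : u * (D + 2 * η) + 2 * v * η < 2 * v * D := by
    have h3 : (u + 1) * (D + 2 * η) ≤ 2 * v * (D + 2 * η) := Nat.mul_le_mul_right _ huv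
    have h4 : 6 * v * η ≤ 6 * Y * η := Nat.mul_le_mul_right _ (Nat.mul_le_mul_left _ hvY)
    nlinarith
  have h₃ : 2 * v * (D * A + η * N) < 2 * v * (D * N) := by
    calc 2 * v * (D * A + η * N) = 2 * v * (D * A) + N * (2 * v * η) := by ring
      _ ≤ N * (u * (D + 2 * η) + 2 * v * η) := by rw [mul_add N]; exact Nat.add_le_add_right h₁ _
      _ < N * (2 * v * D) := Nat.mul_lt_mul_of_pos_left h₂ hN
      _ = 2 * v * (D * N) := by ring
  exact lt_of_mul_lt_mul_left h₃ (Nat.zero_le _)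

/-- The chain of the numbers `N j r`, where `N j r` is the product of the primes in `(ℓ, j]` and of
a prime `r ∈ (X, 2 X ^ 2]`, in lexicographic order. Since by Bertrand's postulate each of them except
the last ones (with `j = X`) is at least about half of a later one, `A / N j r` is smaller than `1` by
a margin as long as `A / N j' r'` is not much more than `1 / 2` for all later `(j', r')`. -/
theorem fraction_lt_of_forall_later {A D η ℓ X : ℕ} (hℓ : 2 ≤ ℓ) (hX : 4 ≤ X)
    (hD : 6 * (2 * X ^ 2) * η < D) (hA : A ≤ ∏ p ∈ basePrimes ℓ X, p) {j r : ℕ} (hj : j ≤ X)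
    (hr : r.Prime) (hXr : X < r) (hrY : r ≤ 2 * X ^ 2)
    (hlater : ∀ j' r', j' ≤ X → r'.Prime → X < r' → r' ≤ 2 * X ^ 2 →
      (j < j' ∨ j = j' ∧ r < r') →
      D * A + η * ((∏ p ∈ basePrimes ℓ j', p) * r') < D * ((∏ p ∈ basePrimes ℓ j', p) * r') →
      2 * D * A ≤ ((∏ p ∈ basePrimes ℓ j', p) * r') * (D + 2 * η)) :
    D * A + η * ((∏ p ∈ basePrimes ℓ j, p) * r) < D * ((∏ p ∈ basePrimes ℓ j, p) * r) := by
  have hpos : ∀ j, 0 < ∏ p ∈ basePrimes ℓ j, p := fun j =>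
    Finset.prod_pos fun p hp => (Finset.mem_filter.1 hp).2.pos
  obtain ⟨n, hn⟩ : ∃ n, (X - j) * (2 * X ^ 2 + 1) + (2 * X ^ 2 - r) = n := ⟨_, rfl⟩
  induction n using Nat.strong_induction_on generalizing j r with
  | _ n ih =>
    have hNpos : 0 < (∏ p ∈ basePrimes ℓ j, p) * r := Nat.mul_pos (hpos j) hr.pos
    rcases Nat.lt_or_ge j X with hjX | hjX
    · -- a later element of the chain is good by induction, hence passes to the given one
      have key : ∀ j' r' u v, j' ≤ X → r'.Prime → X < r' → r' ≤ 2 * X ^ 2 →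
          (j < j' ∨ j = j' ∧ r < r') → v ≤ 2 * X ^ 2 → u + 1 ≤ 2 * v →
          ((∏ p ∈ basePrimes ℓ j', p) * r') * v = ((∏ p ∈ basePrimes ℓ j, p) * r) * u →
          D * A + η * ((∏ p ∈ basePrimes ℓ j, p) * r) < D * ((∏ p ∈ basePrimes ℓ j, p) * r) := by
        intro j' r' u v hj' hr' hXr' hrY' hlt hvY huv heq
        refine fraction_step hNpos hvY huv heq hD (hlater j' r' hj' hr' hXr' hrY' hlt ?_)
        refine ih _ ?_ hj' hr' hXr' hrY' (fun j₂ r₂ h₁ h₂ h₃ h₄ h₅ => hlater j₂ r₂ h₁ h₂ h₃ h₄ ?_) rfl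
        · rw [← hn]
          rcases hlt with h | ⟨rfl, h⟩
          · obtain ⟨a, ha⟩ : ∃ a, X - j = X - j' + 1 + a := ⟨X - j - (X - j') - 1, by omega⟩
            rw [ha]
            nlinarith [Nat.sub_le (2 * X ^ 2) r', Nat.zero_le (2 * X ^ 2 - r),
              Nat.zero_le (a * (2 * X ^ 2 + 1))]
          · omega
        · omega
      obtain ⟨r', hr', hrr', hr'r⟩ := Nat.exists_prime_lt_and_le_two_mul r hr.ne_zero
      have hne : r' ≠ 2 * r := by
        rintro rfl
        exact Nat.not_prime_mul (by norm_num) hr.one_lt.ne' hr'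
      rcases le_or_gt r' (2 * X ^ 2) with hr'Y | hr'Y
      · -- the next prime in place of `r`
        exact key j r' r' r hj hr' (hXr.trans hrr') hr'Y (.inr ⟨rfl, hrr'⟩) hrY (by omega)
          (by ring)
      · have hs := prod_basePrimes_succ ℓ j
        split_ifs at hs with h
        · -- the new factor `j + 1`, and a prime `r₂` with `r < (j + 1) * r₂ < 2 * r`
          have hbX : (j + 1) * X ≤ r := by nlinarith
          have hb : 0 < j + 1 := by omega
          have hn0 : X ≤ r / (j + 1) := (Nat.le_div_iff_mul_le hb).2 (by linarith)
          obtain ⟨r₂, hr₂, hlt, hle⟩ := Nat.exists_prime_lt_and_le_two_mul (r / (j + 1)) (by omega)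
          have hdm : (j + 1) * (r / (j + 1)) ≤ r := Nat.mul_div_le _ _
          have hup : (j + 1) * r₂ ≤ 2 * r := by nlinarith
          have hne2 : (j + 1) * r₂ ≠ 2 * r := by
            intro he
            have h2 : 2 ∣ (j + 1) * r₂ := ⟨r, he⟩
            rcases (Nat.Prime.dvd_mul Nat.prime_two).1 h2 with h2 | h2
            · have := (Nat.prime_dvd_prime_iff_eq Nat.prime_two h.2).1 h2; omega
            · have := (Nat.prime_dvd_prime_iff_eq Nat.prime_two hr₂).1 h2; omega
          refine key (j + 1) r₂ ((j + 1) * r₂) r hjX hr₂ (by omega) ?_ (.inl (by omega)) hrY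
            (by omega) (by rw [hs]; ring)
          nlinarith
        · -- `j + 1` is not a new factor, and the product remains the same
          exact key (j + 1) r 1 1 hjX hr hXr hrY (.inl (by omega)) (by nlinarith)
            (by norm_num) (by rw [hs])
    · -- the last elements of the chain are at least `4 * A`
      obtain rfl : j = X := le_antisymm hj hjX
      have h4 : 4 * A ≤ (∏ p ∈ basePrimes ℓ j, p) * r := by nlinarith
      have h5 : 4 * η ≤ D := by nlinarith
      nlinarith [Nat.mul_le_mul_left D h4, Nat.mul_le_mul_right ((∏ p ∈ basePrimes ℓ j, p) * r) h5,
        Nat.mul_pos (show 0 < D by omega) hNpos]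

/-- Chebyshev's lower bound for the product of the primes up to `X`. With the factor `2 ^ 24`, the
error terms of that bound and the primes up to `L + 1` do not matter. -/
theorem two_pow_le_prod_basePrimes {L X : ℕ} (hX : 2 ^ 24 * (L + 1) ≤ X) :
    2 ^ L ≤ ∏ p ∈ basePrimes (L + 1) X, p := by
  have hmain : (2 : ℝ) ^ (3 * L + 2) ≤ (primorial X : ℝ) := by
    have hXpos : 0 < X := by omega
    have h24 : (2 : ℝ) ^ 24 ≤ X := by
      have : 2 ^ 24 ≤ X := by omega
      exact_mod_cast this
    have hθ := Chebyshev.theta_ge X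
    rw [Chebyshev.theta_eq_log_primorial, Nat.floor_natCast] at hθ
    obtain ⟨s, hs0, hs⟩ : ∃ s : ℝ, 0 ≤ s ∧ s ^ 4 = X :=
      ⟨√√X, by positivity, by
        rw [show (4 : ℕ) = 2 * 2 from rfl, pow_mul, Real.sq_sqrt (by positivity),
          Real.sq_sqrt (by positivity)]⟩
    have hs64 : 64 ≤ s := by
      by_contra h
      have : s ^ 4 < 64 ^ 4 := pow_lt_pow_left₀ (not_le.1 h) hs0 (by norm_num)
      rw [hs] at this
      norm_num at this h24
      linarith
    have hlogs : Real.log s ≤ s := (Real.log_le_sub_one_of_pos (by linarith)).trans (by linarith)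
    have hlogX : Real.log X ≤ 4 * s := by
      rw [← hs, Real.log_pow]; push_cast; linarith
    have hsqrt : √(X : ℝ) = s ^ 2 := by
      rw [← hs, show s ^ 4 = (s ^ 2) ^ 2 by ring, Real.sqrt_sq (by positivity)]
    have hlog1 : Real.log (X + 1) ≤ 1 + 4 * s := by
      have : Real.log (X + 1) ≤ Real.log (2 * X) :=
        Real.log_le_log (by positivity) (by linarith)
      rw [Real.log_mul (by norm_num) (by positivity)] at this
      linarith [Real.log_two_lt_d9]
    have h2 := Real.log_two_gt_d9
    rw [← Real.log_le_log_iff (by positivity) (by exact_mod_cast primorial_pos X), Real.log_pow]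
    refine le_trans ?_ hθ
    rw [hsqrt]
    have hL : ((3 * L + 2 : ℕ) : ℝ) ≤ X / 8 := by
      have : (2 : ℝ) ^ 24 * (L + 1) ≤ X := by exact_mod_cast hX
      push_cast
      have : (0 : ℝ) ≤ L := by positivity
      linarith
    have h3 : s ^ 2 * Real.log X ≤ s ^ 2 * (4 * s) := by gcongr
    have h4 : 64 * s ^ 3 ≤ X := by
      rw [← hs]
      have : 0 ≤ s ^ 3 := by positivity
      nlinarith
    have h5 : s ≤ s ^ 3 := by nlinarith [sq_nonneg s]
    have h6 : ((3 * L + 2 : ℕ) : ℝ) * Real.log 2 ≤ X / 8 * Real.log 2 := by gcongr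
    have h7 : 0.6931471803 * (X : ℝ) ≤ Real.log 2 * X := by gcongr
    nlinarith
  have hmain' : 2 ^ (3 * L + 2) ≤ primorial X := by exact_mod_cast hmain
  have hsplit : primorial X = (∏ p ∈ basePrimes (L + 1) X, p) * primorial (L + 1) := by
    rw [primorial, primorial, basePrimes, ← Finset.prod_union]
    · congr 1
      ext p
      simp only [Finset.mem_filter, Finset.mem_range, Finset.mem_union, Finset.mem_Ioc]
      constructor
      · rintro ⟨h₁, h₂⟩
        rcases Nat.lt_or_ge (L + 1) p with h | h
        · exact .inl ⟨⟨h, by omega⟩, h₂⟩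
        · exact .inr ⟨by omega, h₂⟩
      · rintro (⟨⟨h₁, h₂⟩, h₃⟩ | ⟨h₁, h₂⟩)
        · exact ⟨by omega, h₃⟩
        · exact ⟨by omega, h₂⟩
    · refine Finset.disjoint_left.2 fun p h₁ h₂ => ?_
      simp only [Finset.mem_filter, Finset.mem_range, Finset.mem_Ioc] at h₁ h₂
      omega
  have h4 : primorial (L + 1) ≤ 2 ^ (2 * L + 2) := by
    have := primorial_le_four_pow (L + 1)
    rwa [show (4 : ℕ) = 2 ^ 2 from rfl, ← pow_mul, show 2 * (L + 1) = 2 * L + 2 by ring] at this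
  refine le_of_mul_le_mul_right (a := 2 ^ (2 * L + 2)) ?_ (by positivity)
  rw [← pow_add, show L + (2 * L + 2) = 3 * L + 2 by ring]
  rw [hsplit] at hmain'
  exact hmain'.trans (Nat.mul_le_mul_left _ h4)

/-! ### The number of solutions modulo a prime -/

instance : DecidableEq UnarySymbol
  | .plus, .plus => isTrue rfl
  | .minus, .minus => isTrue rfl
  | .sep, .sep => isTrue rfl
  | .plus, .minus => isFalse nofun
  | .plus, .sep => isFalse nofun
  | .minus, .plus => isFalse nofun
  | .minus, .sep => isFalse nofun
  | .sep, .plus => isFalse nofun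
  | .sep, .minus => isFalse nofun

/-- The number of separators among the first `i` letters. -/
def sepCount (w : List UnarySymbol) (i : ℕ) : ℕ :=
  ∑ j ∈ Finset.range i, if w[j]? = some .sep then 1 else 0

/-- `x ^ z` modulo the prime `q + 1`, where `z` is the integer in signed unary that ends at position
`i` and started after the last separator; the inverse of `x` is `x ^ (q - 1)`. -/
def blockPow (w : List UnarySymbol) (x q : ℕ) : ℕ → ℕ
  | 0 => 1 % (q + 1)
  | i + 1 =>
    if w[i]? = some .plus then blockPow w x q i * x % (q + 1)
    else if w[i]? = some .minus then blockPow w x q i * (x ^ (q - 1) % (q + 1)) % (q + 1)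
    else 1 % (q + 1)

/-- `x ^ (-B) * ∏ (1 + x ^ m)` modulo the prime `q + 1`, where `B` is the first integer in the word
and `m` runs through the other ones that end before position `i`. -/
def blockProd (w : List UnarySymbol) (x q : ℕ) : ℕ → ℕ
  | 0 => 1 % (q + 1)
  | i + 1 =>
    if w[i]? = some .sep then
      blockProd w x q i * (if sepCount w i = 0 then blockPow w x q i ^ (q - 1) % (q + 1)
        else 1 + blockPow w x q i) % (q + 1)
    else blockProd w x q i

/-- The number of solutions modulo the prime `q + 1`, for words that encode an instance. -/
def solutionsMod (w : List UnarySymbol) (q : ℕ) : ℕ :=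
  (q + 1 - (∑ x ∈ Finset.range q, blockProd w (x + 1) q w.length) % (q + 1)) % (q + 1)

section scan

variable {F : Type*} [Field F]

/-- One step in the evaluation of `x ^ (-B) * ∏ (1 + x ^ m)` by a scan of the input word; the state
consists of the number of separators, the product so far, and the power of `x` so far. -/
def scanStep (x : F) (s : ℕ × F × F) : UnarySymbol → ℕ × F × F
  | .plus => (s.1, s.2.1, s.2.2 * x)
  | .minus => (s.1, s.2.1, s.2.2 * x⁻¹)
  | .sep => (s.1 + 1, s.2.1 * (if s.1 = 0 then s.2.2⁻¹ else 1 + s.2.2), 1)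

theorem foldl_scanStep_unaryInt {x : F} (k : ℕ) (P : F) (z : ℤ) :
    (unaryInt z).foldl (scanStep x) (k, P, 1) =
      (k + 1, P * (if k = 0 then (x ^ z)⁻¹ else 1 + x ^ z), 1) := by
  have hplus : ∀ (n : ℕ) (c : F), (List.replicate n UnarySymbol.plus).foldl (scanStep x) (k, P, c) =
      (k, P, c * x ^ n) := by
    intro n
    induction n with
    | zero => simp
    | succ n ih => intro c; rw [List.replicate_succ, List.foldl_cons, scanStep, ih, pow_succ']; ring_nf
  have hminus : ∀ (n : ℕ) (c : F), (List.replicate n UnarySymbol.minus).foldl (scanStep x) (k, P, c) =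
      (k, P, c * x⁻¹ ^ n) := by
    intro n
    induction n with
    | zero => simp
    | succ n ih => intro c; rw [List.replicate_succ, List.foldl_cons, scanStep, ih, pow_succ']; ring_nf
  rw [unaryInt, List.foldl_append]
  by_cases hz : 0 ≤ z
  · lift z to ℕ using hz
    simp [hplus, scanStep]
  · obtain ⟨n, rfl⟩ : ∃ n : ℕ, z = -n := ⟨z.natAbs, by omega⟩
    rw [if_neg hz, hminus]
    simp [scanStep]

theorem foldl_scanStep_flatMap {x : F} (l : List ℤ) (k : ℕ) (P : F) :
    (l.flatMap unaryInt).foldl (scanStep x) (k + 1, P, 1) =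
      (k + 1 + l.length, P * (l.map fun z => 1 + x ^ z).prod, 1) := by
  induction l generalizing k P with
  | nil => simp
  | cons z l ih =>
    rw [List.flatMap_cons, List.foldl_append, foldl_scanStep_unaryInt, ih]
    simp [mul_assoc]
    omega

theorem foldl_scanStep_encode (I : SubsetSum) (x : F) :
    (I.encode.foldl (scanStep x) (0, 1, 1)).2.1 = (x ^ I.B)⁻¹ * ∏ i, (1 + x ^ I.m i) := by
  rw [SubsetSum.encode, List.foldl_append, foldl_scanStep_unaryInt, foldl_scanStep_flatMap]
  simp [List.map_ofFn, List.prod_ofFn]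

end scan

section

variable {q : ℕ} [hp : Fact (q + 1).Prime]

theorem ZMod.pow_pred_eq_inv {a : ZMod (q + 1)} (ha : a ≠ 0) (hq : 1 ≤ q) : a ^ (q - 1) = a⁻¹ := by
  refine eq_inv_of_mul_eq_one_left ?_
  rw [← pow_succ, Nat.sub_add_cancel hq]
  exact ZMod.pow_card_sub_one_eq_one ha

/-- `blockPow` and `blockProd` compute the scan of the input word in the field with `q + 1`
elements. -/
theorem foldl_scanStep_take (w : List UnarySymbol) {x : ℕ} (hx : (x : ZMod (q + 1)) ≠ 0)
    (hq : 1 ≤ q) (i : ℕ) (hi : i ≤ w.length) :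
    (w.take i).foldl (scanStep (x : ZMod (q + 1))) (0, 1, 1) =
      (sepCount w i, (blockProd w x q i : ZMod (q + 1)), (blockPow w x q i : ZMod (q + 1))) ∧
    (blockPow w x q i : ZMod (q + 1)) ≠ 0 := by
  have hmod : ∀ a : ℕ, ((a % (q + 1) : ℕ) : ZMod (q + 1)) = a := fun a => ZMod.natCast_mod a _
  induction i with
  | zero => simp [sepCount, blockProd, blockPow, -Nat.cast_add, hmod]
  | succ i ih =>
    obtain ⟨ih₁, ih₂⟩ := ih (by omega)
    have hget : w[i]? = some w[i] := List.getElem?_eq_getElem hi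
    have hcount : sepCount w (i + 1) = sepCount w i + if w[i] = .sep then 1 else 0 := by
      rw [sepCount, Finset.sum_range_succ, hget]; simp [sepCount]
    rw [List.take_add_one, hget, Option.toList_some, List.foldl_append, ih₁, hcount, blockProd,
      blockPow, hget]
    cases hwi : w[i]
    · simp only [List.foldl_cons, List.foldl_nil, scanStep, hmod, reduceCtorEq, if_false, if_true,
        Nat.add_zero, Option.some.injEq, Nat.cast_mul, true_and]
      exact mul_ne_zero ih₂ hx
    · simp only [List.foldl_cons, List.foldl_nil, scanStep, hmod, reduceCtorEq, if_false, if_true,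
        Nat.add_zero, Option.some.injEq, Nat.cast_mul, Nat.cast_pow, ZMod.pow_pred_eq_inv hx hq]
      exact ⟨trivial, mul_ne_zero ih₂ (inv_ne_zero hx)⟩
    · simp only [List.foldl_cons, List.foldl_nil, scanStep, hmod, reduceCtorEq, if_false, if_true,
        Option.some.injEq, Nat.cast_mul, Nat.cast_one]
      refine ⟨?_, one_ne_zero⟩
      split_ifs
      · simp only [hmod, Nat.cast_pow, ZMod.pow_pred_eq_inv ih₂ hq]
      · simp only [Nat.cast_add, Nat.cast_one]

/-- Summation over the units of a prime field extracts the constant coefficient of a Laurent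
polynomial of small degree, up to the sign. -/
theorem sum_units_zpow {k : ℤ} (hk : k.natAbs < q) :
    ∑ u : (ZMod (q + 1))ˣ, (u : ZMod (q + 1)) ^ k = if k = 0 then -1 else 0 := by
  have hpow : ∀ u : (ZMod (q + 1))ˣ, (u : ZMod (q + 1)) ^ k =
      (u : ZMod (q + 1)) ^ (k + q).toNat := by
    intro u
    have h1 : (u : ZMod (q + 1)) ^ q = 1 := ZMod.pow_card_sub_one_eq_one u.ne_zero
    rw [← zpow_natCast _ (k + q).toNat, Int.toNat_of_nonneg (by omega),
      zpow_add₀ u.ne_zero, zpow_natCast, h1, mul_one]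
  rw [Finset.sum_congr rfl fun u _ => hpow u]
  have := FiniteField.sum_pow_units (ZMod (q + 1)) (k + q).toNat
  rw [ZMod.card, Nat.add_sub_cancel] at this
  rw [this]
  congr 1
  rw [eq_iff_iff]
  constructor
  · rintro ⟨c, hc⟩
    have h1 : (k + q).toNat < q * 2 := by omega
    have h2 : 0 < (k + q).toNat := by omega
    have hc1 : c < 2 := by
      by_contra h
      have := Nat.mul_le_mul_left q (not_lt.1 h)
      omega
    have hc0 : c ≠ 0 := by rintro rfl; omega
    obtain rfl : c = 1 := by omega
    omega
  · rintro rfl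
    simp

theorem SubsetSum.sum_units_eq (I : SubsetSum) (hI : I.B.natAbs + ∑ i, (I.m i).natAbs < q) :
    ∑ u : (ZMod (q + 1))ˣ, (((u : ZMod (q + 1)) ^ I.B)⁻¹ * ∏ i, (1 + (u : ZMod (q + 1)) ^ I.m i)) =
      -(I.numSolutions : ZMod (q + 1)) := by
  have hexp : ∀ u : (ZMod (q + 1))ˣ,
      ((u : ZMod (q + 1)) ^ I.B)⁻¹ * ∏ i, (1 + (u : ZMod (q + 1)) ^ I.m i) =
        ∑ S : Finset (Fin I.n), (u : ZMod (q + 1)) ^ (∑ i ∈ S, I.m i - I.B) := by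
    intro u
    rw [Finset.prod_one_add, Finset.mul_sum, Finset.powerset_univ]
    refine Finset.sum_congr rfl fun S _ => ?_
    rw [zpow_sub₀ u.ne_zero, div_eq_mul_inv, mul_comm]
    congr 1
    clear * -
    induction S using Finset.induction_on with
    | empty => simp
    | insert a S ha ih => rw [Finset.prod_insert ha, Finset.sum_insert ha, zpow_add₀ u.ne_zero, ih]
  rw [Finset.sum_congr rfl fun u _ => hexp u, Finset.sum_comm]
  have hk : ∀ S : Finset (Fin I.n), (∑ i ∈ S, I.m i - I.B).natAbs < q := by
    intro S
    have h1 : (∑ i ∈ S, I.m i).natAbs ≤ ∑ i ∈ S, (I.m i).natAbs := by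
      zify; exact Finset.abs_sum_le_sum_abs _ _
    have h2 : ∑ i ∈ S, (I.m i).natAbs ≤ ∑ i, (I.m i).natAbs :=
      Finset.sum_le_sum_of_subset (Finset.subset_univ S)
    omega
  rw [Finset.sum_congr rfl fun S _ => sum_units_zpow (hk S), ← Finset.sum_filter,
    Finset.sum_const, nsmul_eq_mul, mul_neg, mul_one, SubsetSum.numSolutions]
  simp only [sub_eq_zero]

theorem sum_range_succ_eq_sum_units {M : Type*} [AddCommMonoid M] (f : ZMod (q + 1) → M) :
    ∑ x ∈ Finset.range q, f ((x + 1 : ℕ) : ZMod (q + 1)) = ∑ u : (ZMod (q + 1))ˣ, f u := by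
  have hne : ∀ x ∈ Finset.range q, ((x + 1 : ℕ) : ZMod (q + 1)) ≠ 0 := by
    intro x hx h
    rw [ZMod.natCast_eq_zero_iff] at h
    have := Nat.le_of_dvd (by omega) h
    have := Finset.mem_range.1 hx
    omega
  refine Finset.sum_bij (fun x hx => Units.mk0 _ (hne x hx)) (fun _ _ => Finset.mem_univ _) ?_ ?_ ?_
  · intro x hx y hy h
    have h' : ((x + 1 : ℕ) : ZMod (q + 1)) = ((y + 1 : ℕ) : ZMod (q + 1)) := congrArg Units.val h
    rw [ZMod.natCast_eq_natCast_iff'] at h'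
    have := Finset.mem_range.1 hx
    have := Finset.mem_range.1 hy
    rw [Nat.mod_eq_of_lt (by omega), Nat.mod_eq_of_lt (by omega)] at h'
    omega
  · intro u _
    have h0 : (u : ZMod (q + 1)).val ≠ 0 := by
      rw [Ne, ZMod.val_eq_zero]; exact u.ne_zero
    have hlt := ZMod.val_lt (u : ZMod (q + 1))
    refine ⟨(u : ZMod (q + 1)).val - 1, Finset.mem_range.2 (by omega), ?_⟩
    ext1
    rw [Units.val_mk0, Nat.sub_add_cancel (by omega), ZMod.natCast_zmod_val]
  · intro x hx
    rfl

end

/-- The unary encoding is longer than the degrees of the Laurent polynomial whose constant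
coefficient is the number of solutions. -/
theorem SubsetSum.natAbs_lt_length (I : SubsetSum) :
    I.B.natAbs + ∑ i, (I.m i).natAbs < I.encode.length := by
  have h : ∀ l : List ℤ, (l.map Int.natAbs).sum ≤ (l.flatMap unaryInt).length := by
    intro l
    induction l with
    | nil => simp
    | cons z l ih => simp [unaryInt] at ih ⊢; omega
  have := h (List.ofFn I.m)
  rw [List.map_ofFn, List.sum_ofFn] at this
  simp [SubsetSum.encode, unaryInt] at this ⊢
  omega

/-- The product is a Laurent polynomial in `x` whose constant coefficient is the number of
solutions; summation over the nonzero residues `x` modulo a large prime extracts it. -/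
theorem solutionsMod_encode (I : SubsetSum) {p : ℕ} (hp : p.Prime) (hI : I.encode.length < p) :
    solutionsMod I.encode (p - 1) = I.numSolutions % p := by
  obtain ⟨q, rfl⟩ : ∃ q, p = q + 1 := ⟨p - 1, by have := hp.pos; omega⟩
  have := Fact.mk hp
  have hsize := I.natAbs_lt_length
  have hsum : ((∑ x ∈ Finset.range q, blockProd I.encode (x + 1) q I.encode.length : ℕ) :
      ZMod (q + 1)) = -(I.numSolutions : ZMod (q + 1)) := by
    rw [← I.sum_units_eq (by omega), ← sum_range_succ_eq_sum_units
      (fun a => (a ^ I.B)⁻¹ * ∏ i, (1 + a ^ I.m i)), Nat.cast_sum]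
    refine Finset.sum_congr rfl fun x hx => ?_
    have hx0 : ((x + 1 : ℕ) : ZMod (q + 1)) ≠ 0 := by
      intro h
      rw [ZMod.natCast_eq_zero_iff] at h
      have := Nat.le_of_dvd (by omega) h
      have := Finset.mem_range.1 hx
      omega
    have h := (foldl_scanStep_take I.encode hx0 (by omega) _ le_rfl).1
    rw [List.take_length] at h
    rw [← foldl_scanStep_encode, h]
  rw [solutionsMod, Nat.add_sub_cancel]
  set s := ∑ x ∈ Finset.range q, blockProd I.encode (x + 1) q I.encode.length
  have hlt := Nat.mod_lt s (Nat.succ_pos q)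
  rw [← ZMod.natCast_eq_natCast_iff', Nat.cast_sub hlt.le, ZMod.natCast_mod, hsum]
  simp

namespace LogspaceSubsetSum

variable (K : ℕ) (w : List UnarySymbol)

/-! ### The quantities that are computed -/

/-- The power `2 ^ b` for the precision of `b` bits. -/
def scale : ℕ := (2 ^ w.length.size) ^ K

/-- An upper bound for the small primes of the chain, with `2 ^ |w|` at most their product. -/
def smallBound : ℕ := 2 ^ 24 * scale K w

/-- An upper bound for the last prime factor of an element of the chain. It leaves enough room to
apply Bertrand's postulate after the division by a small prime. -/
def bound : ℕ := 2 * smallBound K w ^ 2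

/-- The denominator of the fixed point numbers. It is so large that the sum of `bound + 1` rounding
errors is small in comparison with `1 / bound` and with `1 / scale`. -/
def denom : ℕ := 16 * bound K w ^ 2 * scale K w

/-- The index `t` of an element of the chain encodes the pair of `j = t / (bound + 1)` and
`r = t % (bound + 1)`; the element is the product of the primes `p` with this property, namely of the
primes in `(|w| + 1, j]` and of `r`. -/
def IsFactor (t p : ℕ) : Prop :=
  p.Prime ∧ ((w.length + 1 < p ∧ p ≤ t / (bound K w + 1)) ∨ p = t % (bound K w + 1))

instance (t p : ℕ) : Decidable (IsFactor K w t p) := by unfold IsFactor; infer_instance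

/-- The product of the factors other than `p`, modulo `p`. -/
def cofactorMod (t p : ℕ) : ℕ :=
  if p = 0 then 0 else
    (∏ i ∈ Finset.range (bound K w + 1), if IsFactor K w t i ∧ ¬ i = p then i else 1) % p

/-- The coefficient of `1 / p` in the partial fraction decomposition of the number of solutions
divided by an element of the chain; the inverse of the cofactor is its power with exponent `p - 2`. -/
def crtCoeff (t p : ℕ) : ℕ :=
  solutionsMod w (p - 1) * (if p = 0 then 0 else cofactorMod K w t p ^ (p - 2) % p) % p

/-- The numerator of an upper approximation, with denominator `denom`, of the number of solutions
divided by the element with index `t` of the chain, modulo `1`. The summand `bound + 1` makes up for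
the rounding of the other summands. -/
def chainFraction (t : ℕ) : ℕ :=
  ((∑ p ∈ Finset.range (bound K w + 1), if IsFactor K w t p then crtCoeff K w t p * denom K w / p
    else 0) + (bound K w + 1)) % denom K w

/-- The index `t` is valid, and the approximated fraction certifies a value above `1 / 2`. -/
def Passes (t : ℕ) : Prop :=
  (t % (bound K w + 1)).Prime ∧ smallBound K w < t % (bound K w + 1) ∧
    denom K w + 2 * (bound K w + 1) < 2 * chainFraction K w t

instance (t : ℕ) : Decidable (Passes K w t) := by unfold Passes; infer_instance

/-- The last index that passes the test; `0` if there is none. -/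
def chosen : ℕ := Nat.findGreatest (fun t => Passes K w t)
  ((smallBound K w + 1) * (bound K w + 1) - 1)

/-- The number of solutions modulo the greatest prime up to `bound`. -/
def smallCount : ℕ := solutionsMod w (Nat.findGreatest (fun p => p.Prime) (bound K w) - 1)

/-- A lower bound for the mantissas in the approximate multiplication. Like `denom`, it is a power of
two, so that the result can be divided by their product without another rounding. -/
def mantissaBound : ℕ := 16 * bound K w * scale K w

/-- The factor of the chosen element of the chain that is multiplied in step `i`. -/
def factor (i : ℕ) : ℕ := if IsFactor K w (chosen K w) i then i else 1

/-- The mantissa of an upper floating point approximation of `mantissaBound` times the product of the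
factors up to step `i`. -/
def mantissa : ℕ → ℕ
  | 0 => mantissaBound K w
  | i + 1 => mantissa i * factor K w i /
      2 ^ (mantissa i * factor K w i / (2 * mantissaBound K w)).size + 1

/-- The exponent that belongs to `mantissa`. -/
def exponent (i : ℕ) : ℕ :=
  ∑ j ∈ Finset.range i, (mantissa K w j * factor K w j / (2 * mantissaBound K w)).size

/-- The number of solutions times `denom * mantissaBound`, without the exponent of the product. -/
def unnormalized : ℕ := chainFraction K w (chosen K w) * mantissa K w (bound K w + 1)

/-- The mantissa (`i = 0`) and the exponent (`i = 1`) of the number of solutions. In the exponent,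
`+ 1` makes up for the size of a power of two being one more than its logarithm. -/
def floatResult (i : ℕ) : ℕ :=
  if Passes K w (chosen K w) then
    if i = 0 then unnormalized K w / 2 ^ (unnormalized K w / scale K w).size
    else exponent K w (bound K w + 1) + (unnormalized K w / scale K w).size + 1 -
      (denom K w * mantissaBound K w).size
  else
    if i = 0 then smallCount K w / 2 ^ (smallCount K w / scale K w).size
    else (smallCount K w / scale K w).size

/-- A prime between a small number of solutions and its double. -/
def smallPrime : ℕ := Nat.findGreatest (fun p => p.Prime) (2 * smallCount K w - 1)

/-- The entries of the second result: the numerator of the fraction, followed by all numbers as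
candidates for the prime factors. -/
def fractionResult (i : ℕ) : ℕ :=
  if i = 0 then
    if Passes K w (chosen K w) then chainFraction K w (chosen K w) / (16 * bound K w ^ 2)
    else smallCount K w * scale K w / smallPrime K w
  else i - 1

/-- Whether an entry of `fractionResult` is part of the second result. -/
def IsEntry (i : ℕ) : Prop :=
  i = 0 ∨ (if Passes K w (chosen K w) then IsFactor K w (chosen K w) (i - 1) ∧ i - 1 ≤ bound K w
    else i - 1 = smallPrime K w)

instance (i : ℕ) : Decidable (IsEntry K w i) := by unfold IsEntry; infer_instance

theorem scale_pos : 0 < scale K w := by unfold scale; positivity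

theorem smallBound_pos : 0 < smallBound K w := by have := scale_pos K w; unfold smallBound; positivity

theorem bound_pos : 0 < bound K w := by have := smallBound_pos K w; unfold bound; positivity

theorem mantissaBound_pos : 0 < mantissaBound K w := by
  have := scale_pos K w; have := bound_pos K w; unfold mantissaBound; positivity

/-! ### Their computation in logarithmic space -/

variable {K} {f g t p x q N : List UnarySymbol → (ℕ → ℕ) → ℕ}

open LogspaceFun LogspacePred

theorem logspace_letter (hf : LogspaceFun f) (a : UnarySymbol) :
    LogspacePred fun w v => w[f w v]? = some a := by
  refine (LogspaceFun.cell (fun | .letter b => decide (b = a) | _ => false) rfl hf.succ).of_eq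
    fun w v => ?_
  simp only [inputCell]
  by_cases h : w[f w v]? = some a
  · simp [h]
  · rw [if_neg h]
    rcases h' : w[f w v]? with _ | b
    · rfl
    · simpa using fun hb : b = a => h (hb ▸ h')

theorem logspace_sepCount (hf : LogspaceFun f) : LogspaceFun fun w v => sepCount w (f w v) :=
  LogspaceFun.sum hf (.ite (P := fun w v => w[v 0]? = some UnarySymbol.sep) (logspace_letter (var 0) .sep)
    (const 1) (const 0))

theorem logspace_blockPow (hx : LogspaceFun x) (hq : LogspaceFun q) (hN : LogspaceFun N) :
    LogspaceFun fun w v => blockPow w (x w v) (q w v) (N w v) := by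
  refine comp₃ (F := blockPow) (prec_of (fun w v => blockPow w (v 0) (v 1)) (var 2)
    ((const 1).mod (var 1).succ)
    (.ite (P := fun w v => w[v 0]? = some UnarySymbol.plus) (logspace_letter (var 0) .plus)
      (((var 1).mul (var 2)).mod (var 3).succ)
      (.ite (P := fun w v => w[v 0]? = some UnarySymbol.minus) (logspace_letter (var 0) .minus)
        (((var 1).mul (((var 2).pow_mod (var 3).pred (var 3).succ).of_eq
          (g := fun w v => v 2 ^ (v 3 - 1) % (v 3 + 1)) fun w v => by simp)).mod (var 3).succ)
        ((const 1).mod (var 3).succ))) (var 1).succ.polyBounded (fun _ _ => rfl) (fun _ _ _ => rfl)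
    fun w v i _ => ?_) hx hq hN
  have hlt : ∀ a, a % (v 1 + 1) ≤ v 1 + 1 := fun a => (Nat.mod_lt _ (Nat.succ_pos _)).le
  cases i with
  | zero => exact hlt _
  | succ i =>
    rw [blockPow]
    split_ifs <;> exact hlt _

theorem logspace_blockProd (hx : LogspaceFun x) (hq : LogspaceFun q) (hN : LogspaceFun N) :
    LogspaceFun fun w v => blockProd w (x w v) (q w v) (N w v) := by
  refine comp₃ (F := blockProd) (prec_of (fun w v => blockProd w (v 0) (v 1)) (var 2)
    ((const 1).mod (var 1).succ)
    (.ite (P := fun w v => w[v 0]? = some UnarySymbol.sep) (logspace_letter (var 0) .sep)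
      (((var 1).mul (.ite (P := fun w v => sepCount w (v 0) = 0)
        (LogspacePred.eq (logspace_sepCount (var 0)) (const 0))
        (((logspace_blockPow (var 2) (var 3) (var 0)).pow_mod (var 3).pred (var 3).succ).of_eq
          (g := fun w v => blockPow w (v 2) (v 3) (v 0) ^ (v 3 - 1) % (v 3 + 1))
          fun w v => by simp)
        ((const 1).add (logspace_blockPow (var 2) (var 3) (var 0))))).mod (var 3).succ)
      (var 1)) (var 1).succ.polyBounded (fun _ _ => rfl) (fun _ _ _ => rfl)
    fun w v i _ => ?_) hx hq hN
  have hlt : ∀ a, a % (v 1 + 1) ≤ v 1 + 1 := fun a => (Nat.mod_lt _ (Nat.succ_pos _)).le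
  induction i with
  | zero => exact hlt _
  | succ i ih =>
    rw [blockProd]
    split_ifs
    · exact hlt _
    · exact hlt _
    · exact ih (by omega)

theorem logspace_solutionsMod (hq : LogspaceFun q) :
    LogspaceFun fun w v => solutionsMod w (q w v) :=
  comp₁ (F := solutionsMod) (((var 0).succ.sub ((LogspaceFun.sum (var 0)
    (logspace_blockProd (var 0).succ (var 1) .length)).mod (var 0).succ)).mod (var 0).succ) hq

theorem logspace_scale : LogspaceFun fun w _ => scale K w :=
  LogspaceFun.length.two_pow_size.pow_const K

theorem logspace_smallBound : LogspaceFun fun w _ => smallBound K w :=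
  (const (2 ^ 24)).mul logspace_scale

theorem logspace_bound : LogspaceFun fun w _ => bound K w :=
  (const 2).mul (logspace_smallBound.pow_const 2)

theorem logspace_denom : LogspaceFun fun w _ => denom K w :=
  ((const 16).mul (logspace_bound.pow_const 2)).mul logspace_scale

theorem logspace_isFactor (ht : LogspaceFun t) (hp : LogspaceFun p) :
    LogspacePred fun w v => IsFactor K w (t w v) (p w v) :=
  (LogspacePred.prime hp).and (((LogspacePred.lt LogspaceFun.length.succ hp).and
    (LogspacePred.le hp (ht.div logspace_bound.succ))).or
    (LogspacePred.eq hp (ht.mod logspace_bound.succ)))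

theorem logspace_cofactorMod (ht : LogspaceFun t) (hp : LogspaceFun p) :
    LogspaceFun fun w v => cofactorMod K w (t w v) (p w v) :=
  comp₂ (F := cofactorMod K) (LogspaceFun.prod_mod logspace_bound.succ
    (.ite (P := fun w v => IsFactor K w (v 1) (v 0) ∧ ¬ v 0 = v 2)
      ((logspace_isFactor (var 1) (var 0)).and (LogspacePred.eq (var 0) (var 2)).not)
      (var 0) (const 1)) (var 1)) ht hp

theorem logspace_crtCoeff (ht : LogspaceFun t) (hp : LogspaceFun p) :
    LogspaceFun fun w v => crtCoeff K w (t w v) (p w v) :=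
  comp₂ (F := crtCoeff K) (((logspace_solutionsMod (var 1).pred).mul
    ((logspace_cofactorMod (var 0) (var 1)).pow_mod ((var 1).sub (const 2)) (var 1))).mod (var 1))
    ht hp

theorem logspace_chainFraction (ht : LogspaceFun t) :
    LogspaceFun fun w v => chainFraction K w (t w v) :=
  comp₁ (F := chainFraction K) (((LogspaceFun.sum logspace_bound.succ
    (.ite (P := fun w v => IsFactor K w (v 1) (v 0)) (logspace_isFactor (var 1) (var 0))
      (((logspace_crtCoeff (var 1) (var 0)).mul logspace_denom).div (var 0)) (const 0))).add
      logspace_bound.succ).mod logspace_denom) ht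

theorem logspace_passes (ht : LogspaceFun t) : LogspacePred fun w v => Passes K w (t w v) :=
  (LogspacePred.prime (ht.mod logspace_bound.succ)).and
    ((LogspacePred.lt logspace_smallBound (ht.mod logspace_bound.succ)).and
      (LogspacePred.lt (logspace_denom.add ((const 2).mul logspace_bound.succ))
        ((const 2).mul (logspace_chainFraction ht))))

theorem logspace_chosen : LogspaceFun fun w _ => chosen K w :=
  LogspaceFun.findGreatest (P := fun w v => Passes K w (v 0))
    ((logspace_smallBound.succ.mul logspace_bound.succ).sub (const 1)) (logspace_passes (var 0))

theorem logspace_smallCount : LogspaceFun fun w _ => smallCount K w :=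
  logspace_solutionsMod (LogspaceFun.findGreatest (P := fun _ v => (v 0).Prime)
    logspace_bound (LogspacePred.prime (var 0))).pred

theorem logspace_mantissaBound : LogspaceFun fun w _ => mantissaBound K w :=
  ((const 16).mul logspace_bound).mul logspace_scale

theorem logspace_factor (hf : LogspaceFun f) : LogspaceFun fun w v => factor K w (f w v) :=
  .ite (P := fun w v => IsFactor K w (chosen K w) (f w v)) (logspace_isFactor logspace_chosen hf)
    hf (const 1)

theorem mantissa_le (w : List UnarySymbol) (i : ℕ) :
    mantissa K w i ≤ 2 * mantissaBound K w + 1 := by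
  cases i with
  | zero => rw [mantissa]; omega
  | succ i =>
    rw [mantissa]
    refine Nat.succ_le_succ (Nat.div_le_of_le_mul ?_)
    set y := mantissa K w i * factor K w i
    have := Nat.lt_size_self (y / (2 * mantissaBound K w))
    rw [Nat.div_lt_iff_lt_mul (Nat.mul_pos two_pos (mantissaBound_pos K w))] at this
    exact this.le

theorem logspace_mantissa (hf : LogspaceFun f) : LogspaceFun fun w v => mantissa K w (f w v) := by
  have hstep : LogspaceFun fun w v => v 1 * factor K w (v 0) :=
    (var 1).mul (logspace_factor (var 0))
  exact prec_of (fun w _ => mantissa K w) hf logspace_mantissaBound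
    ((hstep.shiftRight (hstep.div ((const 2).mul logspace_mantissaBound)).size).succ)
    ((const 2).mul logspace_mantissaBound).succ.polyBounded (fun _ _ => rfl) (fun _ _ _ => rfl)
    fun w _ i _ => mantissa_le w i

theorem logspace_exponent (hf : LogspaceFun f) : LogspaceFun fun w v => exponent K w (f w v) :=
  LogspaceFun.sum hf (((logspace_mantissa (var 0)).mul (logspace_factor (var 0))).div
    ((const 2).mul logspace_mantissaBound)).size

theorem logspace_unnormalized : LogspaceFun fun w _ => unnormalized K w :=
  (logspace_chainFraction logspace_chosen).mul (logspace_mantissa logspace_bound.succ)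

theorem logspace_floatResult : LogspaceFun fun w v => floatResult K w (v 0) :=
  .ite (P := fun w _ => Passes K w (chosen K w)) (logspace_passes logspace_chosen)
    (.ite (P := fun _ v => v 0 = 0) (LogspacePred.eq (var 0) (const 0))
      (logspace_unnormalized.shiftRight (logspace_unnormalized.div logspace_scale).size)
      ((((logspace_exponent logspace_bound.succ).add
        (logspace_unnormalized.div logspace_scale).size).succ).sub
          (logspace_denom.mul logspace_mantissaBound).size))
    (.ite (P := fun _ v => v 0 = 0) (LogspacePred.eq (var 0) (const 0))
      (logspace_smallCount.shiftRight (logspace_smallCount.div logspace_scale).size)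
      (logspace_smallCount.div logspace_scale).size)

theorem logspace_smallPrime : LogspaceFun fun w _ => smallPrime K w :=
  LogspaceFun.findGreatest (P := fun _ v => (v 0).Prime)
    (((const 2).mul logspace_smallCount).sub (const 1)) (LogspacePred.prime (var 0))

theorem logspace_fractionResult : LogspaceFun fun w v => fractionResult K w (v 0) :=
  .ite (P := fun _ v => v 0 = 0) (LogspacePred.eq (var 0) (const 0))
    (.ite (P := fun w _ => Passes K w (chosen K w)) (logspace_passes logspace_chosen)
      ((logspace_chainFraction logspace_chosen).div ((const 16).mul (logspace_bound.pow_const 2)))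
      ((logspace_smallCount.mul logspace_scale).div logspace_smallPrime)) (var 0).pred

theorem logspace_isEntry : LogspacePred fun w v => IsEntry K w (v 0) := by
  have h : LogspacePred fun w _ => Passes K w (chosen K w) := logspace_passes logspace_chosen
  refine LogspacePred.of_iff (P := fun w v => v 0 = 0 ∨
      (Passes K w (chosen K w) ∧ IsFactor K w (chosen K w) (v 0 - 1) ∧ v 0 - 1 ≤ bound K w ∨
        ¬ Passes K w (chosen K w) ∧ v 0 - 1 = smallPrime K w))
    ((LogspacePred.eq (var 0) (const 0)).or ((h.and
      ((logspace_isFactor logspace_chosen (var 0).pred).and (LogspacePred.le (var 0).pred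
        logspace_bound))).or (h.not.and (LogspacePred.eq (var 0).pred logspace_smallPrime))))
    fun w v => ?_
  unfold IsEntry
  by_cases h : Passes K w (chosen K w) <;> simp [h]

/-! ### Correctness of the chosen product of primes -/

variable {K : ℕ} {I : SubsetSum}

theorem n_lt_length_encode (I : SubsetSum) : I.n < I.encode.length := by
  have h : ∀ l : List ℤ, l.length ≤ (l.flatMap unaryInt).length := by
    intro l
    induction l with
    | nil => simp
    | cons a l ih => simp only [List.flatMap_cons, List.length_append, List.length_cons, unaryInt,
        List.length_replicate, List.length_nil]; omega
  have := h (List.ofFn I.m)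
  simp only [SubsetSum.encode, List.length_append, unaryInt, List.length_replicate,
    List.length_cons, List.length_nil]
  rw [List.length_ofFn] at this
  omega

theorem numSolutions_le (I : SubsetSum) : I.numSolutions ≤ 2 ^ I.encode.length := by
  calc I.numSolutions ≤ Fintype.card (Finset (Fin I.n)) := Finset.card_le_univ _
    _ = 2 ^ I.n := by simp
    _ ≤ 2 ^ I.encode.length := Nat.pow_le_pow_right two_pos (n_lt_length_encode I).le

theorem le_smallBound (hK : 1 ≤ K) (w : List UnarySymbol) :
    2 ^ 24 * (w.length + 1) ≤ smallBound K w := by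
  refine Nat.mul_le_mul_left _ ((Nat.lt_size_self w.length).trans_le ?_)
  exact Nat.le_self_pow (by omega) _

theorem smallBound_le_bound (w : List UnarySymbol) : smallBound K w ≤ bound K w := by
  have := smallBound_pos K w
  unfold bound; nlinarith

theorem lt_denom (w : List UnarySymbol) : 6 * bound K w * (bound K w + 1) < denom K w := by
  have := bound_pos K w
  have h := scale_pos K w
  have : 16 * bound K w ^ 2 * 1 ≤ denom K w := Nat.mul_le_mul_left _ h
  nlinarith

/-- The prime factors of the element with index `t` of the chain. -/
def factors (K : ℕ) (w : List UnarySymbol) (t : ℕ) : Finset ℕ :=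
  (Finset.range (bound K w + 1)).filter fun p => IsFactor K w t p

theorem prime_of_mem_factors {w : List UnarySymbol} {t p : ℕ} (hp : p ∈ factors K w t) :
    p.Prime := (Finset.mem_filter.1 hp).2.1

/-- The elements of the chain in terms of the parameters `j` and `r`. -/
theorem prod_factors {w : List UnarySymbol} {j r : ℕ} (hj : j ≤ smallBound K w) (hr : r.Prime)
    (hXr : smallBound K w < r) (hrY : r ≤ bound K w) :
    ∏ p ∈ factors K w (j * (bound K w + 1) + r), p =
      (∏ p ∈ basePrimes (w.length + 1) j, p) * r := by
  have h : factors K w (j * (bound K w + 1) + r) = insert r (basePrimes (w.length + 1) j) := by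
    ext p
    have := smallBound_le_bound (K := K) w
    rw [factors, Finset.mem_filter, Finset.mem_range, IsFactor, basePrimes, Finset.mem_insert,
      Finset.mem_filter, Finset.mem_Ioc, mul_comm j, Nat.mul_add_div (Nat.succ_pos _), Nat.div_eq_of_lt (by omega),
      Nat.mul_add_mod, Nat.mod_eq_of_lt (by omega)]
    constructor
    · rintro ⟨_, hp, h | h⟩
      · exact .inr ⟨h, hp⟩
      · exact .inl h
    · rintro (rfl | ⟨h, hp⟩)
      · exact ⟨by omega, hr, .inr rfl⟩
      · exact ⟨by omega, hp, .inl h⟩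
  rw [h, Finset.prod_insert, mul_comm]
  simp only [basePrimes, Finset.mem_filter, Finset.mem_Ioc]
  omega

theorem cofactorMod_eq {w : List UnarySymbol} {t p : ℕ} (hp : 0 < p) :
    cofactorMod K w t p = (∏ q ∈ (factors K w t).erase p, q) % p := by
  rw [cofactorMod, if_neg hp.ne', ← Finset.prod_filter]
  congr 2
  ext q
  simp only [factors, Finset.mem_filter, Finset.mem_erase]
  tauto

/-- `crtCoeff` inverts the cofactor, by Fermat's little theorem. -/
theorem crtCoeff_modEq (hK : 1 ≤ K) {t p : ℕ} (hX : smallBound K I.encode < t % (bound K I.encode + 1))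
    (hp : p ∈ factors K I.encode t) :
    crtCoeff K I.encode t p * ∏ q ∈ (factors K I.encode t).erase p, q ≡ I.numSolutions [MOD p] := by
  have hprime := prime_of_mem_factors hp
  have hL := le_smallBound hK I.encode
  have h0 := n_lt_length_encode I
  have hlt : I.encode.length + 1 < p := by
    rcases (Finset.mem_filter.1 hp).2.2 with h | h
    · exact h.1
    · omega
  have hcop : Nat.Coprime (∏ q ∈ (factors K I.encode t).erase p, q) p :=
    Nat.Coprime.prod_left fun q hq => (Nat.coprime_primes
      (prime_of_mem_factors (Finset.mem_of_mem_erase hq)) hprime).2 (Finset.ne_of_mem_erase hq)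
  have hfermat := Nat.ModEq.pow_totient hcop
  rw [Nat.totient_prime hprime] at hfermat
  rw [crtCoeff, if_neg hprime.ne_zero, cofactorMod_eq hprime.pos,
    solutionsMod_encode I hprime (by omega)]
  set C := ∏ q ∈ (factors K I.encode t).erase p, q
  calc _ ≡ (I.numSolutions * C ^ (p - 2)) * C [MOD p] :=
        ((Nat.mod_modEq _ _).trans ((Nat.mod_modEq _ _).mul
          ((Nat.mod_modEq _ _).trans ((Nat.mod_modEq _ _).pow _)))).mul_right _
    _ = I.numSolutions * C ^ (p - 1) := by
        rw [mul_assoc, ← pow_succ, show p - 2 + 1 = p - 1 by omega]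
    _ ≡ I.numSolutions * 1 [MOD p] := hfermat.mul_left _
    _ = I.numSolutions := mul_one _

/-- The fixed point number `chainFraction` is an upper approximation of `A / N`, if `A / N` is less
than `1` by a margin. -/
theorem chainFraction_bounds (hK : 1 ≤ K) {t : ℕ}
    (hX : smallBound K I.encode < t % (bound K I.encode + 1))
    (hA : denom K I.encode * I.numSolutions + (bound K I.encode + 1) * ∏ p ∈ factors K I.encode t, p
      < denom K I.encode * ∏ p ∈ factors K I.encode t, p) :
    denom K I.encode * I.numSolutions ≤
        (∏ p ∈ factors K I.encode t, p) * chainFraction K I.encode t ∧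
      (∏ p ∈ factors K I.encode t, p) * chainFraction K I.encode t ≤
        denom K I.encode * I.numSolutions +
          (bound K I.encode + 1) * ∏ p ∈ factors K I.encode t, p := by
  have := crt_fraction (factors K I.encode t) (fun p => prime_of_mem_factors) I.numSolutions
    (denom K I.encode) (bound K I.encode + 1) (crtCoeff K I.encode t)
    (fun p hp => crtCoeff_modEq hK hX hp)
    ((Finset.card_filter_le _ _).trans (Finset.card_range _).le) hA
  rwa [factors, Finset.sum_filter] at this

/-- If no later element of the chain passes the test, then `A / N` is less than `1` by a margin. -/
theorem fraction_lt_of_forall_not_passes (hK : 1 ≤ K) {j r : ℕ} (hj : j ≤ smallBound K I.encode)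
    (hr : r.Prime) (hXr : smallBound K I.encode < r) (hrY : r ≤ bound K I.encode)
    (hlater : ∀ t, j * (bound K I.encode + 1) + r < t →
      t ≤ (smallBound K I.encode + 1) * (bound K I.encode + 1) - 1 → ¬ Passes K I.encode t) :
    denom K I.encode * I.numSolutions + (bound K I.encode + 1) *
        ((∏ p ∈ basePrimes (I.encode.length + 1) j, p) * r) <
      denom K I.encode * ((∏ p ∈ basePrimes (I.encode.length + 1) j, p) * r) := by
  have hL := le_smallBound hK I.encode
  have h0 := n_lt_length_encode I
  refine fraction_lt_of_forall_later (by omega) (by omega) (lt_denom I.encode)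
    ((numSolutions_le I).trans (two_pow_le_prod_basePrimes hL)) hj hr hXr hrY ?_
  intro j' r' hj' hr' hXr' hrY' hlt hgood
  change r' ≤ bound K I.encode at hrY'
  rw [← prod_factors hj' hr' hXr' hrY'] at hgood ⊢
  have hmod : (j' * (bound K I.encode + 1) + r') % (bound K I.encode + 1) = r' := by
    rw [mul_comm, Nat.mul_add_mod, Nat.mod_eq_of_lt (by omega)]
  have hQ := (chainFraction_bounds hK (by rwa [hmod]) hgood).1
  have hnot := hlater (j' * (bound K I.encode + 1) + r') (by
    rcases hlt with h | ⟨rfl, h⟩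
    · have := Nat.mul_le_mul_right (bound K I.encode + 1) (Nat.succ_le_of_lt h)
      rw [Nat.succ_mul] at this
      omega
    · omega) (by
      have := Nat.mul_le_mul_right (bound K I.encode + 1) hj'
      rw [Nat.succ_mul]
      omega)
  rw [Passes, hmod] at hnot
  have hle : 2 * chainFraction K I.encode (j' * (bound K I.encode + 1) + r') ≤
      denom K I.encode + 2 * (bound K I.encode + 1) := by
    by_contra h
    exact hnot ⟨hr', hXr', by omega⟩
  calc _ = 2 * (denom K I.encode * I.numSolutions) := by ring
    _ ≤ 2 * _ := Nat.mul_le_mul_left 2 hQ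
    _ = _ := Nat.mul_left_comm _ _ _
    _ ≤ _ := Nat.mul_le_mul_left _ hle

/-- The element of the chain whose index is `chosen`. -/
def chosenProd (K : ℕ) (w : List UnarySymbol) : ℕ := ∏ p ∈ factors K w (chosen K w), p

theorem chosenProd_pos (w : List UnarySymbol) : 0 < chosenProd K w :=
  Finset.prod_pos fun _ hp => (prime_of_mem_factors hp).pos

/-- The chosen element is the last one that passes, so that the fraction is reliable for it. -/
theorem numSolutions_lt_chosenProd (hK : 1 ≤ K) (h : Passes K I.encode (chosen K I.encode)) :
    denom K I.encode * I.numSolutions + (bound K I.encode + 1) * chosenProd K I.encode <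
      denom K I.encode * chosenProd K I.encode := by
  obtain ⟨hr, hX, -⟩ := id h
  set t := chosen K I.encode with ht
  have hle : t ≤ (smallBound K I.encode + 1) * (bound K I.encode + 1) - 1 :=
    Nat.findGreatest_le _
  have hj : t / (bound K I.encode + 1) ≤ smallBound K I.encode := by
    refine Nat.le_of_lt_succ ((Nat.div_lt_iff_lt_mul (Nat.succ_pos _)).2 ?_)
    have : 0 < (smallBound K I.encode + 1) * (bound K I.encode + 1) := by positivity
    change _ < (smallBound K I.encode + 1) * (bound K I.encode + 1)
    omega
  have hY : t % (bound K I.encode + 1) ≤ bound K I.encode :=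
    Nat.le_of_lt_succ (Nat.mod_lt _ (Nat.succ_pos _))
  have := fraction_lt_of_forall_not_passes hK hj hr hX hY fun t' ht' ht'' => by
    rw [Nat.div_add_mod'] at ht'
    exact Nat.findGreatest_is_greatest ht' ht''
  rwa [← prod_factors hj hr hX hY, Nat.div_add_mod'] at this

theorem chosenFraction_bounds (hK : 1 ≤ K) (h : Passes K I.encode (chosen K I.encode)) :
    denom K I.encode * I.numSolutions ≤
        chosenProd K I.encode * chainFraction K I.encode (chosen K I.encode) ∧
      chosenProd K I.encode * chainFraction K I.encode (chosen K I.encode) ≤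
        denom K I.encode * I.numSolutions + (bound K I.encode + 1) * chosenProd K I.encode :=
  chainFraction_bounds hK h.2.1 (numSolutions_lt_chosenProd hK h)

/-- Passing the test means that the fraction is above `1 / 2`. -/
theorem chosenProd_lt (hK : 1 ≤ K) (h : Passes K I.encode (chosen K I.encode)) :
    I.numSolutions < chosenProd K I.encode ∧ chosenProd K I.encode < 2 * I.numSolutions := by
  have h₁ := numSolutions_lt_chosenProd hK h
  have h₂ := (chosenFraction_bounds hK h).2
  constructor
  · exact lt_of_mul_lt_mul_left ((Nat.le_add_right _ _).trans_lt h₁) (Nat.zero_le _)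
  · have h₃ := Nat.mul_lt_mul_of_pos_left h.2.2 (chosenProd_pos (K := K) I.encode)
    refine lt_of_mul_lt_mul_left (a := denom K I.encode) ?_ (Nat.zero_le _)
    linarith

/-- If the test is never passed, then the number of solutions is small. -/
theorem smallCount_eq (hK : 1 ≤ K) (h : ¬ Passes K I.encode (chosen K I.encode)) :
    smallCount K I.encode = I.numSolutions ∧ I.numSolutions < bound K I.encode := by
  have hX0 := smallBound_pos K I.encode
  -- the empty product in place of the small primes, and the last prime `r`
  obtain ⟨p, hp, hXp, hpX⟩ := Nat.exists_prime_lt_and_le_two_mul _ hX0.ne'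
  have hpY : p ≤ bound K I.encode := hpX.trans (by unfold bound; nlinarith)
  rw [smallCount]
  set r := Nat.findGreatest (fun p => p.Prime) (bound K I.encode) with hr
  have hrprime : r.Prime := Nat.findGreatest_spec (P := fun p => p.Prime) hpY hp
  have hXr : smallBound K I.encode < r := hXp.trans_le (Nat.le_findGreatest hpY hp)
  have hrY : r ≤ bound K I.encode := Nat.findGreatest_le _
  have hL := le_smallBound hK I.encode
  have := fraction_lt_of_forall_not_passes hK (Nat.zero_le _) hrprime hXr hrY
    fun t _ ht hpass => h (Nat.findGreatest_spec (P := fun t => Passes K I.encode t) ht hpass)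
  have hempty : basePrimes (I.encode.length + 1) 0 = ∅ := by simp [basePrimes]
  rw [hempty, Finset.prod_empty, one_mul] at this
  have hlt : I.numSolutions < r :=
    lt_of_mul_lt_mul_left ((Nat.le_add_right _ _).trans_lt this) (Nat.zero_le _)
  rw [solutionsMod_encode I hrprime (by omega), Nat.mod_eq_of_lt hlt]
  exact ⟨rfl, hlt.trans_le hrY⟩

/-! ### The fraction and the prime factors -/

theorem scale_encode (I : SubsetSum) : scale K I.encode = 2 ^ (K * I.logSize) := by
  have h0 : I.encode.length ≠ 0 := by have := n_lt_length_encode I; omega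
  have : I.encode.length.size = I.logSize := by
    refine le_antisymm (Nat.size_le.2 (Nat.lt_pow_succ_log_self one_lt_two _)) ?_
    exact Nat.succ_le_of_lt (Nat.lt_size.2 (Nat.pow_log_le_self 2 h0))
  rw [scale, this, ← pow_mul, mul_comm]

theorem smallPrime_spec {w : List UnarySymbol} (h : 2 ≤ smallCount K w) :
    (smallPrime K w).Prime ∧ smallCount K w < smallPrime K w ∧
      smallPrime K w < 2 * smallCount K w := by
  obtain ⟨p, hp, hlt, hle⟩ := Nat.exists_prime_lt_and_le_two_mul (smallCount K w) (by omega)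
  have hne : p ≠ 2 * smallCount K w := by
    rintro rfl
    exact Nat.not_prime_mul (by omega) (by omega) hp
  have hle' : p ≤ 2 * smallCount K w - 1 := by omega
  have hbound := Nat.findGreatest_le (P := fun p => p.Prime) (2 * smallCount K w - 1)
  exact ⟨Nat.findGreatest_spec (P := fun p => p.Prime) hle' hp,
    hlt.trans_le (Nat.le_findGreatest (P := fun p => p.Prime) hle' hp), by
      unfold smallPrime; omega⟩

/-- The entries of the second result after the first one. -/
def primeList (K : ℕ) (w : List UnarySymbol) : List ℕ :=
  (List.range (2 * bound K w + 1)).filter fun i => IsEntry K w (i + 1)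

theorem fractionResult_list (w : List UnarySymbol) :
    ((List.range (2 * bound K w + 2)).filter fun i => IsEntry K w i).map (fractionResult K w) =
      fractionResult K w 0 :: primeList K w := by
  have h0 : IsEntry K w 0 := .inl rfl
  rw [List.range_succ_eq_map, List.filter_cons_of_pos (by simpa using h0), List.map_cons,
    List.filter_map, List.map_map]
  congr 1
  exact (List.map_congr_left fun i _ => by simp [fractionResult]).trans (List.map_id _)

theorem prod_primeList (w : List UnarySymbol) : (primeList K w).prod =
    ∏ p ∈ (Finset.range (2 * bound K w + 1)).filter fun i => IsEntry K w (i + 1), p := by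
  rw [← List.map_id (primeList K w), primeList, ← List.prod_toFinset id
    (List.nodup_range.filter _), List.toFinset_filter, List.toFinset_range]
  simp

/-- The requirements on the second result, with the precision expressed by natural numbers. -/
theorem primeList_spec (hK : 1 ≤ K) (hA : 2 ≤ I.numSolutions) :
    (∀ p ∈ primeList K I.encode, p.Prime) ∧
      I.numSolutions < (primeList K I.encode).prod ∧
      (primeList K I.encode).prod < 2 * I.numSolutions ∧
      fractionResult K I.encode 0 * (primeList K I.encode).prod <
        I.numSolutions * scale K I.encode + (primeList K I.encode).prod ∧
      I.numSolutions * scale K I.encode <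
        fractionResult K I.encode 0 * (primeList K I.encode).prod +
          (primeList K I.encode).prod := by
  rw [prod_primeList, fractionResult, if_pos rfl]
  simp only [primeList, List.mem_filter, IsEntry, Nat.succ_ne_zero, false_or, Nat.add_sub_cancel,
    decide_eq_true_eq]
  by_cases h : Passes K I.encode (chosen K I.encode)
  · simp only [if_pos h]
    have hS : ((Finset.range (2 * bound K I.encode + 1)).filter fun p =>
        IsFactor K I.encode (chosen K I.encode) p ∧ p ≤ bound K I.encode) =
        factors K I.encode (chosen K I.encode) := by
      ext p
      simp only [factors, Finset.mem_filter, Finset.mem_range]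
      constructor
      · rintro ⟨_, h₁, h₂⟩
        exact ⟨by omega, h₁⟩
      · rintro ⟨h₁, h₂⟩
        exact ⟨by omega, h₂, by omega⟩
    rw [hS]
    change (_ ∧ I.numSolutions < chosenProd K I.encode ∧ chosenProd K I.encode < _ ∧
      _ * chosenProd K I.encode < _ + chosenProd K I.encode ∧
      _ < _ * chosenProd K I.encode + chosenProd K I.encode)
    obtain ⟨h₁, h₂⟩ := chosenProd_lt hK h
    obtain ⟨h₃, h₄⟩ := chosenFraction_bounds hK h
    refine ⟨fun p hp => hp.2.1.1, h₁, h₂, ?_⟩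
    have hN := chosenProd_pos (K := K) I.encode
    have hY := bound_pos K I.encode
    rw [denom] at h₃ h₄
    set N := chosenProd K I.encode
    set Q := chainFraction K I.encode (chosen K I.encode)
    set Y := bound K I.encode
    set P := scale K I.encode
    have hE : Y + 1 < 16 * Y ^ 2 := by nlinarith
    set E := 16 * Y ^ 2
    have hq := Nat.div_mul_le_self Q E
    have hq' := Nat.lt_div_mul_add (a := Q) (b := E) (by omega)
    constructor
    · refine lt_of_mul_lt_mul_right (a := E) ?_ (Nat.zero_le _)
      calc Q / E * N * E = N * (Q / E * E) := by ring
        _ ≤ N * Q := Nat.mul_le_mul_left _ hq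
        _ ≤ _ := h₄
        _ < E * P * I.numSolutions + E * N :=
          Nat.add_lt_add_left (Nat.mul_lt_mul_of_pos_right hE hN) _
        _ = _ := by ring
    · refine lt_of_mul_lt_mul_right (a := E) ?_ (Nat.zero_le _)
      calc I.numSolutions * P * E = E * P * I.numSolutions := by ring
        _ ≤ N * Q := h₃
        _ < N * (Q / E * E + E) := Nat.mul_lt_mul_of_pos_left hq' hN
        _ = _ := by ring
  · obtain ⟨hc, hlt⟩ := smallCount_eq hK h
    rw [← hc] at hA hlt ⊢
    obtain ⟨h₁, h₂, h₃⟩ := smallPrime_spec hA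
    simp only [if_neg h]
    have hS : ((Finset.range (2 * bound K I.encode + 1)).filter fun p =>
        p = smallPrime K I.encode) = {smallPrime K I.encode} := by
      ext p
      simp only [Finset.mem_filter, Finset.mem_range, Finset.mem_singleton]
      omega
    rw [hS, Finset.prod_singleton]
    refine ⟨fun p hp => hp.2 ▸ h₁, h₂, h₃, ?_, ?_⟩
    · exact (Nat.div_mul_le_self _ _).trans_lt (Nat.lt_add_of_pos_right h₁.pos)
    · exact Nat.lt_div_mul_add h₁.pos

theorem abs_div_sub_div_lt {A N q P : ℕ} (hN : 0 < N) (hP : 0 < P) (h₁ : q * N < A * P + N)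
    (h₂ : A * P < q * N + N) : |(A : ℝ) / N - q / P| < 1 / P := by
  have hN' : (0 : ℝ) < N := by exact_mod_cast hN
  have hP' : (0 : ℝ) < P := by exact_mod_cast hP
  have h₁' : (q : ℝ) * N < A * P + N := by exact_mod_cast h₁
  have h₂' : (A : ℝ) * P < q * N + N := by exact_mod_cast h₂
  have : (1 : ℝ) / P = N / (N * P) := by field_simp
  rw [div_sub_div _ _ hN'.ne' hP'.ne', this, abs_lt, ← neg_div]
  constructor <;> gcongr <;> linarith

theorem exists_fraction (hK : 1 ≤ K) (hA : 2 ≤ I.numSolutions) :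
    ∃ (q : ℕ) (ps : List ℕ), ((List.range (2 * bound K I.encode + 2)).filter fun i =>
        IsEntry K I.encode i).map (fractionResult K I.encode) = q :: ps ∧
      ps.Nodup ∧ (∀ p ∈ ps, p.Prime) ∧
      I.numSolutions < ps.prod ∧ ps.prod < 2 * I.numSolutions ∧
      |(I.numSolutions : ℝ) / (ps.prod : ℝ) - (q : ℝ) / 2 ^ (K * I.logSize)| <
        1 / 2 ^ (K * I.logSize) := by
  obtain ⟨h₁, h₂, h₃, h₄, h₅⟩ := primeList_spec hK hA
  refine ⟨_, _, fractionResult_list _, List.nodup_range.filter _, h₁, h₂, h₃, ?_⟩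
  have := abs_div_sub_div_lt (by omega) (scale_pos K I.encode) h₄ h₅
  simpa only [scale_encode, Nat.cast_pow, Nat.cast_ofNat] using this

/-! ### The floating point approximation -/

theorem factor_pos (w : List UnarySymbol) (i : ℕ) : 0 < factor K w i := by
  unfold factor
  split_ifs with h
  · exact h.1.pos
  · exact one_pos

theorem prod_factor (w : List UnarySymbol) :
    ∏ i ∈ Finset.range (bound K w + 1), factor K w i = chosenProd K w := by
  simp only [factor]
  rw [chosenProd, factors, Finset.prod_filter]

/-- Rounding up after each multiplication loses a relative accuracy of `1 / mantissaBound`. -/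
theorem mantissa_bounds (w : List UnarySymbol) (i : ℕ) (hi : 2 * i ≤ mantissaBound K w) :
    mantissaBound K w ≤ mantissa K w i ∧
      mantissaBound K w * ∏ j ∈ Finset.range i, factor K w j ≤
        mantissa K w i * 2 ^ exponent K w i ∧
      mantissa K w i * 2 ^ exponent K w i ≤
        (∏ j ∈ Finset.range i, factor K w j) * (mantissaBound K w + 2 * i) := by
  have hH := mantissaBound_pos K w
  induction i with
  | zero => simp [mantissa, exponent]
  | succ i ih =>
    obtain ⟨h₁, h₂, h₃⟩ := ih (by omega)
    rw [mantissa, exponent, Finset.sum_range_succ, ← exponent, Finset.prod_range_succ, pow_add]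
    have hf := factor_pos (K := K) w i
    set f := factor K w i
    set N := ∏ j ∈ Finset.range i, factor K w j
    set H := mantissaBound K w
    set m := mantissa K w i
    set E := 2 ^ exponent K w i
    set k := (m * f / (2 * H)).size with hk
    have hy : H ≤ m * f := h₁.trans (Nat.le_mul_of_pos_right _ hf)
    have hHk : H * 2 ^ k ≤ m * f := by
      rcases hk' : k with _ | l
      · simpa using hy
      · have : 2 ^ l ≤ m * f / (2 * H) := Nat.lt_size.1 (by omega)
        rw [Nat.le_div_iff_mul_le (by omega)] at this
        rw [pow_succ]; linarith
    have hlow := Nat.lt_div_mul_add (a := m * f) (b := 2 ^ k) (by positivity)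
    have hupp := Nat.div_mul_le_self (m * f) (2 ^ k)
    set y := m * f / 2 ^ k with hy'
    refine ⟨?_, ?_, ?_⟩
    · exact ((Nat.le_div_iff_mul_le (by positivity)).2 hHk).trans (Nat.le_succ _)
    · calc H * (N * f) = H * N * f := by ring
        _ ≤ m * E * f := Nat.mul_le_mul_right _ h₂
        _ = m * f * E := by ring
        _ ≤ (y * 2 ^ k + 2 ^ k) * E := Nat.mul_le_mul_right _ hlow.le
        _ = _ := by ring
    · refine le_of_mul_le_mul_left (a := H) ?_ hH
      calc H * ((y + 1) * (E * 2 ^ k)) = E * (H * (y * 2 ^ k) + H * 2 ^ k) := by ring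
        _ ≤ E * (H * (m * f) + m * f) :=
          Nat.mul_le_mul_left _ (Nat.add_le_add (Nat.mul_le_mul_left _ hupp) hHk)
        _ = m * E * (f * (H + 1)) := by ring
        _ ≤ N * (H + 2 * i) * (f * (H + 1)) := Nat.mul_le_mul_right _ h₃
        _ = N * f * ((H + 2 * i) * (H + 1)) := by ring
        _ ≤ N * f * (H * (H + 2 * (i + 1))) := Nat.mul_le_mul_left _ (by nlinarith)
        _ = _ := by ring

theorem lt_two_pow_mul_size (z P : ℕ) (hP : 0 < P) : z < P * 2 ^ (z / P).size := by
  have := Nat.lt_size_self (z / P)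
  rwa [Nat.div_lt_iff_lt_mul hP, mul_comm] at this

theorem le_div_two_pow_size {z b : ℕ} (hb : 1 ≤ b) (h : 2 ^ b ≤ z) :
    2 ^ (b - 1) ≤ z / 2 ^ (z / 2 ^ b).size := by
  obtain ⟨b, rfl⟩ : ∃ c, b = c + 1 := ⟨b - 1, by omega⟩
  have h0 : 0 < (z / 2 ^ (b + 1)).size := Nat.size_pos.2 (Nat.div_pos h (by positivity))
  obtain ⟨k, hk⟩ : ∃ k, (z / 2 ^ (b + 1)).size = k + 1 := ⟨_, (Nat.succ_pred_eq_of_pos h0).symm⟩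
  have : 2 ^ k ≤ z / 2 ^ (b + 1) := Nat.lt_size.1 (by omega)
  rw [Nat.le_div_iff_mul_le (by positivity)] at this
  rw [hk, Nat.le_div_iff_mul_le (by positivity), Nat.add_sub_cancel]
  calc 2 ^ b * 2 ^ (k + 1) = 2 ^ k * 2 ^ (b + 1) := by ring
    _ ≤ z := this

/-- Truncation of a number that is known exactly. -/
theorem significantBits_truncate {b A : ℕ} (hb : 1 ≤ b) :
    SignificantBits b A (A / 2 ^ (A / 2 ^ b).size) (A / 2 ^ b).size := by
  refine ⟨?_, ?_, ?_⟩
  · rw [Nat.div_lt_iff_lt_mul (by positivity)]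
    exact lt_two_pow_mul_size _ _ (by positivity)
  · rcases Nat.lt_or_ge A (2 ^ b) with h | h
    · left; rw [Nat.div_eq_of_lt h, Nat.size_zero]
    · exact .inr (le_div_two_pow_size hb h)
  · have h₁ := Nat.div_mul_le_self A (2 ^ (A / 2 ^ b).size)
    have h₂ := Nat.lt_div_mul_add (a := A) (b := 2 ^ (A / 2 ^ b).size) (by positivity)
    zify at h₁ h₂
    rw [abs_lt]
    constructor <;> push_cast <;> linarith [show (0 : ℤ) < 2 ^ (A / 2 ^ b).size by positivity]

/-- If `z * 2 ^ e / 2 ^ τ` is an upper approximation of `A` with a relative error less than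
`1 / 2 ^ b`, then the truncation of `z` to `b` bits is the mantissa of an approximation of `A`. -/
theorem significantBits_of_approx {b A z e τ : ℕ} (hb : 1 ≤ b) (hz : 2 ^ b ≤ z) (hA : 2 ^ b ≤ A)
    (hlow : 2 ^ τ * A ≤ z * 2 ^ e) (hupp : 2 ^ b * (z * 2 ^ e) ≤ 2 ^ τ * A * (2 ^ b + 1)) :
    SignificantBits b A (z / 2 ^ (z / 2 ^ b).size) (e + (z / 2 ^ b).size - τ) := by
  have hzlt := lt_two_pow_mul_size z (2 ^ b) (by positivity)
  have hM := le_div_two_pow_size hb hz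
  have h₁ := Nat.div_mul_le_self z (2 ^ (z / 2 ^ b).size)
  have h₂ := Nat.lt_div_mul_add (a := z) (b := 2 ^ (z / 2 ^ b).size) (by positivity)
  set k := (z / 2 ^ b).size
  set M := z / 2 ^ k
  have hlt : 2 ^ τ * A < 2 ^ b * 2 ^ (e + k) := by
    calc _ ≤ _ := hlow
      _ < 2 ^ b * 2 ^ k * 2 ^ e := Nat.mul_lt_mul_of_pos_right hzlt (by positivity)
      _ = _ := by ring
  have hτ : τ ≤ e + k := by
    refine ((Nat.pow_lt_pow_iff_right one_lt_two).1 (lt_of_mul_lt_mul_left (a := 2 ^ b) ?_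
      (Nat.zero_le _))).le
    calc 2 ^ b * 2 ^ τ = 2 ^ τ * 2 ^ b := mul_comm _ _
      _ ≤ 2 ^ τ * A := Nat.mul_le_mul_left _ hA
      _ < _ := hlt
  obtain ⟨g, hg⟩ := Nat.exists_eq_add_of_le hτ
  have hg' : e + k - τ = g := by omega
  have hpow : 2 ^ k * 2 ^ e = 2 ^ τ * 2 ^ g := by rw [← pow_add, ← pow_add, add_comm k, hg]
  rw [hg'] at *
  rw [hg, pow_add] at hlt
  refine ⟨(Nat.div_lt_iff_lt_mul (by positivity)).2 hzlt, .inr hM, ?_⟩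
  have h₃ : A < M * 2 ^ g + 2 ^ g := by
    refine lt_of_mul_lt_mul_left (a := 2 ^ τ) ?_ (Nat.zero_le _)
    calc _ ≤ _ := hlow
      _ < (M * 2 ^ k + 2 ^ k) * 2 ^ e := Nat.mul_lt_mul_of_pos_right h₂ (by positivity)
      _ = (M + 1) * (2 ^ k * 2 ^ e) := by ring
      _ = _ := by rw [hpow]; ring
  have h₄ : M * 2 ^ g < A + 2 ^ g := by
    refine lt_of_mul_lt_mul_left (a := 2 ^ b * 2 ^ τ) ?_ (Nat.zero_le _)
    calc 2 ^ b * 2 ^ τ * (M * 2 ^ g) = 2 ^ b * (M * (2 ^ τ * 2 ^ g)) := by ring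
      _ = 2 ^ b * (M * 2 ^ k * 2 ^ e) := by rw [← hpow]; ring
      _ ≤ 2 ^ b * (z * 2 ^ e) := Nat.mul_le_mul_left _ (Nat.mul_le_mul_right _ h₁)
      _ ≤ _ := hupp
      _ = 2 ^ b * 2 ^ τ * A + 2 ^ τ * A := by ring
      _ < 2 ^ b * 2 ^ τ * A + 2 ^ b * (2 ^ τ * 2 ^ g) := Nat.add_lt_add_left hlt _
      _ = _ := by ring
  zify at h₃ h₄
  rw [abs_lt]
  constructor <;> linarith

theorem denom_mul_mantissaBound (I : SubsetSum) :
    denom K I.encode * mantissaBound K I.encode = 2 ^ (155 + 8 * (K * I.logSize)) := by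
  simp only [denom, mantissaBound, bound, smallBound, scale_encode]
  ring

/-- The product of the approximations `Q / D` of `A / N` and `m * E / H` of `N` approximates `A` with
a relative error of at most `1 / P`. -/
theorem approx_of_bounds {A N Q m E D H P Y : ℕ} (hY : 0 < Y) (hP : 0 < P)
    (hD : D = 16 * Y ^ 2 * P) (hH : H = 16 * Y * P) (hN : N ≤ 2 * A) (h₁ : D * A ≤ N * Q)
    (h₂ : N * Q ≤ D * A + (Y + 1) * N) (h₃ : H * N ≤ m * E)
    (h₄ : m * E ≤ N * (H + 2 * (Y + 1))) :
    D * H * A ≤ Q * m * E ∧ P * (Q * m * E) ≤ D * H * A * (P + 1) := by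
  constructor
  · calc D * H * A = H * (D * A) := by ring
      _ ≤ H * (N * Q) := Nat.mul_le_mul_left _ h₁
      _ = Q * (H * N) := by ring
      _ ≤ Q * (m * E) := Nat.mul_le_mul_left _ h₃
      _ = _ := by ring
  · have hη : Y + 1 ≤ 2 * Y := by omega
    have hYP : 0 < Y * P := Nat.mul_pos hY hP
    have key : P * ((D + 2 * (Y + 1)) * (H + 2 * (Y + 1))) ≤ D * H * (P + 1) := by
      have e₁ : 4 * (2 * (Y + 1) * P * H) ≤ D * H := by
        rw [← mul_assoc]
        refine Nat.mul_le_mul_right _ ?_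
        rw [hD]; nlinarith
      have e₂ : 4 * (2 * (Y + 1) * P * D) ≤ D * H := by
        rw [mul_comm D H, ← mul_assoc]
        refine Nat.mul_le_mul_right _ ?_
        rw [hH]; nlinarith
      have e₃ : 4 * (4 * (Y + 1) ^ 2 * P) ≤ D * H := by
        calc 4 * (4 * (Y + 1) ^ 2 * P) ≤ 4 * (4 * (2 * Y) ^ 2 * P) := by gcongr
          _ = 4 * D := by rw [hD]; ring
          _ ≤ H * D := Nat.mul_le_mul_right _ (by rw [hH]; nlinarith)
          _ = _ := mul_comm _ _
      nlinarith
    calc P * (Q * m * E) = P * (Q * (m * E)) := by ring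
      _ ≤ P * (Q * (N * (H + 2 * (Y + 1)))) := by gcongr
      _ = P * (N * Q * (H + 2 * (Y + 1))) := by ring
      _ ≤ P * ((D * A + (Y + 1) * N) * (H + 2 * (Y + 1))) := by gcongr
      _ ≤ P * ((D * A + (Y + 1) * (2 * A)) * (H + 2 * (Y + 1))) := by gcongr
      _ = A * (P * ((D + 2 * (Y + 1)) * (H + 2 * (Y + 1)))) := by ring
      _ ≤ A * (D * H * (P + 1)) := Nat.mul_le_mul_left _ key
      _ = _ := by ring

theorem significantBits_floatResult (hK : 1 ≤ K) : SignificantBits (K * I.logSize) I.numSolutions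
    (floatResult K I.encode 0) (floatResult K I.encode 1) := by
  have hb : 1 ≤ K * I.logSize := Nat.mul_pos hK (Nat.succ_pos _)
  simp only [floatResult, if_neg one_ne_zero]
  by_cases h : Passes K I.encode (chosen K I.encode)
  · simp only [if_pos h]
    rw [denom_mul_mantissaBound, Nat.size_pow, Nat.add_sub_add_right, scale_encode]
    obtain ⟨hr, hX, hQ⟩ := id h
    obtain ⟨h₁, h₂⟩ := chosenProd_lt hK h
    obtain ⟨h₃, h₄⟩ := chosenFraction_bounds hK h
    have hY := bound_pos K I.encode
    have hP := scale_pos K I.encode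
    have hη : 2 * (bound K I.encode + 1) ≤ mantissaBound K I.encode := by
      rw [mantissaBound]; nlinarith
    obtain ⟨h₅, h₆, h₇⟩ := mantissa_bounds (K := K) I.encode _ hη
    rw [prod_factor] at h₆ h₇
    have hmem : chosen K I.encode % (bound K I.encode + 1) ∈
        factors K I.encode (chosen K I.encode) :=
      Finset.mem_filter.2 ⟨Finset.mem_range.2 (Nat.mod_lt _ (Nat.succ_pos _)), hr, .inr rfl⟩
    have hrN : chosen K I.encode % (bound K I.encode + 1) ≤ chosenProd K I.encode :=
      Nat.le_of_dvd (chosenProd_pos _) (Finset.dvd_prod_of_mem _ hmem)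
    have hA : scale K I.encode ≤ I.numSolutions := by
      unfold smallBound at hX; omega
    obtain ⟨h₈, h₉⟩ := approx_of_bounds hY hP (rfl : denom K I.encode = _)
      (rfl : mantissaBound K I.encode = _) h₂.le h₃ h₄ h₆ h₇
    rw [denom_mul_mantissaBound] at h₈ h₉
    rw [unnormalized]
    refine significantBits_of_approx hb ?_ (by rwa [← scale_encode]) h₈ (by rwa [← scale_encode])
    have hQ0 : 0 < chainFraction K I.encode (chosen K I.encode) := by omega
    have hPH : scale K I.encode ≤ mantissaBound K I.encode := by
      rw [mantissaBound]; nlinarith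
    rw [← scale_encode]
    exact (hPH.trans h₅).trans (Nat.le_mul_of_pos_left _ hQ0)
  · simp only [if_neg h]
    rw [(smallCount_eq hK h).1, scale_encode]
    exact significantBits_truncate hb

end LogspaceSubsetSum

theorem mainTheorem5 (K : ℕ) (hK : 1 ≤ K) :
    LogspaceSolvable SubsetSum.encode (fun I l =>
      ∃ M e : ℕ, l = [M, e] ∧ SignificantBits (K * I.logSize) I.numSolutions M e) ∧
    LogspaceSolvable SubsetSum.encode (fun I l =>
      2 ≤ I.numSolutions → ∃ (q : ℕ) (ps : List ℕ), l = q :: ps ∧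
        ps.Nodup ∧ (∀ p ∈ ps, p.Prime) ∧
        I.numSolutions < ps.prod ∧ ps.prod < 2 * I.numSolutions ∧
        |(I.numSolutions : ℝ) / (ps.prod : ℝ) - (q : ℝ) / 2 ^ (K * I.logSize)| <
          1 / 2 ^ (K * I.logSize)) := by
  constructor
  · exact LogspaceSolvable.of_logspaceFun (N := fun _ => 2) (P := fun _ _ => True)
      (LogspaceFun.const 2) LogspaceSubsetSum.logspace_floatResult
      ((LogspacePred.eq (LogspaceFun.const 0) (LogspaceFun.const 0)).of_iff fun _ _ => by simp)
      fun I => ⟨_, _, rfl, LogspaceSubsetSum.significantBits_floatResult hK⟩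
  · exact LogspaceSolvable.of_logspaceFun
      (((LogspaceFun.const 2).mul LogspaceSubsetSum.logspace_bound).add (LogspaceFun.const 2))
      LogspaceSubsetSum.logspace_fractionResult LogspaceSubsetSum.logspace_isEntry
      fun I => LogspaceSubsetSum.exists_fraction hK
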